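/- **Theorem.** $\{\mathrm{CFpoly}\}^{dec} \subseteq \mathrm{NSPACE}(\log^2 n)$: every problem $X \subseteq \{0,1\}^*$ that is decided by some CFpoly program lies in $\mathrm{NSPACE}(\log^2 n)$. The notions used here are as follows. *CF programs.* A CF (cons-free, first-order) program is a nonempty finite sequence of mutually recursive definitions $f\,x_1\ldots x_m = e$ ($m \ge 0$) of distinct functions, with expressions $$e ::= \mathtt{True} \mid \mathtt{False} \mid [\,] \mid x_i \mid \mathtt{not}\ e \mid \mathtt{null}\ e \mid \mathtt{head}\ e \mid \mathtt{tail}\ e \mid \mathtt{if}\ e\ \mathtt{then}\ e\ \mathtt{else}\ e \mid f\,e_1\ldots e_m,$$ where the variables of a right-hand side are among the distinct parameters $x_1,\ldots,x_m$ of its definition, and each call is to a function defined in the program, with as many arguments as that function has parameters. The first definition is that of the entry function, which has exactly one parameter. Values are bits ($1=\mathtt{True}$, $0=\mathtt{False}$) and lists of bits. The semantics is the usual call-by-value big-step semantics: a finite computation tree for $p$ on input $x \in \{0,1\}^*$ is a derivation of $[\![p]\!](x)=v$ whose root has as its only premise the evaluation of the entry function's body with the parameter bound to the list $x$; a constant or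 a variable is evaluated without premises, a base function call with one premise (its operand), a conditional with two (the test and the chosen branch), and a call of an $m$-ary function with $m+1$ (its arguments and the function's body). No rule applies to $\mathtt{head}\,[\,]$, to $\mathtt{tail}\,[\,]$, or to an operand or test of the wrong kind. The program terminates on $x$ if such a tree exists, and the running time is then the number of nodes of the tree. The program decides $X$ if it terminates on every $x \in \{0,1\}^*$, with result $1$ if $x \in X$ and $0$ if $x \notin X$. *CFpoly.* A CFpoly program is a CF program for which there is a polynomial $\pi$ such that on every input $x$ it terminates in time at most $\pi(|x|)$. *Nondeterministic space.* $X \in \mathrm{NSPACE}(s(n))$ means that there is a nondeterministic Turing machine, with a read-only input tape on which the head stays within the input and its two end markers, and with finitely many read-write work tapes over a finite alphabet, such that for every $x \in \{0,1\}^*$ some computation on $x$ reaches an accepting state if and only if $x \in X$, and every computation on $x$ visits $O(s(|x|))$ work tape cells, i.e. at most $C\,s(|x|)+C$ cells for a constant $C$ independent of $x$. -/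

import Mathlib

/-! ## The cons-free first-order language CF -/

/-- CF expressions with `m` variables, over a list of `k` function symbols with given arities.
Every call is to one of the `k` defined functions, with the right number of arguments. -/
inductive CFExpr {k : ℕ} (arity : Fin k → ℕ) (m : ℕ) : Type where
  | tt : CFExpr arity m
  | ff : CFExpr arity m
  | nil : CFExpr arity m
  | var (i : Fin m) : CFExpr arity m
  | not (e : CFExpr arity m) : CFExpr arity m
  | null (e : CFExpr arity m) : CFExpr arity m
  | head (e : CFExpr arity m) : CFExpr arity m
  | tail (e : CFExpr arity m) : CFExpr arity m
  | ite (e₀ e₁ e₂ : CFExpr arity m) : CFExpr arity m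
  | call (f : Fin k) (es : Fin (arity f) → CFExpr arity m) : CFExpr arity m

/-- A CF program: a nonempty finite sequence of mutually recursive function definitions
`f x₁ … xₘ = e`. The first one is the entry function; it has exactly one argument. -/
structure CFProgram where
  /-- the number of definitions that follow the entry definition -/
  numAux : ℕ
  arity : Fin (numAux + 1) → ℕ
  body : (f : Fin (numAux + 1)) → CFExpr arity (arity f)
  arity_entry : arity 0 = 1

/-- Values: bits (`1 = True`, `0 = False`) and lists of bits. -/
inductive CFVal : Type where
  | bit (b : Bool) : CFVal
  | list (l : List Bool) : CFVal

/-- `CFTree p ρ e v` is the type of finite computation trees with root `p, ρ ⊢ e → v`. No rule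
applies to `head []`, to `tail []`, or to an operand of the wrong kind. -/
inductive CFTree (p : CFProgram) :
    {m : ℕ} → (Fin m → CFVal) → CFExpr p.arity m → CFVal → Type where
  | var {m : ℕ} {ρ : Fin m → CFVal} (i : Fin m) : CFTree p ρ (.var i) (ρ i)
  | tt {m : ℕ} {ρ : Fin m → CFVal} : CFTree p ρ .tt (.bit true)
  | ff {m : ℕ} {ρ : Fin m → CFVal} : CFTree p ρ .ff (.bit false)
  | nil {m : ℕ} {ρ : Fin m → CFVal} : CFTree p ρ .nil (.list [])
  | not {m : ℕ} {ρ : Fin m → CFVal} {e : CFExpr p.arity m} {b : Bool}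
      (T : CFTree p ρ e (.bit b)) : CFTree p ρ (.not e) (.bit (!b))
  | nullNil {m : ℕ} {ρ : Fin m → CFVal} {e : CFExpr p.arity m}
      (T : CFTree p ρ e (.list [])) : CFTree p ρ (.null e) (.bit true)
  | nullCons {m : ℕ} {ρ : Fin m → CFVal} {e : CFExpr p.arity m} {b : Bool} {l : List Bool}
      (T : CFTree p ρ e (.list (b :: l))) : CFTree p ρ (.null e) (.bit false)
  | head {m : ℕ} {ρ : Fin m → CFVal} {e : CFExpr p.arity m} {b : Bool} {l : List Bool}
      (T : CFTree p ρ e (.list (b :: l))) : CFTree p ρ (.head e) (.bit b)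
  | tail {m : ℕ} {ρ : Fin m → CFVal} {e : CFExpr p.arity m} {b : Bool} {l : List Bool}
      (T : CFTree p ρ e (.list (b :: l))) : CFTree p ρ (.tail e) (.list l)
  | iteTrue {m : ℕ} {ρ : Fin m → CFVal} {e₀ e₁ e₂ : CFExpr p.arity m} {v : CFVal}
      (T₀ : CFTree p ρ e₀ (.bit true)) (T₁ : CFTree p ρ e₁ v) : CFTree p ρ (.ite e₀ e₁ e₂) v
  | iteFalse {m : ℕ} {ρ : Fin m → CFVal} {e₀ e₁ e₂ : CFExpr p.arity m} {v : CFVal}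
      (T₀ : CFTree p ρ e₀ (.bit false)) (T₂ : CFTree p ρ e₂ v) : CFTree p ρ (.ite e₀ e₁ e₂) v
  | call {m : ℕ} {ρ : Fin m → CFVal} (f : Fin (p.numAux + 1))
      {es : Fin (p.arity f) → CFExpr p.arity m} (w : Fin (p.arity f) → CFVal) {v : CFVal}
      (Ts : (i : Fin (p.arity f)) → CFTree p ρ (es i) (w i))
      (T : CFTree p w (p.body f) v) : CFTree p ρ (.call f es) v

/-- The number of nodes of a computation tree. -/
def CFTree.size {p : CFProgram} {m : ℕ} {ρ : Fin m → CFVal} {e : CFExpr p.arity m} {v : CFVal} :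
    CFTree p ρ e v → ℕ
  | .var _ => 1
  | .tt => 1
  | .ff => 1
  | .nil => 1
  | .not T => T.size + 1
  | .nullNil T => T.size + 1
  | .nullCons T => T.size + 1
  | .head T => T.size + 1
  | .tail T => T.size + 1
  | .iteTrue T₀ T₁ => T₀.size + T₁.size + 1
  | .iteFalse T₀ T₂ => T₀.size + T₂.size + 1
  | .call _ _ Ts T => (∑ i, (Ts i).size) + T.size + 1

/-- `p.RunsTo x v t`: the run of `p` on input `x` terminates with result `v` in time `t`, that is,
there is a computation tree with root `⟦p⟧(x) = v` and `t` nodes. Its root has one premise, in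
which the entry body is evaluated with the only variable bound to `x`. -/
def CFProgram.RunsTo (p : CFProgram) (x : List Bool) (v : CFVal) (t : ℕ) : Prop :=
  ∃ T : CFTree p (fun _ : Fin (p.arity 0) => CFVal.list x) (p.body 0) v, t = T.size + 1

/-- `p` decides `X`: it terminates on every input, with result `1` on members of `X` and `0` on
the other strings. -/
def CFProgram.Decides (p : CFProgram) (X : Set (List Bool)) : Prop :=
  ∀ x : List Bool, (x ∈ X → ∃ t, p.RunsTo x (.bit true) t) ∧
    (x ∉ X → ∃ t, p.RunsTo x (.bit false) t)

/-- CFpoly: the CF programs that terminate on every input, in time polynomial in its length. -/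
def CFpoly : Set CFProgram :=
  {p | ∃ π : Polynomial ℕ, ∀ x : List Bool, ∃ v t, p.RunsTo x v t ∧ t ≤ π.eval x.length}

/-- The problems decided by some program of the class `L`. -/
def decidedBy (L : Set CFProgram) : Set (Set (List Bool)) :=
  {X | ∃ p ∈ L, p.Decides X}

/-! ## Nondeterministic space -/

/-- Symbols on the input tape: the input bits between two end markers. -/
inductive InSym : Type where
  | leftEnd : InSym
  | bit (b : Bool) : InSym
  | rightEnd : InSym

/-- Head moves. -/
inductive HeadMove : Type where
  | left : HeadMove
  | stay : HeadMove
  | right : HeadMove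

/-- A nondeterministic Turing machine with a two-way read-only input tape and finitely many
read-write work tapes, each infinite to the right. -/
structure NTM where
  State : Type
  Sym : Type
  [finiteState : Finite State]
  [finiteSym : Finite Sym]
  numTapes : ℕ
  blank : Sym
  start : State
  accept : Set State
  /-- The possible actions (new state, symbols written, input head move, work head moves), given
  the state, the scanned input symbol and the scanned work symbols. -/
  trans : State → InSym → (Fin numTapes → Sym) →
    Set (State × (Fin numTapes → Sym) × HeadMove × (Fin numTapes → HeadMove))

/-- The configurations, without the input, which never changes. -/
structure NTM.Cfg (M : NTM) where
  state : M.State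
  inPos : ℕ
  tape : Fin M.numTapes → ℕ → M.Sym
  pos : Fin M.numTapes → ℕ

/-- The symbol in cell `i` of the input tape: the left end marker in cell `0`, then `x`, then the
right end marker in cell `|x| + 1`. -/
def inputSym (x : List Bool) : ℕ → InSym
  | 0 => .leftEnd
  | i + 1 => if h : i < x.length then .bit x[i] else .rightEnd

/-- A move on a tape with cells `0, 1, 2, …`; a left move in cell `0` leaves the head there. -/
def HeadMove.apply : HeadMove → ℕ → ℕ
  | .left, i => i - 1
  | .stay, i => i
  | .right, i => i + 1

def NTM.init (M : NTM) : M.Cfg where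
  state := M.start
  inPos := 0
  tape := fun _ _ => M.blank
  pos := fun _ => 0

/-- One step on input `x`. The input head cannot move past the right end marker. -/
def NTM.Step (M : NTM) (x : List Bool) (c c' : M.Cfg) : Prop :=
  ∃ (q : M.State) (w : Fin M.numTapes → M.Sym) (d : HeadMove) (ds : Fin M.numTapes → HeadMove),
    (q, w, d, ds) ∈ M.trans c.state (inputSym x c.inPos) (fun i => c.tape i (c.pos i)) ∧
    c' = { state := q
           inPos := min (d.apply c.inPos) (x.length + 1)
           tape := fun i => Function.update (c.tape i) (c.pos i) (w i)
           pos := fun i => (ds i).apply (c.pos i) }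

/-- `c` occurs in some computation of `M` on input `x`. -/
def NTM.Reachable (M : NTM) (x : List Bool) (c : M.Cfg) : Prop :=
  Relation.ReflTransGen (M.Step x) M.init c

/-- `M` accepts `x` if some computation on `x` reaches an accepting state. -/
def NTM.Accepts (M : NTM) (x : List Bool) : Prop :=
  ∃ c, M.Reachable x c ∧ c.state ∈ M.accept

/-- In no computation on input `x` does `M` visit more than the first `s` cells of any work
tape. -/
def NTM.SpaceAtMost (M : NTM) (x : List Bool) (s : ℕ) : Prop :=
  ∀ c, M.Reachable x c → ∀ i, c.pos i < s

/-- `NSPACE(s(n))`: the problems `X` for which some nondeterministic Turing machine accepts exactly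
the members of `X` and uses `O(s(n))` work tape cells on every input of length `n`, whatever
choices it makes. -/
def NSPACE (s : ℕ → ℕ) : Set (Set (List Bool)) :=
  {X | ∃ M : NTM, (∀ x, x ∈ X ↔ M.Accepts x) ∧
    ∃ c : ℕ, ∀ x : List Bool, M.SpaceAtMost x (c * s x.length + c)}

/-! A cons-free program never builds a list, so every value in a computation on `x` is a bit or a
suffix of `x` (`CFTree.suffixOf`) and is coded by a number at most `x.length + 2`. A judgement, that
is, a subexpression with an environment and a value, therefore takes O(log n) bits. A
nondeterministic machine can verify a judgement by choosing the last rule of its computation tree,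
guessing the values of the arguments of a call, and verifying the premises, which wait on a stack
(`exprRules`).

In a fixed order of the premises the stack could become as high as the tree. The machine guesses the
order instead. If the largest premise comes last, nothing is kept for it on the stack, and each
other premise has less than half the size of the tree. So a tree with `z` nodes and at most `κ`
premises per rule is verified with at most `κ * (Nat.log 2 z + 1)` additional frames
(`exists_steps_pushAll`, `doable_of_tree`). Polynomial time gives `z` polynomial in n, hence O(log
n) frames of O(log n) bits.

The bound must also hold on branches with bad guesses. A width of order log n is computed by
counting the input cells before the verification starts. A register with value `2 ^ d - 1` at stack
height `d` is doubled by every push, and a push that overflows the width is impossible, so the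
height never exceeds the width (`verifier_space`). Conversely an accepting run yields a computation
tree: if the obligations after a step hold, so do those before it, and at acceptance none are left
(`verifier_sound`).

The verifier is written as a register program. Each of its register instructions is one
left-to-right pass over the binary digits with a carry (`exists_cells_iff`), which gives a sweep
machine, and this runs on a Turing machine with one work tape for the current block and one for the
stack (`RegProgram.exists_NTM`). Determinism (`CFTree.unique`) links the tree with result True to
membership and to the time bound. -/

/-! ## Sweep machines

A sweep machine works on one block of cells, which it reads and rewrites from left to right, and a
stack of saved blocks. -/

/-- What happens at the end of a sweep. -/
inductive SweepEnd (Ctl : Type) : Type where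
  | goto (q : Ctl)
  | grow (q : Ctl)
  | pop

/-- In a control state, a sweep machine either inspects the scanned input symbol and moves the input
head, or starts a sweep, possibly saving the block on the stack with a tag. -/
structure SweepMachine where
  Ctl : Type
  Sw : Type
  Cell : Type
  [finiteCtl : Finite Ctl]
  [finiteSw : Finite Sw]
  [finiteCell : Finite Cell]
  start : Ctl
  accept : Set Ctl
  zeroCell : Cell
  look : Ctl → InSym → Set (Ctl × HeadMove)
  begin : Ctl → Set (Option Ctl × Sw)
  sweep : Sw → Cell → Set (Sw × Cell)
  fin : Sw → Set (SweepEnd Ctl)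

namespace SweepMachine

attribute [instance] finiteCtl finiteSw finiteCell

variable (N : SweepMachine)

/-- Configurations; only the first `width` cells of the words matter. -/
structure Cfg where
  ctl : N.Ctl
  inPos : ℕ
  width : ℕ
  word : ℕ → N.Cell
  stack : List (N.Ctl × (ℕ → N.Cell))

/-- `SweepTo i u w u' w'`: sweeping over the first `i` cells of `w` from `u` can end in `u'` and turn
`w` into `w'`. -/
inductive SweepTo : ℕ → N.Sw → (ℕ → N.Cell) → N.Sw → (ℕ → N.Cell) → Prop where
  | zero (u : N.Sw) (w : ℕ → N.Cell) : SweepTo 0 u w u w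
  | step {i : ℕ} {u u' u'' : N.Sw} {w w' : ℕ → N.Cell} {a : N.Cell} (h : SweepTo i u w u' w')
      (ha : (u'', a) ∈ N.sweep u' (w' i)) : SweepTo (i + 1) u w u'' (Function.update w' i a)

variable {N}

/-- Save a word under a tag, if there is one. -/
def save (tag : Option N.Ctl) (w : ℕ → N.Cell) (st : List (N.Ctl × (ℕ → N.Cell))) :
    List (N.Ctl × (ℕ → N.Cell)) :=
  match tag with
  | none => st
  | some t => (t, w) :: st

variable (N)

/-- The saved block is the one from before the sweep, so that each cell can be copied to the stack
in the same pass that rewrites it. -/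
inductive Step (x : List Bool) : N.Cfg → N.Cfg → Prop where
  | look {q q' : N.Ctl} {h W : ℕ} {w : ℕ → N.Cell} {st : List (N.Ctl × (ℕ → N.Cell))}
      {d : HeadMove} (hl : (q', d) ∈ N.look q (inputSym x h)) :
      Step x ⟨q, h, W, w, st⟩ ⟨q', min (d.apply h) (x.length + 1), W, w, st⟩
  | goto {q q' : N.Ctl} {h W : ℕ} {w w' : ℕ → N.Cell} {st : List (N.Ctl × (ℕ → N.Cell))}
      {tag : Option N.Ctl} {u u' : N.Sw} (hb : (tag, u) ∈ N.begin q)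
      (hs : N.SweepTo W u w u' w') (hf : .goto q' ∈ N.fin u') :
      Step x ⟨q, h, W, w, st⟩ ⟨q', h, W, w', save tag w st⟩
  | grow {q q' : N.Ctl} {h W : ℕ} {w w' : ℕ → N.Cell} {st : List (N.Ctl × (ℕ → N.Cell))}
      {tag : Option N.Ctl} {u u' : N.Sw} (hb : (tag, u) ∈ N.begin q)
      (hs : N.SweepTo W u w u' w') (hf : .grow q' ∈ N.fin u') :
      Step x ⟨q, h, W, w, st⟩ ⟨q', h, W + 1, Function.update w' W N.zeroCell, save tag w st⟩
  | pop {q q' : N.Ctl} {h W : ℕ} {w w' w'' : ℕ → N.Cell} {st st' : List (N.Ctl × (ℕ → N.Cell))}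
      {tag : Option N.Ctl} {u u' : N.Sw} (hb : (tag, u) ∈ N.begin q)
      (hs : N.SweepTo W u w u' w') (hf : .pop ∈ N.fin u') (hst : save tag w st = (q', w'') :: st') :
      Step x ⟨q, h, W, w, st⟩ ⟨q', h, W, w'', st'⟩

def init : N.Cfg := ⟨N.start, 0, 1, fun _ => N.zeroCell, []⟩

def Reachable (x : List Bool) (c : N.Cfg) : Prop :=
  Relation.ReflTransGen (N.Step x) N.init c

variable {N}

/-- With an empty block a pop could end without having compared a single tag. -/
theorem Reachable.width_pos {x : List Bool} {c : N.Cfg} (h : N.Reachable x c) : 0 < c.width := by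
  induction h with
  | refl => exact Nat.one_pos
  | tail _ hs ih => cases hs <;> simp_all

theorem length_save_le (tag : Option N.Ctl) (w : ℕ → N.Cell) (st : List (N.Ctl × (ℕ → N.Cell))) :
    (save tag w st).length ≤ st.length + 1 := by
  cases tag <;> simp [save]

/-! ### Simulation by a Turing machine with two work tapes -/

/-- Tape symbols: block cells and the marks around the block on the first tape, cells of saved
blocks with their tags on the second. -/
inductive TSym (N : SweepMachine) : Type where
  | blank
  | left
  | right
  | cell (a : N.Cell)
  | frame (a : N.Cell) (t : N.Ctl)

/-- In `popping q` the return state `q` is a guess: it is made before the frame is read and is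
checked against the tag in every cell of the frame. `growing` only writes the new right mark. -/
inductive TState (N : SweepMachine) : Type where
  | init₀
  | init₁
  | init₂
  | rest (q : N.Ctl)
  | fwd (tag : Option N.Ctl) (u : N.Sw)
  | bwd (q : N.Ctl)
  | popping (q : N.Ctl)
  | growing (q : N.Ctl)

instance : Finite (TSym N) := by
  let F : Option (Option (Option (N.Cell ⊕ N.Cell × N.Ctl))) → TSym N
    | none => .blank
    | some none => .left
    | some (some none) => .right
    | some (some (some (.inl a))) => .cell a
    | some (some (some (.inr (a, t)))) => .frame a t
  refine Finite.of_surjective F fun s => ?_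
  cases s with
  | blank => exact ⟨none, rfl⟩
  | left => exact ⟨some none, rfl⟩
  | right => exact ⟨some (some none), rfl⟩
  | cell a => exact ⟨some (some (some (.inl a))), rfl⟩
  | frame a t => exact ⟨some (some (some (.inr (a, t)))), rfl⟩

instance : Finite (TState N) := by
  let F : Fin 3 ⊕ N.Ctl × Fin 4 ⊕ Option N.Ctl × N.Sw → TState N
    | .inl 0 => .init₀
    | .inl 1 => .init₁
    | .inl 2 => .init₂
    | .inr (.inl (q, 0)) => .rest q
    | .inr (.inl (q, 1)) => .bwd q
    | .inr (.inl (q, 2)) => .popping q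
    | .inr (.inl (q, 3)) => .growing q
    | .inr (.inr (tag, u)) => .fwd tag u
  refine Finite.of_surjective F fun s => ?_
  cases s with
  | init₀ => exact ⟨.inl 0, rfl⟩
  | init₁ => exact ⟨.inl 1, rfl⟩
  | init₂ => exact ⟨.inl 2, rfl⟩
  | rest q => exact ⟨.inr (.inl (q, 0)), rfl⟩
  | bwd q => exact ⟨.inr (.inl (q, 1)), rfl⟩
  | popping q => exact ⟨.inr (.inl (q, 2)), rfl⟩
  | growing q => exact ⟨.inr (.inl (q, 3)), rfl⟩
  | fwd tag u => exact ⟨.inr (.inr (tag, u)), rfl⟩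

/-- The actions of the simulating machine: state, input symbol, scanned work symbols; new state,
written work symbols, moves of the input head and of the work heads. -/
inductive Act (N : SweepMachine) : TState N → InSym → TSym N → TSym N →
    TState N → TSym N → TSym N → HeadMove → HeadMove → HeadMove → Prop where
  | init₀ {σ r s} : Act N .init₀ σ r s .init₁ .left s .stay .right .right
  | init₁ {σ r s} : Act N .init₁ σ r s .init₂ (.cell N.zeroCell) s .stay .right .stay
  | init₂ {σ r s} : Act N .init₂ σ r s (.bwd N.start) .right s .stay .left .stay
  | look {σ r s q q' d} (h : (q', d) ∈ N.look q σ) :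
      Act N (.rest q) σ r s (.rest q') r s d .stay .stay
  | begin {σ r s q tag u} (h : (tag, u) ∈ N.begin q) :
      Act N (.rest q) σ r s (.fwd tag u) r s .stay .right .stay
  | sweep {σ s u u' a a'} (h : (u', a') ∈ N.sweep u a) :
      Act N (.fwd none u) σ (.cell a) s (.fwd none u') (.cell a') s .stay .right .stay
  | sweepSave {σ s t u u' a a'} (h : (u', a') ∈ N.sweep u a) :
      Act N (.fwd (some t) u) σ (.cell a) s (.fwd (some t) u') (.cell a') (.frame a t)
        .stay .right .right
  | finGoto {σ s tag u q} (h : .goto q ∈ N.fin u) :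
      Act N (.fwd tag u) σ .right s (.bwd q) .right s .stay .left .stay
  | finGrow {σ s tag u q} (h : .grow q ∈ N.fin u) :
      Act N (.fwd tag u) σ .right s (.growing q) (.cell N.zeroCell) s .stay .right .stay
  | finPop {σ s tag u q} (h : .pop ∈ N.fin u) :
      Act N (.fwd tag u) σ .right s (.popping q) .right s .stay .left .left
  | growing {σ r s q} : Act N (.growing q) σ r s (.bwd q) .right s .stay .left .stay
  | bwd {σ s q a} : Act N (.bwd q) σ (.cell a) s (.bwd q) (.cell a) s .stay .left .stay
  | bwdEnd {σ s q} : Act N (.bwd q) σ .left s (.rest q) .left s .stay .stay .stay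
  | popping {σ q a b} :
      Act N (.popping q) σ (.cell a) (.frame b q) (.popping q) (.cell b) (.frame b q)
        .stay .left .left
  | poppingEnd {σ s q} : Act N (.popping q) σ .left s (.rest q) .left s .stay .stay .right

variable (N) in
def toNTM : NTM where
  State := TState N
  Sym := TSym N
  numTapes := 2
  blank := .blank
  start := .init₀
  accept := {s | ∃ q ∈ N.accept, s = .rest q}
  trans s σ r := {a | Act N s σ (r 0) (r 1) a.1 (a.2.1 0) (a.2.1 1) a.2.2.1 (a.2.2.2 0) (a.2.2.2 1)}

/-- The configurations of the simulating machine. -/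
structure TCfg (N : SweepMachine) where
  state : TState N
  inPos : ℕ
  tape : ℕ → TSym N
  tape' : ℕ → TSym N
  pos : ℕ
  pos' : ℕ

def TStep (x : List Bool) (c c' : TCfg N) : Prop :=
  ∃ q r s d e e', Act N c.state (inputSym x c.inPos) (c.tape c.pos) (c.tape' c.pos') q r s d e e' ∧
    c' = ⟨q, min (d.apply c.inPos) (x.length + 1), Function.update c.tape c.pos r,
      Function.update c.tape' c.pos' s, e.apply c.pos, e'.apply c.pos'⟩

def toTCfg (c : N.toNTM.Cfg) : TCfg N :=
  ⟨c.state, c.inPos, c.tape (0 : Fin 2), c.tape (1 : Fin 2), c.pos (0 : Fin 2),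
    c.pos (1 : Fin 2)⟩

def ofTCfg (c : TCfg N) : N.toNTM.Cfg :=
  ⟨c.state, c.inPos, ![c.tape, c.tape'], ![c.pos, c.pos']⟩

theorem tStep_of_step {x : List Bool} {c c' : N.toNTM.Cfg} (h : N.toNTM.Step x c c') :
    TStep x (toTCfg c) (toTCfg c') := by
  obtain ⟨q, w, d, ds, ha, rfl⟩ := h
  exact ⟨q, w (0 : Fin 2), w (1 : Fin 2), d, ds (0 : Fin 2), ds (1 : Fin 2), ha, rfl⟩

theorem step_of_tStep {x : List Bool} {c c' : TCfg N} (h : TStep x c c') :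
    N.toNTM.Step x (ofTCfg c) (ofTCfg c') := by
  obtain ⟨q, r, s, d, e, e', ha, rfl⟩ := h
  refine ⟨q, ![r, s], d, ![e, e'], ha, ?_⟩
  refine congrArg₂ (fun t p => (⟨q, _, t, p⟩ : N.toNTM.Cfg)) ?_ ?_ <;>
    exact funext fun i : Fin 2 => by fin_cases i <;> rfl

variable (N) in
def tInit : TCfg N := ⟨.init₀, 0, fun _ => .blank, fun _ => .blank, 0, 0⟩

theorem ofTCfg_tInit : ofTCfg (tInit N) = N.toNTM.init := by
  refine congrArg₂ (fun t p => (⟨_, _, t, p⟩ : N.toNTM.Cfg)) ?_ ?_ <;>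
    exact funext fun i : Fin 2 => by fin_cases i <;> rfl

def TReachable (x : List Bool) (c : TCfg N) : Prop :=
  Relation.ReflTransGen (TStep x) (tInit N) c

theorem TReachable.reachable {x : List Bool} {c : TCfg N} (h : TReachable x c) :
    N.toNTM.Reachable x (ofTCfg c) := by
  rw [NTM.Reachable, ← ofTCfg_tInit]
  exact Relation.ReflTransGen.lift (ofTCfg (N := N)) (fun _ _ => step_of_tStep) _ _ h

theorem tReachable_of_reachable {x : List Bool} {c : N.toNTM.Cfg} (h : N.toNTM.Reachable x c) :
    TReachable x (toTCfg c) :=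
  Relation.ReflTransGen.lift (toTCfg (N := N)) (fun _ _ => tStep_of_step) _ _ h

/-! ### Invariant of the simulating Turing machine -/

theorem Reachable.inPos_le {x : List Bool} {c : N.Cfg} (h : N.Reachable x c) :
    c.inPos ≤ x.length + 1 := by
  induction h with
  | refl => exact Nat.zero_le _
  | tail _ hs ih => cases hs <;> simp_all

/-- The first tape holds the first `W` cells of `w` between its marks. -/
def BlockOn (R : ℕ → TSym N) (W : ℕ) (w : ℕ → N.Cell) : Prop :=
  R 0 = .left ∧ (∀ i < W, R (i + 1) = .cell (w i)) ∧ R (W + 1) = .right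

/-- The second tape holds the saved words, the bottom of the stack first. -/
def StackOn (S : ℕ → TSym N) (W : ℕ) : List (N.Ctl × (ℕ → N.Cell)) → Prop
  | [] => S 0 = .blank
  | (t, w) :: st => (∀ i < W, S (1 + st.length * W + i) = .frame (w i) t) ∧ StackOn S W st

theorem BlockOn.congr {R : ℕ → TSym N} {W : ℕ} {w w' : ℕ → N.Cell} (h : BlockOn R W w)
    (hw : ∀ i < W, w i = w' i) : BlockOn R W w' :=
  ⟨h.1, fun i hi => by rw [h.2.1 i hi, hw i hi], h.2.2⟩

theorem BlockOn.update {R : ℕ → TSym N} {W : ℕ} {w : ℕ → N.Cell} (h : BlockOn R W w) {i : ℕ}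
    (hi : i < W) (a : N.Cell) :
    BlockOn (Function.update R (i + 1) (.cell a)) W (Function.update w i a) := by
  refine ⟨?_, fun j hj => ?_, ?_⟩
  · rw [Function.update_of_ne (by omega), h.1]
  · by_cases hij : j = i
    · subst hij; simp
    · rw [Function.update_of_ne (by omega), Function.update_of_ne hij, h.2.1 j hj]
  · rw [Function.update_of_ne (by omega), h.2.2]

theorem StackOn.zero {S : ℕ → TSym N} {W : ℕ} {st : List (N.Ctl × (ℕ → N.Cell))}
    (h : StackOn S W st) : S 0 = .blank := by
  induction st with
  | nil => exact h
  | cons f st ih => exact ih h.2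

theorem StackOn.update {S : ℕ → TSym N} {W : ℕ} {st : List (N.Ctl × (ℕ → N.Cell))}
    (h : StackOn S W st) {j : ℕ} (hj : st.length * W < j) (s : TSym N) :
    StackOn (Function.update S j s) W st := by
  induction st with
  | nil => simpa [StackOn, Function.update_of_ne (show (0 : ℕ) ≠ j by simp at hj; omega)] using h
  | cons f st ih =>
    have hl : (st.length + 1) * W = st.length * W + W := by ring
    rw [List.length_cons, hl] at hj
    refine ⟨fun i hi => ?_, ih h.2 (by omega)⟩
    rw [Function.update_of_ne (by omega), h.1 i hi]

/-- Cells ahead of the sweep are untouched; hence what a tagged sweep copies to the stack is the old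
block. -/
theorem SweepTo.eq_of_le {i : ℕ} {u u' : N.Sw} {w w' : ℕ → N.Cell} (h : N.SweepTo i u w u' w') :
    ∀ j, i ≤ j → w' j = w j := by
  induction h with
  | zero => exact fun _ _ => rfl
  | step _ _ ih => exact fun j hj => by rw [Function.update_of_ne (by omega), ih j (by omega)]

/-- How the configurations of the simulating machine relate to those of the sweep machine. -/
inductive Simulates (x : List Bool) : TCfg N → Prop where
  | init₀ {R S : ℕ → TSym N} (hS : S 0 = .blank) : Simulates x ⟨.init₀, 0, R, S, 0, 0⟩
  | init₁ {R S : ℕ → TSym N} (hS : S 0 = .blank) (hR : R 0 = .left) :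
      Simulates x ⟨.init₁, 0, R, S, 1, 1⟩
  | init₂ {R S : ℕ → TSym N} (hS : S 0 = .blank) (hR : R 0 = .left)
      (hR' : R 1 = .cell N.zeroCell) : Simulates x ⟨.init₂, 0, R, S, 2, 1⟩
  | rest {R S : ℕ → TSym N} {q : N.Ctl} {h W : ℕ} {w : ℕ → N.Cell}
      {st : List (N.Ctl × (ℕ → N.Cell))} (hc : N.Reachable x ⟨q, h, W, w, st⟩)
      (hR : BlockOn R W w) (hS : StackOn S W st) :
      Simulates x ⟨.rest q, h, R, S, 0, 1 + st.length * W⟩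
  | bwd {R S : ℕ → TSym N} {q : N.Ctl} {h W i : ℕ} {w : ℕ → N.Cell}
      {st : List (N.Ctl × (ℕ → N.Cell))} (hc : N.Reachable x ⟨q, h, W, w, st⟩)
      (hR : BlockOn R W w) (hS : StackOn S W st) (hi : i ≤ W) :
      Simulates x ⟨.bwd q, h, R, S, i, 1 + st.length * W⟩
  | fwd {R S : ℕ → TSym N} {q : N.Ctl} {h W k : ℕ} {w w' : ℕ → N.Cell}
      {st : List (N.Ctl × (ℕ → N.Cell))} {tag : Option N.Ctl} {u u' : N.Sw}
      (hc : N.Reachable x ⟨q, h, W, w, st⟩) (hb : (tag, u) ∈ N.begin q) (hk : k ≤ W)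
      (hs : N.SweepTo k u w u' w') (hR : BlockOn R W w') (hS : StackOn S W st)
      (hS' : ∀ t, tag = some t → ∀ l < k, S (1 + st.length * W + l) = .frame (w l) t) :
      Simulates x ⟨.fwd tag u', h, R, S, k + 1,
        1 + st.length * W + if tag.isSome then k else 0⟩
  | growing {R S : ℕ → TSym N} {q : N.Ctl} {h W : ℕ} {w : ℕ → N.Cell}
      (hc : N.Reachable x ⟨q, h, W + 1, w, []⟩) (hR : R 0 = .left)
      (hR' : ∀ i < W + 1, R (i + 1) = .cell (w i)) (hS : S 0 = .blank) :
      Simulates x ⟨.growing q, h, R, S, W + 2, 1⟩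
  -- The two heads move back in step; `hj` relates them without subtraction and also covers the
  -- empty stack, where `i` is the width and `j = 0`. Nothing is known about the tag before the
  -- first cell has been compared, hence the restriction in `hv`.
  | popping {R S : ℕ → TSym N} {q : N.Ctl} {c : N.Cfg} {i j : ℕ} {v : ℕ → N.Cell}
      {st : List (N.Ctl × (ℕ → N.Cell))} (hc : N.Reachable x c)
      (hst : st.length ≤ c.stack.length + 1)
      (hpop : ∀ q w st', st = (q, w) :: st' → N.Reachable x ⟨q, c.inPos, c.width, w, st'⟩)
      (hR : BlockOn R c.width v) (hS : StackOn S c.width st) (hi : i ≤ c.width)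
      (hj : j + c.width = st.length * c.width + i)
      (hv : i < c.width → ∃ w st', st = (q, w) :: st' ∧ ∀ l, i ≤ l → l < c.width → v l = w l) :
      Simulates x ⟨.popping q, c.inPos, R, S, i, j⟩

/-- The width grows only while the stack is empty. -/
def GrowsOnlyEmpty (N : SweepMachine) (x : List Bool) : Prop :=
  ∀ c c', N.Reachable x c → N.Step x c c' → c'.width = c.width ∨ c'.stack = []

theorem Simulates.inPos_le {x : List Bool} {c : TCfg N} (h : Simulates x c) :
    c.inPos ≤ x.length + 1 := by
  cases h with
  | init₀ | init₁ | init₂ => exact Nat.zero_le _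
  | rest hc | bwd hc | fwd hc | growing hc | popping hc => exact hc.inPos_le

theorem Simulates.pos_lt {x : List Bool} {c : TCfg N} (h : Simulates x c) {B : ℕ}
    (hB : ∀ c, N.Reachable x c → c.width + 2 < B ∧ (c.stack.length + 1) * c.width + 1 < B) :
    c.pos < B ∧ c.pos' < B := by
  have h0 := hB _ Relation.ReflTransGen.refl
  simp only [init] at h0
  cases h with
  | init₀ | init₁ | init₂ => simp; omega
  | rest hc =>
    have := hB _ hc
    simp only [add_mul, one_mul] at this ⊢
    omega
  | bwd hc =>
    have := hB _ hc
    simp only [add_mul, one_mul] at this ⊢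
    omega
  | fwd hc =>
    have := hB _ hc
    simp only [add_mul, one_mul] at this ⊢
    split_ifs <;> omega
  | growing hc =>
    have := hB _ hc
    simp at this ⊢
    omega
  | @popping _ _ _ c _ _ _ _ hc hst =>
    have := hB _ hc
    have h2 := Nat.mul_le_mul_right c.width hst
    simp only [add_mul, one_mul] at this h2 ⊢
    omega

/-- The scanned mark tells where the first head is: the left mark stands only in front of the block
and the right mark only behind it. So no choice of actions leaves a pass early or runs beyond the
block. -/
theorem Simulates.step {x : List Bool} {c c' : TCfg N} (hg : GrowsOnlyEmpty N x)
    (h : Simulates x c) (hs : TStep x c c') : Simulates x c' := by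
  obtain ⟨q', r', s', d, e, e', ha, rfl⟩ := hs
  have hmin : min c.inPos (x.length + 1) = c.inPos := min_eq_left h.inPos_le
  generalize hr : c.tape c.pos = r at ha
  generalize ht : c.tape' c.pos' = s at ha
  cases h with
  | init₀ hS =>
    cases ha
    subst ht
    simp only [HeadMove.apply, hmin, Function.update_eq_self] at *
    exact .init₁ hS (Function.update_self _ _ _)
  | init₁ hS hR =>
    cases ha
    subst ht
    simp only [HeadMove.apply, hmin, Function.update_eq_self] at *
    exact .init₂ hS (by rw [Function.update_of_ne (by omega), hR]) (Function.update_self _ _ _)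
  | init₂ hS hR hR' =>
    cases ha
    subst ht
    simp only [HeadMove.apply, hmin, Function.update_eq_self] at *
    refine .bwd (W := 1) (w := fun _ => N.zeroCell) (st := []) Relation.ReflTransGen.refl
      ⟨?_, ?_, ?_⟩ hS le_rfl
    · rw [Function.update_of_ne (by omega), hR]
    · intro i hi
      rw [Function.update_of_ne (by omega), show i = 0 by omega, hR']
    · exact Function.update_self _ _ _
  | rest hc hR hS =>
    cases ha with
    | look hl =>
      subst hr ht
      simp only [HeadMove.apply, Function.update_eq_self] at *
      exact .rest (hc.tail (.look hl)) hR hS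
    | @begin _ _ _ _ tag u hb =>
      subst hr ht
      simp only [HeadMove.apply, hmin, Function.update_eq_self] at *
      have := Simulates.fwd hc hb (Nat.zero_le _) (.zero u _) hR hS (by simp)
      simpa using this
  | @bwd _ _ _ _ W i _ _ hc hR hS hi =>
    cases ha with
    | bwd =>
      simp only [HeadMove.apply, hmin] at *
      rw [← hr, ← ht, Function.update_eq_self, Function.update_eq_self]
      exact .bwd hc hR hS (by omega)
    | bwdEnd =>
      simp only [HeadMove.apply, hmin] at *
      rw [← hr, ← ht, Function.update_eq_self, Function.update_eq_self]
      have : i = 0 := by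
        by_contra h0
        have := hR.2.1 (i - 1) (by omega)
        rw [Nat.sub_add_cancel (by omega), hr] at this
        cases this
      subst this
      exact .rest hc hR hS
  | @growing R S _ _ W w hc hR hR' hS =>
    cases ha
    subst ht
    simp only [HeadMove.apply, hmin, Function.update_eq_self] at *
    have hS' : StackOn S (W + 1) [] := hS
    have hB : BlockOn (Function.update R (W + 2) .right) (W + 1) w := ⟨?_, ?_, ?_⟩
    · simpa using Simulates.bwd hc hB hS' le_rfl
    · rw [Function.update_of_ne (by omega), hR]
    · intro i hi
      rw [Function.update_of_ne (by omega), hR' i hi]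
    · exact Function.update_self _ _ _
  | @fwd R S q h₀ W k w w' st tag u u' hc hb hk hs hR hS hS' =>
    have hlt : ∀ a, r = .cell a → k < W := by
      rintro a rfl
      by_contra h0
      have h1 : k = W := by omega
      subst h1
      simp only [hR.2.2] at hr
      cases hr
    have heq : r = .right → k = W := by
      rintro rfl
      by_contra h0
      simp only [hR.2.1 k (by omega)] at hr
      cases hr
    cases ha with
    | @sweep _ _ _ u'' a a' h =>
      have hkW := hlt _ rfl
      simp only [HeadMove.apply, hmin] at *
      rw [← ht, Function.update_eq_self]
      have : w' k = a := by
        have := hR.2.1 k hkW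
        rw [hr] at this
        cases this; rfl
      subst this
      exact .fwd hc hb hkW (hs.step h) (hR.update hkW _) hS (by simp)
    | @sweepSave _ _ t _ u'' a a' h =>
      have hkW := hlt _ rfl
      simp only [HeadMove.apply, hmin] at *
      have : w' k = a := by
        have := hR.2.1 k hkW
        rw [hr] at this
        cases this; rfl
      subst this
      have := Simulates.fwd (S := Function.update S (1 + st.length * W + k) (.frame (w' k) t)) hc hb
        hkW (hs.step h) (hR.update hkW _) (hS.update (by omega) _) (by
          rintro t' ht' l hl
          cases ht'
          by_cases hlk : l = k
          · subst hlk
            simp [hs.eq_of_le l le_rfl]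
          · rw [Function.update_of_ne (by omega)]
            exact hS' t rfl l (by omega))
      simpa [add_assoc] using this
    | @finGoto _ _ _ _ q' h =>
      have := heq rfl
      subst this
      have hc' := hc.tail (Step.goto hb hs h)
      simp only [HeadMove.apply, hmin] at *
      rw [← ht, ← hr, Function.update_eq_self, Function.update_eq_self]
      cases tag with
      | none => exact .bwd hc' hR hS (by simp)
      | some t =>
        have := Simulates.bwd (S := S) hc' hR ⟨hS' t rfl, hS⟩ (i := k) le_rfl
        simpa [save, add_mul, add_assoc] using this
    | @finGrow _ _ _ _ q' hf =>
      have := heq rfl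
      subst this
      have hst := Step.grow (x := x) (h := h₀) (st := st) hb hs hf
      -- Frames are located by multiples of the width, so growth above a nonempty stack would
      -- destroy the layout of the second tape.
      have hst0 : save tag w st = [] := by
        rcases hg _ _ hc hst with h1 | h1
        · simp at h1
        · exact h1
      have hc' := hc.tail hst
      rw [hst0] at hc'
      cases tag with
      | some t => cases hst0
      | none =>
        cases st with
        | cons f st => cases hst0
        | nil =>
          simp only [HeadMove.apply, hmin] at *
          rw [← ht, Function.update_eq_self]
          have := Simulates.growing (R := Function.update R (k + 1) (.cell N.zeroCell)) hc' ?_ ?_ hS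
          · simpa using this
          · rw [Function.update_of_ne (by omega), hR.1]
          · intro i hi
            by_cases hik : i = k
            · subst hik; simp
            · rw [Function.update_of_ne (by omega), Function.update_of_ne hik,
                hR.2.1 i (by omega)]
    | @finPop _ _ _ _ q' h =>
      have := heq rfl
      subst this
      simp only [HeadMove.apply, hmin] at *
      rw [← ht, ← hr, Function.update_eq_self, Function.update_eq_self]
      refine Simulates.popping (c := ⟨q, _, k, w, st⟩) (st := save tag w st) hc
        (length_save_le _ _ _) ?_ hR ?_ (by simp) ?_ (by simp)
      · intro q w'' st' hst
        exact hc.tail (Step.pop hb hs h hst)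
      · cases tag with
        | none => exact hS
        | some t => exact ⟨hS' t rfl, hS⟩
      · cases tag with
        | none => simp [save]
        | some t => simp [save, add_mul]; omega
  | @popping R S q c i j v st hc hst hpop hR hS hi hj hv =>
    cases ha with
    | @popping _ _ a b =>
      simp only [HeadMove.apply, hmin] at *
      rw [← ht, Function.update_eq_self]
      have hi0 : i ≠ 0 := by
        rintro rfl
        rw [hR.1] at hr
        cases hr
      obtain ⟨i, rfl⟩ := Nat.exists_eq_succ_of_ne_zero hi0
      cases st with
      -- With an empty stack the second head stands on the blank in cell 0, for which `popping` has
      -- no action.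
      | nil =>
        have : j = 0 := by simp at hj; omega
        subst this
        rw [hS.zero] at ht
        cases ht
      | cons f st =>
        obtain ⟨t, w⟩ := f
        have hj' : j = 1 + st.length * c.width + i := by
          simp only [List.length_cons, add_mul] at hj
          omega
        have hfr := hS.1 i (by omega)
        rw [← hj', ht] at hfr
        cases hfr
        refine Simulates.popping hc hst hpop (hR.update (i := i) (by omega) _) hS (by simp; omega)
          (by simp only [Nat.succ_eq_add_one] at hj ⊢; omega) fun _ => ⟨w, st, rfl, ?_⟩
        intro l hl hl'
        simp only [Nat.succ_eq_add_one, Nat.add_sub_cancel] at hl ⊢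
        by_cases hli : l = i
        · subst hli; simp
        · rw [Function.update_of_ne hli]
          obtain ⟨w', st', h1, h2⟩ := hv (by omega)
          cases h1
          exact h2 l (by omega) hl'
    | poppingEnd =>
      simp only [HeadMove.apply, hmin] at *
      rw [← ht, ← hr, Function.update_eq_self, Function.update_eq_self]
      have hi0 : i = 0 := by
        by_contra h0
        have := hR.2.1 (i - 1) (by omega)
        rw [Nat.sub_add_cancel (by omega), hr] at this
        cases this
      subst hi0
      -- At least one cell has been compared, so the guessed return state is the tag of the top
      -- frame.
      obtain ⟨w, st', rfl, h2⟩ := hv hc.width_pos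
      have hj' : j + 1 = 1 + st'.length * c.width := by
        simp only [List.length_cons, add_mul] at hj
        omega
      rw [hj']
      exact .rest (hpop _ _ _ rfl) (hR.congr fun l hl => h2 l (Nat.zero_le _) hl) hS.2

theorem TReachable.simulates {x : List Bool} {c : TCfg N} (hg : GrowsOnlyEmpty N x)
    (h : TReachable x c) : Simulates x c := by
  induction h with
  | refl => exact .init₀ rfl
  | tail _ hs ih => exact ih.step hg hs

/-! ### Runs of the Turing machine for the steps of the sweep machine -/

theorem Act.tStep {x : List Bool} {q q' : TState N} {h i j : ℕ} {R S : ℕ → TSym N}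
    {r' s' : TSym N} {e e' : HeadMove} (hh : h ≤ x.length + 1)
    (ha : Act N q (inputSym x h) (R i) (S j) q' r' s' .stay e e') :
    TStep x ⟨q, h, R, S, i, j⟩
      ⟨q', h, Function.update R i r', Function.update S j s', e.apply i, e'.apply j⟩ :=
  ⟨q', r', s', .stay, e, e', ha, by simp only [HeadMove.apply, min_eq_left hh]⟩

/-- A configuration of the simulating machine that represents one of the sweep machine. -/
inductive Represents : N.Cfg → TCfg N → Prop where
  | mk {R S : ℕ → TSym N} {q : N.Ctl} {h W : ℕ} {w : ℕ → N.Cell}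
      {st : List (N.Ctl × (ℕ → N.Cell))} (hR : BlockOn R W w) (hS : StackOn S W st) :
      Represents ⟨q, h, W, w, st⟩ ⟨.rest q, h, R, S, 0, 1 + st.length * W⟩

theorem bwd_run {x : List Bool} {q : N.Ctl} {h W i j : ℕ} {R S : ℕ → TSym N} {w : ℕ → N.Cell}
    (hh : h ≤ x.length + 1) (hR : BlockOn R W w) (hi : i ≤ W) :
    Relation.ReflTransGen (TStep x) ⟨.bwd q, h, R, S, i, j⟩ ⟨.rest q, h, R, S, 0, j⟩ := by
  induction i with
  | zero =>
    have ha : Act N (.bwd q) (inputSym x h) (R 0) (S j) (.rest q) (R 0) (S j) .stay .stay .stay := by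
      rw [hR.1]; exact .bwdEnd
    simpa [HeadMove.apply] using Relation.ReflTransGen.single (ha.tStep hh)
  | succ i ih =>
    have ha : Act N (.bwd q) (inputSym x h) (R (i + 1)) (S j) (.bwd q) (R (i + 1)) (S j)
        .stay .left .stay := by
      rw [hR.2.1 i (by omega)]; exact .bwd
    refine .head (ha.tStep hh) ?_
    simpa [HeadMove.apply] using ih (by omega)

theorem sweep_run {x : List Bool} {h W k : ℕ} {R S : ℕ → TSym N} {u u' : N.Sw} {w w' : ℕ → N.Cell}
    {st : List (N.Ctl × (ℕ → N.Cell))} (tag : Option N.Ctl)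
    (hh : h ≤ x.length + 1) (hs : N.SweepTo k u w u' w') (hk : k ≤ W)
    (hR : BlockOn R W w) (hS : StackOn S W st) :
    ∃ R' S', Relation.ReflTransGen (TStep x) ⟨.fwd tag u, h, R, S, 1, 1 + st.length * W⟩
        ⟨.fwd tag u', h, R', S', k + 1, 1 + st.length * W + if tag.isSome then k else 0⟩ ∧
      BlockOn R' W w' ∧ StackOn S' W st ∧
      ∀ t, tag = some t → ∀ l < k, S' (1 + st.length * W + l) = .frame (w l) t := by
  induction hs with
  | zero => exact ⟨R, S, by simpa using Relation.ReflTransGen.refl, hR, hS, by simp⟩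
  | @step i u u' u'' w w' a hs ha ih =>
    obtain ⟨R', S', hrun, hR', hS', hfr⟩ := ih (by omega) hR
    have hRi := hR'.2.1 i (by omega)
    cases tag with
    | none =>
      have hact : Act N (.fwd none u') (inputSym x h) (R' (i + 1)) (S' (1 + st.length * W))
          (.fwd none u'') (.cell a) (S' (1 + st.length * W)) .stay .right .stay := by
        rw [hRi]; exact .sweep ha
      refine ⟨_, S', hrun.tail ?_, hR'.update (by omega) a, hS', by simp⟩
      simpa [HeadMove.apply] using hact.tStep hh
    | some t =>
      have hact : Act N (.fwd (some t) u') (inputSym x h) (R' (i + 1))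
          (S' (1 + st.length * W + i)) (.fwd (some t) u'') (.cell a) (.frame (w' i) t)
          .stay .right .right := by
        rw [hRi]; exact .sweepSave ha
      refine ⟨_, Function.update S' (1 + st.length * W + i) (.frame (w' i) t), hrun.tail ?_,
        hR'.update (by omega) a, hS'.update (by omega) _, ?_⟩
      · simpa [HeadMove.apply, add_assoc] using hact.tStep hh
      · rintro t' ht' l hl
        cases ht'
        by_cases hli : l = i
        · subst hli
          simp [hs.eq_of_le l le_rfl]
        · rw [Function.update_of_ne (by omega)]
          exact hfr t rfl l (by omega)

theorem pop_run {x : List Bool} {q : N.Ctl} {h W i : ℕ} {R S : ℕ → TSym N} {v w : ℕ → N.Cell}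
    {st : List (N.Ctl × (ℕ → N.Cell))} (hh : h ≤ x.length + 1) (hR : BlockOn R W v)
    (hS : StackOn S W ((q, w) :: st)) (hi : i ≤ W) (hv : ∀ l, i ≤ l → l < W → v l = w l) :
    ∃ R', Relation.ReflTransGen (TStep x) ⟨.popping q, h, R, S, i, st.length * W + i⟩
      ⟨.rest q, h, R', S, 0, 1 + st.length * W⟩ ∧ BlockOn R' W w := by
  induction i generalizing R v with
  | zero =>
    have ha : Act N (.popping q) (inputSym x h) (R 0) (S (st.length * W)) (.rest q) (R 0)
        (S (st.length * W)) .stay .stay .right := by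
      rw [hR.1]; exact .poppingEnd
    refine ⟨R, ?_, hR.congr fun l hl => hv l (Nat.zero_le _) hl⟩
    simpa [HeadMove.apply, add_comm 1] using Relation.ReflTransGen.single (ha.tStep hh)
  | succ i ih =>
    have hfr := hS.1 i (by omega)
    rw [show 1 + st.length * W + i = st.length * W + (i + 1) by ring] at hfr
    have ha : Act N (.popping q) (inputSym x h) (R (i + 1)) (S (st.length * W + (i + 1)))
        (.popping q) (.cell (w i)) (S (st.length * W + (i + 1))) .stay .left .left := by
      rw [hR.2.1 i (by omega), hfr]; exact .popping
    obtain ⟨R', hrun, hR'⟩ := ih (hR.update (i := i) (by omega) (w i)) (by omega) (fun l hl hl' => by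
      by_cases hli : l = i
      · subst hli; simp
      · rw [Function.update_of_ne hli]
        exact hv l (by omega) hl')
    refine ⟨R', .head (ha.tStep hh) ?_, hR'⟩
    simpa [HeadMove.apply] using hrun

theorem begin_run {x : List Bool} {h W : ℕ} {R S : ℕ → TSym N} {q : N.Ctl} {u u' : N.Sw}
    {w w' : ℕ → N.Cell} {st : List (N.Ctl × (ℕ → N.Cell))} {tag : Option N.Ctl}
    (hh : h ≤ x.length + 1) (hb : (tag, u) ∈ N.begin q) (hs : N.SweepTo W u w u' w')
    (hR : BlockOn R W w) (hS : StackOn S W st) :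
    ∃ R' S', Relation.ReflTransGen (TStep x) ⟨.rest q, h, R, S, 0, 1 + st.length * W⟩
        ⟨.fwd tag u', h, R', S', W + 1, 1 + (save tag w st).length * W⟩ ∧
      BlockOn R' W w' ∧ StackOn S' W (save tag w st) := by
  obtain ⟨R', S', hrun, hR', hS', hfr⟩ := sweep_run tag hh hs le_rfl hR hS
  refine ⟨R', S', ?_, hR', ?_⟩
  · have ha : Act N (.rest q) (inputSym x h) (R 0) (S (1 + st.length * W)) (.fwd tag u) (R 0)
        (S (1 + st.length * W)) .stay .right .stay := .begin hb
    have h1 := ha.tStep hh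
    simp only [HeadMove.apply, Function.update_eq_self, zero_add] at h1
    refine .head h1 ?_
    convert hrun using 2
    cases tag <;> simp [save, add_mul, add_assoc]
  · cases tag with
    | none => exact hS'
    | some t => exact ⟨hfr t rfl, hS'⟩

theorem Step.exists_run {x : List Bool} {c c' : N.Cfg} (h : N.Step x c c')
    (hh : c.inPos ≤ x.length + 1) (hg : c'.width = c.width ∨ c'.stack = []) {t : TCfg N}
    (ht : Represents c t) : ∃ t', Represents c' t' ∧ Relation.ReflTransGen (TStep x) t t' := by
  cases ht with
  | @mk R S q h W w st hR hS =>
    cases h with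
    | look hl =>
      refine ⟨_, .mk hR hS, .single ⟨_, _, _, _, _, _, .look hl, ?_⟩⟩
      simp [HeadMove.apply]
    | @goto _ q' _ _ _ w' _ tag u u' hb hs hf =>
      obtain ⟨R', S', hrun, hR', hS'⟩ := begin_run hh hb hs hR hS
      have ha (j : ℕ) : Act N (.fwd tag u') (inputSym x h) (R' (W + 1)) (S' j) (.bwd q')
          (R' (W + 1)) (S' j) .stay .left .stay := by
        rw [hR'.2.2]; exact .finGoto hf
      refine ⟨_, .mk hR' hS', hrun.trans (.head ((ha _).tStep hh) ?_)⟩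
      simp only [HeadMove.apply, Function.update_eq_self]
      exact bwd_run hh hR' le_rfl
    | @grow _ q' _ _ _ w' _ tag u u' hb hs hf =>
      obtain ⟨R', S', hrun, hR', hS'⟩ := begin_run hh hb hs hR hS
      have hst : save tag w st = [] := hg.resolve_left (by simp)
      rw [hst] at hrun hS' ⊢
      have hR'' : BlockOn (Function.update (Function.update R' (W + 1) (.cell N.zeroCell))
          (W + 2) .right) (W + 1) (Function.update w' W N.zeroCell) := by
        refine ⟨?_, fun i hi => ?_, Function.update_self _ _ _⟩
        · rw [Function.update_of_ne (by omega), Function.update_of_ne (by omega), hR'.1]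
        · rw [Function.update_of_ne (by omega)]
          by_cases hiW : i = W
          · subst hiW; simp
          · rw [Function.update_of_ne (by omega), Function.update_of_ne hiW, hR'.2.1 i (by omega)]
      have hS'' : StackOn S' (W + 1) [] := hS'
      have ha (j : ℕ) : Act N (.fwd tag u') (inputSym x h) (R' (W + 1)) (S' j) (.growing q')
          (.cell N.zeroCell) (S' j) .stay .right .stay := by
        rw [hR'.2.2]; exact .finGrow hf
      refine ⟨_, .mk hR'' hS'', hrun.trans
        (.head ((ha _).tStep hh) (.head (Act.growing.tStep hh) ?_))⟩
      simp only [HeadMove.apply, Function.update_eq_self]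
      simpa using bwd_run hh hR'' le_rfl
    | @pop _ q' _ _ _ w' w'' _ st' tag u u' hb hs hf hst =>
      obtain ⟨R', S', hrun, hR', hS'⟩ := begin_run hh hb hs hR hS
      rw [hst] at hrun hS'
      obtain ⟨R'', hrun', hR''⟩ := pop_run (x := x) hh hR' hS' le_rfl (by omega)
      have ha (j : ℕ) : Act N (.fwd tag u') (inputSym x h) (R' (W + 1)) (S' j) (.popping q')
          (R' (W + 1)) (S' j) .stay .left .left := by
        rw [hR'.2.2]; exact .finPop hf
      refine ⟨_, .mk hR'' hS'.2, hrun.trans (.head ((ha _).tStep hh) ?_)⟩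
      simp only [HeadMove.apply, Function.update_eq_self]
      convert hrun' using 2
      · rfl
      · change 1 + (st'.length + 1) * W - 1 = st'.length * W + W
        rw [add_mul]
        omega

theorem init_run (x : List Bool) : ∃ t, Represents N.init t ∧ TReachable x t := by
  have hh := Nat.zero_le (x.length + 1)
  refine ⟨_, .mk (R := Function.update (Function.update (Function.update (fun _ => .blank) 0 .left) 1
    (.cell N.zeroCell)) 2 .right) (S := fun _ => .blank) (st := []) ?_ rfl,
    .head (Act.tStep hh .init₀) (.head (Act.tStep hh .init₁) (.head (Act.tStep hh .init₂) ?_))⟩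
  · refine ⟨rfl, fun i hi => ?_, rfl⟩
    rw [show i = 0 by omega]
    rfl
  · simp only [HeadMove.apply, Function.update_eq_self]
    refine bwd_run (W := 1) (w := fun _ => N.zeroCell) hh ⟨rfl, fun i hi => ?_, rfl⟩ le_rfl
    rw [show i = 0 by omega]
    rfl

theorem Reachable.exists_run {x : List Bool} (hg : GrowsOnlyEmpty N x) {c : N.Cfg}
    (h : N.Reachable x c) : ∃ t, Represents c t ∧ TReachable x t := by
  induction h with
  | refl => exact init_run x
  | tail hc hs ih =>
    obtain ⟨t, ht, hr⟩ := ih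
    obtain ⟨t', ht', hr'⟩ := hs.exists_run (Reachable.inPos_le hc) (hg _ _ hc hs) ht
    exact ⟨t', ht', Relation.ReflTransGen.trans hr hr'⟩

theorem accepts_toNTM_iff {x : List Bool} (hg : GrowsOnlyEmpty N x) :
    N.toNTM.Accepts x ↔ ∃ c, N.Reachable x c ∧ c.ctl ∈ N.accept := by
  constructor
  · rintro ⟨c, hc, q, hq, hcq⟩
    have := (tReachable_of_reachable hc).simulates hg
    generalize ht : toTCfg c = t at this
    have hst : t.state = .rest q := by rw [← ht]; exact hcq
    cases this <;> simp at hst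
    subst hst
    exact ⟨_, ‹_›, hq⟩
  · rintro ⟨c, hc, hq⟩
    obtain ⟨t, ht, hr⟩ := hc.exists_run hg
    refine ⟨_, hr.reachable, c.ctl, hq, ?_⟩
    cases ht
    rfl

theorem spaceAtMost_toNTM {x : List Bool} (hg : GrowsOnlyEmpty N x) {B : ℕ}
    (hB : ∀ c, N.Reachable x c → c.width + 2 < B ∧ (c.stack.length + 1) * c.width + 1 < B) :
    N.toNTM.SpaceAtMost x B := by
  intro c hc (i : Fin 2)
  have := ((tReachable_of_reachable hc).simulates hg).pos_lt hB
  fin_cases i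
  · exact this.1
  · exact this.2

end SweepMachine

/-- Every cell is visited once, so a sweep amounts to its sequence of states together with local
conditions. In this form the whole sequence of carries can be named at once. -/
theorem SweepMachine.sweepTo_iff {N : SweepMachine} {k : ℕ} {u u' : N.Sw} {w w' : ℕ → N.Cell} :
    N.SweepTo k u w u' w' ↔ ∃ us : ℕ → N.Sw, us 0 = u ∧ us k = u' ∧
      (∀ j < k, (us (j + 1), w' j) ∈ N.sweep (us j) (w j)) ∧ ∀ j, k ≤ j → w' j = w j := by
  constructor
  · intro h
    induction h with
    | zero u w => exact ⟨fun _ => u, rfl, rfl, by simp, fun _ _ => rfl⟩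
    | @step i u u' u'' w w' a h ha ih =>
      obtain ⟨us, h0, hk, hs, he⟩ := ih
      refine ⟨Function.update us (i + 1) u'', ?_, Function.update_self _ _ _, fun j hj => ?_,
        fun j hj => ?_⟩
      · rw [Function.update_of_ne (by omega), h0]
      · rw [Function.update_of_ne (show j ≠ i + 1 by omega)]
        by_cases hji : j = i
        · subst hji
          rw [Function.update_self, Function.update_self, hk, ← he j le_rfl]
          exact ha
        · rw [Function.update_of_ne (by omega), Function.update_of_ne hji]
          exact hs j (by omega)
      · rw [Function.update_of_ne (by omega), he j (by omega)]
  · rintro ⟨us, rfl, rfl, hs, he⟩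
    -- After `i` cells the word is new to the left of `i` and old from there on.
    have : ∀ i ≤ k, N.SweepTo i (us 0) w (us i) fun j => if j < i then w' j else w j := by
      intro i hi
      induction i with
      | zero => simpa using SweepTo.zero (us 0) w
      | succ i ih =>
        convert (ih (by omega)).step (a := w' i) (u'' := us (i + 1))
          (by simpa using hs i (by omega)) using 1
        funext j
        by_cases hji : j = i
        · subst hji; simp
        · rw [Function.update_of_ne hji]
          by_cases hj : j < i
          · rw [if_pos hj, if_pos (by omega)]
          · rw [if_neg hj, if_neg (by omega)]
    convert this k le_rfl using 1
    funext j
    by_cases hj : j < k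
    · rw [if_pos hj]
    · rw [if_neg hj, he j (by omega)]

/-! ## Register programs

A register program computes with numbers below `2 ^ width` in finitely many registers, and with a
stack of register contents. -/

/-- `dbl r` replaces `r` by `2 * r + 1`; `eq` and `look` are tests; `push t` saves the registers with
a return label `t`, and performs `dbl` on the depth register. -/
inductive Instr (Reg Label : Type) : Type where
  | zero (r : Reg)
  | inc (r : Reg)
  | dbl (r : Reg)
  | eq (r s : Reg)
  | copy (r s : Reg)
  | guess (r : Reg)
  | look (A : Set InSym) (d : HeadMove)
  | push (t : Label)
  | grow

/-- At a label, a register program chooses one of finitely many straight-line codes, and continues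
with a given label or with the one on top of the stack. -/
structure RegProgram where
  Reg : Type
  Label : Type
  [finiteReg : Finite Reg]
  [finiteLabel : Finite Label]
  [decEqReg : DecidableEq Reg]
  rules : Label → List (List (Instr Reg Label) × Option Label)
  start : Label
  accept : Label
  depth : Reg

/-- The head position, the width, the registers and the stack. -/
structure RegStore (Reg Label : Type) where
  inPos : ℕ
  width : ℕ
  reg : Reg → ℕ
  stack : List (Label × (Reg → ℕ))

namespace RegProgram

attribute [instance] finiteReg finiteLabel decEqReg

section Instructions

variable {Reg Label : Type} [DecidableEq Reg] (D : Reg)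

/-- The effect of an instruction on the registers; `D` is the depth register. -/
def Vals (W : ℕ) (ρ ρ' : Reg → ℕ) : Instr Reg Label → Prop
  | .zero r => ρ' = Function.update ρ r 0
  | .inc r => ρ r + 1 < 2 ^ W ∧ ρ' = Function.update ρ r (ρ r + 1)
  | .dbl r => 2 * ρ r + 1 < 2 ^ W ∧ ρ' = Function.update ρ r (2 * ρ r + 1)
  | .eq r s => ρ r = ρ s ∧ ρ' = ρ
  | .copy r s => ρ' = Function.update ρ r (ρ s)
  | .guess r => ∃ a < 2 ^ W, ρ' = Function.update ρ r a
  | .look _ _ => ρ' = ρ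
  | .push _ => 2 * ρ D + 1 < 2 ^ W ∧ ρ' = Function.update ρ D (2 * ρ D + 1)
  | .grow => ρ' = ρ

/-- The effect of an instruction on the rest of the store. -/
def Effect (x : List Bool) (s s' : RegStore Reg Label) : Instr Reg Label → Prop
  | .look A d => inputSym x s.inPos ∈ A ∧ s'.inPos = min (d.apply s.inPos) (x.length + 1) ∧
      s'.width = s.width ∧ s'.stack = s.stack
  | .push t => s'.inPos = s.inPos ∧ s'.width = s.width ∧ s'.stack = (t, s.reg) :: s.stack
  | .grow => s'.inPos = s.inPos ∧ s'.width = s.width + 1 ∧ s'.stack = s.stack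
  | _ => s'.inPos = s.inPos ∧ s'.width = s.width ∧ s'.stack = s.stack

def Rel (x : List Bool) (i : Instr Reg Label) (s s' : RegStore Reg Label) : Prop :=
  Vals D s.width s.reg s'.reg i ∧ Effect x s s' i

end Instructions

variable (P : RegProgram)

abbrev Store : Type := RegStore P.Reg P.Label

structure Cfg where
  code : List (Instr P.Reg P.Label)
  next : Option P.Label
  store : P.Store

inductive Step (x : List Bool) : P.Cfg → P.Cfg → Prop where
  | instr {i : Instr P.Reg P.Label} {l : List (Instr P.Reg P.Label)} {o : Option P.Label}
      {s s' : P.Store} (h : Rel P.depth x i s s') : Step x ⟨i :: l, o, s⟩ ⟨l, o, s'⟩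
  | jump {t : P.Label} {l : List (Instr P.Reg P.Label)} {o : Option P.Label} {s : P.Store}
      (h : (l, o) ∈ P.rules t) : Step x ⟨[], some t, s⟩ ⟨l, o, s⟩
  | ret {h W : ℕ} {ρ ρ' : P.Reg → ℕ} {t : P.Label} {st : List (P.Label × (P.Reg → ℕ))} :
      Step x ⟨[], none, h, W, ρ, (t, ρ') :: st⟩ ⟨[], some t, h, W, ρ', st⟩

def init : P.Cfg := ⟨[], some P.start, 0, 1, fun _ => 0, []⟩

def Reachable (x : List Bool) (c : P.Cfg) : Prop :=
  Relation.ReflTransGen (P.Step x) P.init c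

variable {P}

/-- All numbers are below `2 ^ width`. -/
def _root_.RegStore.Bounded {Reg Label : Type} (s : RegStore Reg Label) : Prop :=
  (∀ r, s.reg r < 2 ^ s.width) ∧ ∀ f ∈ s.stack, ∀ r, f.2 r < 2 ^ s.width

theorem Vals.lt {W : ℕ} {ρ ρ' : P.Reg → ℕ} {i : Instr P.Reg P.Label} (h : Vals P.depth W ρ ρ' i)
    (hρ : ∀ r, ρ r < 2 ^ W) (r : P.Reg) : ρ' r < 2 ^ W := by
  have hu : ∀ r' a, a < 2 ^ W → Function.update ρ r' a r < 2 ^ W := by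
    intro r' a ha
    rw [Function.update_apply]
    split_ifs
    · exact ha
    · exact hρ r
  cases i with
  | zero r => rw [h]; exact hu _ _ (by positivity)
  | inc r | dbl r | push t => rw [h.2]; exact hu _ _ h.1
  | eq _ _ => rw [h.2]; exact hρ r
  | copy r s => rw [h]; exact hu _ _ (hρ _)
  | guess r => obtain ⟨a, ha, rfl⟩ := h; exact hu _ _ ha
  | look A d | grow => rw [h]; exact hρ r

theorem Step.bounded {x : List Bool} {c c' : P.Cfg} (h : P.Step x c c') (hc : c.store.Bounded) :
    c'.store.Bounded := by
  cases h with
  | @instr i l o s s' h =>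
    have h1 := fun r => h.1.lt hc.1 r
    cases i with
    | push t =>
      refine ⟨by simpa [h.2.2.1] using h1, fun f hf r => ?_⟩
      have h2 := h.2.2.2
      simp only [h2, List.mem_cons] at hf
      simp only [h.2.2.1]
      rcases hf with rfl | hf
      · exact hc.1 r
      · exact hc.2 f hf r
    | look A d =>
      refine ⟨by simpa [h.2.2.2.1] using h1, ?_⟩
      simpa [h.2.2.2.1, h.2.2.2.2] using hc.2
    | grow =>
      have h2 : 2 ^ s.width < 2 ^ (s.width + 1) := Nat.pow_lt_pow_right (by omega) (by omega)
      refine ⟨fun r => ?_, fun f hf r => ?_⟩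
      · simp only [h.2.2.1]; exact (h1 r).trans h2
      · simp only [h.2.2.2] at hf
        simp only [h.2.2.1]; exact (hc.2 f hf r).trans h2
    | _ =>
      refine ⟨by simpa [h.2.2.1] using h1, ?_⟩
      simpa [h.2.2.1, h.2.2.2] using hc.2
  | jump h => exact hc
  | ret =>
    exact ⟨hc.2 _ List.mem_cons_self, fun f hf => hc.2 f (List.mem_cons_of_mem _ hf)⟩

theorem Reachable.bounded {x : List Bool} {c : P.Cfg} (h : P.Reachable x c) : c.store.Bounded := by
  induction h with
  | refl => exact ⟨fun _ => by simp [init], by simp [init]⟩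
  | tail _ hs ih => exact hs.bounded ih

/-! ### Bitwise execution -/

/-- The bits of the registers, as a word of cells. -/
def word (ρ : P.Reg → ℕ) (i : ℕ) (r : P.Reg) : Bool := (ρ r).testBit i

theorem word_update (ρ : P.Reg → ℕ) (r : P.Reg) (a i : ℕ) :
    word (Function.update ρ r a) i = Function.update (word ρ i) r (a.testBit i) := by
  funext r'
  by_cases h : r' = r
  · subst h; simp [word]
  · simp [word, h]

theorem testBit_of_lt {a W j : ℕ} (h : a < 2 ^ W) (hj : W ≤ j) : a.testBit j = false :=
  Nat.testBit_lt_two_pow (h.trans_le (Nat.pow_le_pow_right (by omega) hj))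

theorem eq_of_testBit_of_lt {a b W : ℕ} (ha : a < 2 ^ W) (hb : b < 2 ^ W)
    (h : ∀ j < W, a.testBit j = b.testBit j) : a = b := by
  refine Nat.eq_of_testBit_eq fun j => ?_
  by_cases hj : j < W
  · exact h j hj
  · rw [testBit_of_lt ha (by omega), testBit_of_lt hb (by omega)]

/-- When 1 is added, a carry enters bit `j` exactly if all lower bits are 1, that is, if `2 ^ j ∣ a
+ 1`. -/
theorem testBit_succ_carry (a j : ℕ) :
    (a + 1).testBit j = xor (a.testBit j) (decide (2 ^ j ∣ a + 1)) := by
  simp only [Nat.testBit_eq_decide_div_mod_eq, Nat.succ_div]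
  split_ifs with h
  · have := Nat.mod_two_eq_zero_or_one (a / 2 ^ j)
    rcases this with h1 | h1 <;> simp [h, h1, Nat.add_mod]
  · simp [h]

/-- The same carry leaves bit `j` exactly if it has entered and the bit is 1. -/
theorem two_pow_succ_dvd_succ (a j : ℕ) :
    decide (2 ^ (j + 1) ∣ a + 1) = (decide (2 ^ j ∣ a + 1) && a.testBit j) := by
  rw [Bool.eq_iff_iff]
  simp only [Nat.testBit_eq_decide_div_mod_eq, decide_eq_true_eq, Bool.and_eq_true]
  constructor
  · intro h
    have h1 : 2 ^ j ∣ a + 1 := (pow_dvd_pow 2 (by omega)).trans h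
    refine ⟨h1, ?_⟩
    obtain ⟨m, hm⟩ := h
    have h2 : (a + 1) / 2 ^ j = 2 * m := by
      rw [hm, pow_succ, mul_assoc, Nat.mul_div_cancel_left _ (by positivity)]
    rw [Nat.succ_div, if_pos h1] at h2
    omega
  · rintro ⟨h1, h2⟩
    have h3 := Nat.succ_div (a := a) (b := 2 ^ j)
    rw [if_pos h1] at h3
    obtain ⟨m, hm⟩ := h1
    rw [hm, Nat.mul_div_cancel_left _ (by positivity)] at h3
    rw [hm, pow_succ]
    exact Nat.mul_dvd_mul_left _ (by omega)

/-- The action on a cell, with a carry. -/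
def CellRel (c : Bool) (a : P.Reg → Bool) (c' : Bool) (a' : P.Reg → Bool) :
    Instr P.Reg P.Label → Prop
  | .zero r => c' = c ∧ a' = Function.update a r false
  | .inc r => c' = (c && a r) ∧ a' = Function.update a r (xor (a r) c)
  | .dbl r => c' = a r ∧ a' = Function.update a r c
  | .eq r s => c' = c ∧ a r = a s ∧ a' = a
  | .copy r s => c' = c ∧ a' = Function.update a r (a s)
  | .guess r => c' = c ∧ ∃ b, a' = Function.update a r b
  | .look _ _ => c' = c ∧ a' = a
  | .push _ => c' = a P.depth ∧ a' = Function.update a P.depth c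
  | .grow => c' = c ∧ a' = a

/-- Whether a carry is allowed at the end. -/
def CarryOK (c : Bool) : Instr P.Reg P.Label → Prop
  | .inc _ | .dbl _ | .push _ => c = false
  | _ => True

theorem testBit_two_mul_add_one (a j : ℕ) :
    (2 * a + 1).testBit (j + 1) = a.testBit j := by
  rw [Nat.testBit_succ, show (2 * a + 1) / 2 = a by omega]

/-- The value is below `2 ^ (W + 1)`, so overflow is visible in the single bit `W`, the carry left
at the end of the sweep. -/
theorem two_mul_add_one_lt_iff {a W : ℕ} (ha : a < 2 ^ W) :
    2 * a + 1 < 2 ^ W ↔ (2 * a + 1).testBit W = false := by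
  constructor
  · exact fun h => testBit_of_lt h le_rfl
  · intro h
    by_contra h1
    rw [Nat.testBit_eq_decide_div_mod_eq] at h
    have h2 : (2 * a + 1) / 2 ^ W = 1 :=
      Nat.div_eq_of_lt_le (by omega) (by omega)
    simp [h2] at h

theorem succ_lt_iff {a W : ℕ} (ha : a < 2 ^ W) :
    a + 1 < 2 ^ W ↔ decide (2 ^ W ∣ a + 1) = false := by
  rw [decide_eq_false_iff_not]
  constructor
  · exact fun h h1 => absurd (Nat.le_of_dvd (by omega) h1) (by omega)
  · intro h
    by_contra h1
    exact h (by rw [show a + 1 = 2 ^ W by omega])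

theorem word_eq_of_bits {W r} {ρ : P.Reg → ℕ} {w' : ℕ → P.Reg → Bool} {a : ℕ}
    (hρ : ∀ r, ρ r < 2 ^ W) (ha : a < 2 ^ W)
    (h : ∀ j < W, w' j = Function.update (word ρ j) r (a.testBit j))
    (h' : ∀ j, W ≤ j → w' j = word ρ j) : w' = word (Function.update ρ r a) := by
  funext j
  rw [word_update]
  by_cases hj : j < W
  · exact h j hj
  · rw [h' j (by omega), testBit_of_lt ha (by omega), ← testBit_of_lt (hρ r) (show W ≤ j by omega)]
    exact (Function.update_eq_self r (word ρ j)).symm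

theorem carry_dbl {W : ℕ} {a : ℕ} {cs : ℕ → Bool} (h0 : cs 0 = true)
    (hs : ∀ j < W, cs (j + 1) = a.testBit j) : ∀ j ≤ W, cs j = (2 * a + 1).testBit j := by
  intro j hj
  cases j with
  | zero => rw [h0]; simp
  | succ j => rw [hs j (by omega), testBit_two_mul_add_one]

/-- All these operations are computed by finite transducers from the lowest bit upwards. The initial
carry is the 1 that `inc` adds and that `dbl` shifts in. The carries are then forced, being `2 ^ j ∣
a + 1` for `inc` and bit `j` of `2 * a + 1` for `dbl`, and the last one decides about overflow. -/
theorem exists_cells_iff {W : ℕ} {ρ : P.Reg → ℕ} (hρ : ∀ r, ρ r < 2 ^ W)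
    {i : Instr P.Reg P.Label} {w' : ℕ → P.Reg → Bool} :
    (∃ cs : ℕ → Bool, cs 0 = true ∧ (∀ j < W, CellRel (cs j) (word ρ j) (cs (j + 1)) (w' j) i) ∧
      (∀ j, W ≤ j → w' j = word ρ j) ∧ CarryOK (cs W) i) ↔
    ∃ ρ', w' = word ρ' ∧ Vals P.depth W ρ ρ' i := by
  have hge : ∀ {r a}, a < 2 ^ W → ∀ j, W ≤ j → word (Function.update ρ r a) j = word ρ j := by
    intro r a ha j hj
    rw [word_update, testBit_of_lt ha hj, ← testBit_of_lt (hρ r) hj]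
    exact Function.update_eq_self r (word ρ j)
  have hd : ∀ r, (∃ cs : ℕ → Bool, cs 0 = true ∧
      (∀ j < W, cs (j + 1) = word ρ j r ∧ w' j = Function.update (word ρ j) r (cs j)) ∧
      (∀ j, W ≤ j → w' j = word ρ j) ∧ cs W = false) ↔
      ∃ ρ', w' = word ρ' ∧ 2 * ρ r + 1 < 2 ^ W ∧ ρ' = Function.update ρ r (2 * ρ r + 1) := by
    intro r
    constructor
    · rintro ⟨cs, h0, hs, he, hc⟩
      have hcs := carry_dbl h0 fun j hj => (hs j hj).1
      rw [hcs W le_rfl, ← two_mul_add_one_lt_iff (hρ r)] at hc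
      refine ⟨_, word_eq_of_bits hρ hc (fun j hj => ?_) he, hc, rfl⟩
      rw [(hs j hj).2, hcs j hj.le]
    · rintro ⟨_, rfl, hc, rfl⟩
      refine ⟨fun j => (2 * ρ r + 1).testBit j, by simp, fun j hj => ⟨?_, word_update _ _ _ _⟩,
        hge hc, (two_mul_add_one_lt_iff (hρ r)).1 hc⟩
      exact testBit_two_mul_add_one _ _
  have hn : (∀ j < W, w' j = word ρ j) → (∀ j, W ≤ j → w' j = word ρ j) → w' = word ρ := by
    intro h h'
    funext j
    by_cases hj : j < W
    · exact h j hj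
    · exact h' j (by omega)
  cases i with
  | zero r =>
    constructor
    · rintro ⟨cs, -, hs, he, -⟩
      refine ⟨_, word_eq_of_bits hρ (by positivity) (fun j hj => ?_) he, rfl⟩
      rw [(hs j hj).2, Nat.zero_testBit]
    · rintro ⟨_, rfl, rfl⟩
      refine ⟨fun _ => true, rfl, fun j _ => ⟨rfl, ?_⟩, hge (by positivity), trivial⟩
      rw [word_update, Nat.zero_testBit]
  | inc r =>
    constructor
    · rintro ⟨cs, h0, hs, he, hc⟩
      have hcs : ∀ j ≤ W, cs j = decide (2 ^ j ∣ ρ r + 1) := by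
        intro j hj
        induction j with
        | zero => simpa using h0
        | succ j ih =>
          rw [(hs j (by omega)).1, ih (by omega), two_pow_succ_dvd_succ]; rfl
      have hc' : cs W = false := hc
      rw [hcs W le_rfl, ← succ_lt_iff (hρ r)] at hc'
      refine ⟨_, word_eq_of_bits hρ hc' (fun j hj => ?_) he, hc', rfl⟩
      rw [(hs j hj).2, hcs j hj.le, testBit_succ_carry]; rfl
    · rintro ⟨_, rfl, hc, rfl⟩
      refine ⟨fun j => decide (2 ^ j ∣ ρ r + 1), by simp, fun j hj => ⟨?_, ?_⟩, hge hc,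
        (succ_lt_iff (hρ r)).1 hc⟩
      · exact two_pow_succ_dvd_succ _ _
      · rw [word_update, testBit_succ_carry]; rfl
  | dbl r => exact hd r
  | push t => exact hd P.depth
  | eq r s =>
    constructor
    · rintro ⟨cs, -, hs, he, -⟩
      exact ⟨ρ, hn (fun j hj => (hs j hj).2.2) he,
        eq_of_testBit_of_lt (hρ r) (hρ s) fun j hj => (hs j hj).2.1, rfl⟩
    · rintro ⟨_, rfl, h, rfl⟩
      exact ⟨fun _ => true, rfl, fun j _ => ⟨rfl, by simp [word, h], rfl⟩, fun _ _ => rfl, trivial⟩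
  | copy r s =>
    constructor
    · rintro ⟨cs, -, hs, he, -⟩
      exact ⟨_, word_eq_of_bits hρ (hρ s) (fun j hj => (hs j hj).2) he, rfl⟩
    · rintro ⟨_, rfl, rfl⟩
      exact ⟨fun _ => true, rfl, fun j _ => ⟨rfl, word_update _ _ _ _⟩, hge (hρ s), trivial⟩
  | guess r =>
    constructor
    · rintro ⟨cs, -, hs, he, -⟩
      -- The bits chosen cell by cell are collected into one number.
      choose! b hb using fun j hj => (hs j hj).2
      refine ⟨_, word_eq_of_bits hρ (Nat.ofBits_lt_two_pow fun j : Fin W => b j) (fun j hj => ?_) he,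
        _, Nat.ofBits_lt_two_pow _, rfl⟩
      rw [hb j hj, Nat.testBit_ofBits_lt _ _ hj]
    · rintro ⟨_, rfl, a, ha, rfl⟩
      exact ⟨fun _ => true, rfl, fun j _ => ⟨rfl, _, word_update _ _ _ _⟩, hge ha, trivial⟩
  | look A d | grow =>
    constructor
    · rintro ⟨cs, -, hs, he, -⟩
      exact ⟨ρ, hn (fun j hj => (hs j hj).2) he, rfl⟩
    · rintro ⟨_, rfl, h⟩
      cases h
      exact ⟨fun _ => true, rfl, fun j _ => ⟨rfl, rfl⟩, fun _ _ => rfl, trivial⟩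

/-! ### Compilation of register programs into sweep machines -/

variable (P)

/-- The control points of a program: the codes that can remain to be executed. -/
def points : Set (List (Instr P.Reg P.Label) × Option P.Label) :=
  {c | c.1 = []} ∪ {c | ∃ t, ∃ r ∈ P.rules t, c.1 <:+ r.1 ∧ c.2 = r.2}

theorem finite_points : P.points.Finite := by
  refine .union ?_ ?_
  · refine (Set.finite_range fun o : Option P.Label => (([] : List (Instr P.Reg P.Label)), o)).subset ?_
    rintro ⟨l, o⟩ (rfl : l = [])
    exact ⟨o, rfl⟩
  · have : (⋃ t, ⋃ r ∈ {r | r ∈ P.rules t}, ({l | l ∈ r.1.tails} ×ˢ {r.2} :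
        Set (List (Instr P.Reg P.Label) × Option P.Label))).Finite := by
      refine Set.finite_iUnion fun t => Set.Finite.biUnion (List.finite_toSet _) fun r _ => ?_
      exact (List.finite_toSet _).prod (Set.finite_singleton _)
    refine this.subset ?_
    rintro ⟨l, o⟩ ⟨t, r, hr, hl, ho⟩
    simp only [Set.mem_iUnion]
    exact ⟨t, r, hr, by simpa using hl, ho⟩

variable {P}

theorem points_tail {i : Instr P.Reg P.Label} {l : List (Instr P.Reg P.Label)} {o : Option P.Label}
    (h : (i :: l, o) ∈ P.points) : (l, o) ∈ P.points := by
  rcases h with h | ⟨t, r, hr, hl, ho⟩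
  · cases h
  · exact .inr ⟨t, r, hr, (List.suffix_cons i l).trans hl, ho⟩

theorem points_rule {t : P.Label} {r} (h : r ∈ P.rules t) : r ∈ P.points :=
  .inr ⟨t, r, h, List.suffix_rfl, rfl⟩

variable (P)

/-- The control point at a label, or at a return. -/
def atLabel (o : Option P.Label) : P.points := ⟨([], o), .inl rfl⟩

/-- The sweep machine that executes a program. A sweep state consists of the control point at the
beginning of the sweep and a carry. -/
def toSweepMachine : SweepMachine where
  Ctl := P.points
  Sw := P.points × Bool
  Cell := P.Reg → Bool
  finiteCtl := P.finite_points
  finiteSw := by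
    have : Finite P.points := P.finite_points
    infer_instance
  start := P.atLabel (some P.start)
  accept := {P.atLabel (some P.accept)}
  zeroCell := fun _ => false
  look q σ := {a | (∃ A l o, q.1 = (.look A a.2 :: l, o) ∧ σ ∈ A ∧ a.1.1 = (l, o)) ∨
    ∃ t, q.1 = ([], some t) ∧ a.1.1 ∈ P.rules t ∧ a.2 = .stay}
  begin q := {a | a.2 = (q, true) ∧ (match q.1 with
    | ([], none) => a.1 = none
    | ([], some _) => False
    | (.look _ _ :: _, _) => False
    | (.push t :: _, _) => a.1 = some (P.atLabel (some t))
    | _ => a.1 = none)}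
  sweep u a := {b | b.1.1 = u.1 ∧ (match u.1.1.1 with
    | [] => b.1.2 = u.2 ∧ b.2 = a
    | i :: _ => CellRel u.2 a b.1.2 b.2 i)}
  fin u := {e | match u.1.1 with
    | ([], _) => e = .pop
    | (.grow :: l, o) => ∃ q : P.points, q.1 = (l, o) ∧ e = .grow q
    | (i :: l, o) => CarryOK u.2 i ∧ ∃ q : P.points, q.1 = (l, o) ∧ e = .goto q}

variable {P}

def embStack (st : List (P.Label × (P.Reg → ℕ))) :
    List (P.toSweepMachine.Ctl × (ℕ → P.toSweepMachine.Cell)) :=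
  st.map fun f => (P.atLabel (some f.1), word f.2)

/-- The configuration of the sweep machine that represents a store at a control point. -/
def emb (q : P.points) (s : P.Store) : P.toSweepMachine.Cfg :=
  ⟨q, s.inPos, s.width, word s.reg, embStack s.stack⟩

/-- The control point stays fixed during a sweep, so a sweep is nothing but a sequence of carries
and `exists_cells_iff` applies. -/
theorem sweepTo_instr_iff {W : ℕ} {ρ : P.Reg → ℕ} (hρ : ∀ r, ρ r < 2 ^ W)
    {i : Instr P.Reg P.Label} {l : List (Instr P.Reg P.Label)} {o : Option P.Label}
    (hq : (i :: l, o) ∈ P.points) {w' : ℕ → P.Reg → Bool} :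
    (∃ u', P.toSweepMachine.SweepTo W (⟨_, hq⟩, true) (word ρ) u' w' ∧ u'.1 = ⟨_, hq⟩ ∧
      CarryOK u'.2 i) ↔ ∃ ρ', w' = word ρ' ∧ Vals P.depth W ρ ρ' i := by
  rw [← exists_cells_iff hρ]
  constructor
  · rintro ⟨u', h, hu, hc⟩
    obtain ⟨us, h0, hk, hs, he⟩ := SweepMachine.sweepTo_iff.1 h
    have hus : ∀ j ≤ W, (us j).1 = ⟨_, hq⟩ := by
      intro j hj
      induction j with
      | zero => rw [h0]
      | succ j ih => rw [(hs j (by omega)).1, ih (by omega)]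
    refine ⟨fun j => (us j).2, congrArg Prod.snd h0, fun j hj => ?_, he, by subst hk; exact hc⟩
    have := (hs j hj).2
    rwa [hus j hj.le] at this
  · rintro ⟨cs, h0, hs, he, hc⟩
    refine ⟨(⟨_, hq⟩, cs W), SweepMachine.sweepTo_iff.2 ⟨fun j => (⟨_, hq⟩, cs j),
      congrArg (Prod.mk _) h0, rfl,
      fun j hj => ⟨rfl, hs j hj⟩, he⟩, rfl, hc⟩

theorem sweepTo_fst {W : ℕ} {w w' : ℕ → P.Reg → Bool} {u u' : P.toSweepMachine.Sw}
    (h : P.toSweepMachine.SweepTo W u w u' w') : u'.1 = u.1 := by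
  induction h with
  | zero => rfl
  | step _ ha ih => exact ha.1.trans ih

theorem sweepTo_ret (W : ℕ) (w : ℕ → P.Reg → Bool) :
    P.toSweepMachine.SweepTo W (P.atLabel none, true) w (P.atLabel none, true) w :=
  SweepMachine.sweepTo_iff.2 ⟨fun _ => (P.atLabel none, true), rfl, rfl,
    fun _ _ => ⟨rfl, rfl, rfl⟩, fun _ _ => rfl⟩

/-- A fresh cell of zeros is a leading digit and changes no register. -/
theorem word_grow {W : ℕ} {ρ : P.Reg → ℕ} (hρ : ∀ r, ρ r < 2 ^ W) :
    Function.update (word ρ) W (fun _ => false) = word ρ := by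
  rw [Function.update_eq_self_iff]
  funext r
  exact (testBit_of_lt (hρ r) le_rfl).symm

/-- The correspondence is one to one: `look` and jumps are head steps, every other instruction and
every return is one sweep. `Step.of_emb` is the other half of the bisimulation. -/
theorem Step.emb {x : List Bool} {c c' : P.Cfg} (h : P.Step x c c') (hb : c.store.Bounded)
    (hh : c.store.inPos ≤ x.length + 1) (hc : (c.code, c.next) ∈ P.points) :
    ∃ hc' : (c'.code, c'.next) ∈ P.points,
      P.toSweepMachine.Step x (emb ⟨_, hc⟩ c.store) (emb ⟨_, hc'⟩ c'.store) := by
  cases h with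
  | @instr i l o s s' h =>
    obtain ⟨hv, he⟩ := h
    refine ⟨points_tail hc, ?_⟩
    obtain ⟨h, W, ρ, st⟩ := s
    obtain ⟨h', W', ρ', st'⟩ := s'
    obtain ⟨u', hs, hu, hok⟩ := (sweepTo_instr_iff hb.1 hc).2 ⟨ρ', rfl, hv⟩
    obtain ⟨⟨u1, hu1⟩, b⟩ := u'
    cases hu
    cases i with
    | look A d =>
      obtain ⟨hA, h1, h2, h3⟩ := he
      cases hv
      simp only at h1 h2 h3
      subst h1 h2 h3
      exact .look (.inl ⟨A, l, o, rfl, hA, rfl⟩)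
    | push t =>
      obtain ⟨h1, h2, h3⟩ := he
      simp only at h1 h2 h3
      subst h1 h2 h3
      exact SweepMachine.Step.goto (N := P.toSweepMachine) (q := (⟨_, hc⟩ : P.points))
        (q' := (⟨_, points_tail hc⟩ : P.points)) ⟨rfl, rfl⟩ hs ⟨hok, _, rfl, rfl⟩
    | grow =>
      obtain ⟨h1, h2, h3⟩ := he
      simp only at h1 h2 h3
      subst h1 h2 h3
      have := SweepMachine.Step.grow (x := x) (N := P.toSweepMachine) (q := (⟨_, hc⟩ : P.points))
        (q' := (⟨_, points_tail hc⟩ : P.points)) (tag := none) (h := h') (st := embStack st')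
        ⟨rfl, rfl⟩ hs ⟨_, rfl, rfl⟩
      obtain rfl : ρ' = ρ := hv
      -- The word with the appended zero cell equals the old word only propositionally, so the step
      -- is transported along `word_grow`.
      have key : ∀ w, w = word ρ' → P.toSweepMachine.Step x
          (RegProgram.emb ⟨_, hc⟩ ⟨h', W, ρ', st'⟩)
          ⟨(⟨_, points_tail hc⟩ : P.points), h', W + 1, w, embStack st'⟩ →
          P.toSweepMachine.Step x (RegProgram.emb ⟨_, hc⟩ ⟨h', W, ρ', st'⟩)
          (RegProgram.emb ⟨_, points_tail hc⟩ ⟨h', W + 1, ρ', st'⟩) := by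
        rintro _ rfl h
        exact h
      exact key _ (word_grow hb.1) this
    | _ =>
      obtain ⟨h1, h2, h3⟩ := he
      simp only at h1 h2 h3
      subst h1 h2 h3
      exact SweepMachine.Step.goto (N := P.toSweepMachine) (q := (⟨_, hc⟩ : P.points))
        (q' := (⟨_, points_tail hc⟩ : P.points)) (tag := none) ⟨rfl, rfl⟩ hs ⟨hok, _, rfl, rfl⟩
  | @jump t l o s h =>
    refine ⟨points_rule h, ?_⟩
    have := SweepMachine.Step.look (x := x) (N := P.toSweepMachine) (q := (⟨_, hc⟩ : P.points))
        (q' := (⟨_, points_rule h⟩ : P.points)) (h := s.inPos) (W := s.width) (w := word s.reg)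
        (st := embStack s.stack) (d := .stay) (.inr ⟨t, rfl, h, rfl⟩)
    rwa [show min (HeadMove.stay.apply s.inPos) (x.length + 1) = s.inPos from min_eq_left hh] at this
  | @ret h W ρ ρ' t st =>
    exact ⟨.inl rfl, .pop (tag := none) ⟨rfl, rfl⟩ (sweepTo_ret W (word ρ)) rfl rfl⟩

theorem Step.of_emb {x : List Bool} {q : P.points} {s : P.Store} {c' : P.toSweepMachine.Cfg}
    (hb : s.Bounded) (hh : s.inPos ≤ x.length + 1)
    (h : P.toSweepMachine.Step x (RegProgram.emb q s) c') :
    ∃ q' s', c' = RegProgram.emb q' s' ∧ P.Step x ⟨q.1.1, q.1.2, s⟩ ⟨q'.1.1, q'.1.2, s'⟩ := by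
  obtain ⟨⟨l, o⟩, hq⟩ := q
  obtain ⟨h, W, ρ, st⟩ := s
  cases h with
  | @look _ q' _ _ _ _ d hl =>
    obtain ⟨q', hq'⟩ := q'
    rcases hl with ⟨A, l', o', h1, hA, h2⟩ | ⟨t, h1, h2, h3⟩
    · cases h1
      cases h2
      exact ⟨⟨_, hq'⟩, ⟨_, _, _, _⟩, rfl, .instr ⟨rfl, hA, rfl, rfl, rfl⟩⟩
    · cases h1
      cases h3
      refine ⟨⟨_, hq'⟩, ⟨_, _, _, _⟩, ?_, .jump h2⟩
      simp only [HeadMove.apply, min_eq_left hh]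
      rfl
  | @goto _ q' _ _ _ w' _ tag u u' hbg hs hf =>
    obtain ⟨hu, hm⟩ := hbg
    cases hu
    have hu' := sweepTo_fst hs
    obtain ⟨⟨u1, hu1⟩, b⟩ := u'
    cases hu'
    cases l with
    | nil => cases hf
    | cons i l =>
      cases i with
      | look A d => exact hm.elim
      | grow =>
        obtain ⟨q', hq', h⟩ := hf
        cases h
      | push t =>
        obtain ⟨hok, q'', hq', h⟩ := hf
        cases h
        obtain ⟨ρ', rfl, hv⟩ := (sweepTo_instr_iff hb.1 hq).1 ⟨_, hs, rfl, hok⟩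
        obtain ⟨q', hq''⟩ := q'
        cases hq'
        cases hm
        exact ⟨⟨_, hq''⟩, ⟨_, _, _, _⟩, rfl, .instr ⟨hv, rfl, rfl, rfl⟩⟩
      | _ =>
        obtain ⟨hok, q'', hq', h⟩ := hf
        cases h
        obtain ⟨ρ', rfl, hv⟩ := (sweepTo_instr_iff hb.1 hq).1 ⟨_, hs, rfl, hok⟩
        obtain ⟨q', hq''⟩ := q'
        cases hq'
        cases hm
        exact ⟨⟨_, hq''⟩, ⟨_, _, _, _⟩, rfl, .instr ⟨hv, rfl, rfl, rfl⟩⟩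
  | @grow _ q' _ _ _ w' _ tag u u' hbg hs hf =>
    obtain ⟨hu, hm⟩ := hbg
    cases hu
    have hu' := sweepTo_fst hs
    obtain ⟨⟨u1, hu1⟩, b⟩ := u'
    cases hu'
    cases l with
    | nil => cases hf
    | cons i l =>
      cases i with
      | grow =>
        obtain ⟨q'', hq', h⟩ := hf
        cases h
        obtain ⟨ρ', rfl, hv⟩ := (sweepTo_instr_iff hb.1 hq).1 ⟨_, hs, rfl, trivial⟩
        obtain ⟨q', hq''⟩ := q'
        cases hq'
        cases hm
        obtain rfl : ρ' = ρ := hv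
        refine ⟨⟨_, hq''⟩, ⟨_, W + 1, ρ', st⟩, ?_, .instr ⟨rfl, rfl, rfl, rfl⟩⟩
        exact congrArg (fun w => (⟨(⟨_, hq''⟩ : P.points), h, W + 1, w, embStack st⟩ :
          P.toSweepMachine.Cfg)) (word_grow hb.1)
      | _ =>
        obtain ⟨hok, q'', hq', h⟩ := hf
        cases h
  | @pop _ q' _ _ _ w' w'' _ st' tag u u' hbg hs hf hst =>
    obtain ⟨hu, hm⟩ := hbg
    cases hu
    have hu' := sweepTo_fst hs
    obtain ⟨⟨u1, hu1⟩, b⟩ := u'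
    cases hu'
    cases l with
    | nil =>
      cases o with
      | some t => exact hm.elim
      | none =>
        cases hm
        cases st with
        | nil => cases hst
        | cons f st =>
          cases hst
          exact ⟨P.atLabel (some f.1), ⟨h, W, f.2, st⟩, rfl, .ret⟩
    | cons i l =>
      cases i with
      | grow =>
        obtain ⟨q', hq', h⟩ := hf
        cases h
      | _ =>
        obtain ⟨hok, q'', hq', h⟩ := hf
        cases h

theorem Reachable.inPos_le {x : List Bool} {c : P.Cfg} (h : P.Reachable x c) :
    c.store.inPos ≤ x.length + 1 := by
  induction h with
  | refl => exact Nat.zero_le _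
  | tail _ hs ih =>
    cases hs with
    | @instr i _ _ _ _ h =>
      cases i with
      | look A d => exact h.2.2.1.trans_le (min_le_right _ _)
      | _ => exact h.2.1.trans_le ih
    | jump => exact ih
    | ret => exact ih

theorem reachable_toSweepMachine {x : List Bool} {c : P.toSweepMachine.Cfg}
    (h : P.toSweepMachine.Reachable x c) :
    ∃ q s, c = RegProgram.emb q s ∧ P.Reachable x ⟨q.1.1, q.1.2, s⟩ := by
  induction h with
  | refl =>
    refine ⟨P.atLabel (some P.start), ⟨0, 1, fun _ => 0, []⟩, ?_, Relation.ReflTransGen.refl⟩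
    have : word (fun _ : P.Reg => 0) = fun _ _ => false := by
      funext i r
      simp [word]
    simp only [emb, this]
    rfl
  | tail _ hs ih =>
    obtain ⟨q, s, rfl, hr⟩ := ih
    obtain ⟨q', s', h', hs'⟩ := Step.of_emb hr.bounded hr.inPos_le hs
    exact ⟨q', s', h', Relation.ReflTransGen.tail hr hs'⟩

theorem Reachable.toSweepMachine {x : List Bool} {c : P.Cfg} (h : P.Reachable x c) :
    ∃ hc : (c.code, c.next) ∈ P.points,
      P.toSweepMachine.Reachable x (RegProgram.emb ⟨_, hc⟩ c.store) := by
  induction h with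
  | refl =>
    refine ⟨.inl rfl, ?_⟩
    have h1 : word (fun _ : P.Reg => 0) = fun _ _ => false := by
      funext i r
      simp [word]
    have : RegProgram.emb (P.atLabel (some P.start)) ⟨0, 1, fun _ => 0, []⟩ =
        P.toSweepMachine.init := by
      simp only [emb, h1]
      rfl
    change P.toSweepMachine.Reachable x
      (RegProgram.emb (P.atLabel (some P.start)) ⟨0, 1, fun _ => 0, []⟩)
    rw [this]
    exact Relation.ReflTransGen.refl
  | tail hr hs ih =>
    obtain ⟨hc, hr'⟩ := ih
    obtain ⟨hc', hs'⟩ := hs.emb (Reachable.bounded hr) (Reachable.inPos_le hr) hc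
    exact ⟨hc', Relation.ReflTransGen.tail hr' hs'⟩

/-- Turing machines for register programs that grow only with an empty stack. -/
theorem exists_NTM (P : RegProgram) : ∃ M : NTM, ∀ x : List Bool,
    (∀ c l, P.Reachable x c → c.code = .grow :: l → c.store.stack = []) →
    (M.Accepts x ↔ ∃ s, P.Reachable x ⟨[], some P.accept, s⟩) ∧
    ∀ B, (∀ c, P.Reachable x c →
      c.store.width + 2 < B ∧ (c.store.stack.length + 1) * c.store.width + 1 < B) →
      M.SpaceAtMost x B := by
  refine ⟨P.toSweepMachine.toNTM, fun x hg => ?_⟩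
  have hg' : P.toSweepMachine.GrowsOnlyEmpty x := by
    intro c c' hc hs
    obtain ⟨q, s, rfl, hr⟩ := reachable_toSweepMachine hc
    obtain ⟨q', s', rfl, hs'⟩ := Step.of_emb hr.bounded hr.inPos_le hs
    generalize hc0 : (⟨q.1.1, q.1.2, s⟩ : P.Cfg) = c0 at hs' hr
    generalize hc1 : (⟨q'.1.1, q'.1.2, s'⟩ : P.Cfg) = c1 at hs'
    obtain rfl : s = c0.store := by rw [← hc0]
    obtain rfl : s' = c1.store := by rw [← hc1]
    cases hs' with
    | @instr i l _ s s' h =>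
      cases i with
      | grow =>
        right
        have : s'.stack = [] := h.2.2.2.trans (hg _ _ hr rfl)
        simp [RegProgram.emb, embStack, this]
      | look A d => exact .inl h.2.2.2.1
      | _ => exact .inl h.2.2.1
    | jump => exact .inl rfl
    | ret => exact .inl rfl
  refine ⟨?_, fun B hB => ?_⟩
  · rw [SweepMachine.accepts_toNTM_iff hg']
    constructor
    · rintro ⟨c, hc, hq⟩
      obtain ⟨q, s, rfl, hr⟩ := reachable_toSweepMachine hc
      obtain rfl : q = P.atLabel (some P.accept) := hq
      exact ⟨s, hr⟩
    · rintro ⟨s, hs⟩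
      obtain ⟨hc, h⟩ := hs.toSweepMachine
      exact ⟨_, h, rfl⟩
  · refine SweepMachine.spaceAtMost_toNTM hg' fun c hc => ?_
    obtain ⟨q, s, rfl, hr⟩ := reachable_toSweepMachine hc
    simpa [RegProgram.emb, embStack] using hB _ hr

end RegProgram

/-! ## Computation trees -/

/-- Big-step evaluation is deterministic. -/
theorem CFTree.unique {p : CFProgram} {m : ℕ} {ρ : Fin m → CFVal} {e : CFExpr p.arity m}
    {v v' : CFVal} (T : CFTree p ρ e v) (T' : CFTree p ρ e v') : v = v' := by
  induction T generalizing v' with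
  | var | tt | ff | nil => cases T'; rfl
  | not _ ih =>
    cases T' with
    | not S => cases ih S; rfl
  | nullNil _ ih | nullCons _ ih =>
    cases T' with
    | nullNil S => first | rfl | cases ih S
    | nullCons S => first | rfl | cases ih S
  | head _ ih =>
    cases T' with
    | head S => cases ih S; rfl
  | tail _ ih =>
    cases T' with
    | tail S => cases ih S; rfl
  | iteTrue _ _ ih₀ ih₁ | iteFalse _ _ ih₀ ih₁ =>
    cases T' with
    | iteTrue S₀ S₁ => first | exact ih₁ S₁ | cases ih₀ S₀
    | iteFalse S₀ S₁ => first | exact ih₁ S₁ | cases ih₀ S₀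
  | call f w Ts T ihs ih =>
    cases T' with
    | call _ w' Ss S =>
      obtain rfl : w = w' := funext fun i => ihs i (Ss i)
      exact ih S

theorem CFTree.size_pos {p : CFProgram} {m : ℕ} {ρ : Fin m → CFVal} {e : CFExpr p.arity m}
    {v : CFVal} (T : CFTree p ρ e v) : 0 < T.size := by
  cases T <;> simp [CFTree.size]

/-- Values of which the lists are suffixes of `x`. -/
def CFVal.SuffixOf (x : List Bool) : CFVal → Prop
  | .bit _ => True
  | .list l => l <:+ x

/-- This is where cons-freeness enters: lists arise only as `[]`, from variables and by `tail`. -/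
theorem CFTree.suffixOf {x : List Bool} {p : CFProgram} {m : ℕ} {ρ : Fin m → CFVal}
    {e : CFExpr p.arity m} {v : CFVal} (T : CFTree p ρ e v) (hρ : ∀ i, (ρ i).SuffixOf x) :
    v.SuffixOf x := by
  induction T with
  | var i => exact hρ i
  | tt | ff | not | nullNil | nullCons | head => exact trivial
  | nil => exact List.nil_suffix
  | tail _ ih => exact (List.suffix_cons _ _).trans (ih hρ)
  | iteTrue _ _ _ ih | iteFalse _ _ _ ih => exact ih hρ
  | call f w Ts T ihs ih => exact ih fun i => ihs i hρ

/-- The value with a given code: the bits have codes `0` and `1`, and the suffixes of `x` the codes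
`2, 3, …` in the order of decreasing length. -/
def decodeVal (x : List Bool) : ℕ → CFVal
  | 0 => .bit false
  | 1 => .bit true
  | k + 2 => .list (x.drop k)

/-- The least code of a suffix. `decodeVal` is total and reads all larger numbers as `[]`, so
guessed numbers need no range check. -/
def codeVal (x : List Bool) : CFVal → ℕ
  | .bit b => b.toNat
  | .list l => x.length - l.length + 2

theorem decodeVal_toNat (x : List Bool) (b : Bool) : decodeVal x b.toNat = .bit b := by
  cases b <;> rfl

theorem codeVal_le (x : List Bool) (v : CFVal) : codeVal x v ≤ x.length + 2 := by
  cases v with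
  | bit b => cases b <;> simp [codeVal]
  | list l => simp [codeVal]

theorem inputSym_eq_leftEnd {x : List Bool} {h : ℕ} : inputSym x h = .leftEnd ↔ h = 0 := by
  cases h with
  | zero => simp [inputSym]
  | succ h => simp only [inputSym]; split_ifs <;> simp

theorem inputSym_eq_rightEnd {x : List Bool} {h : ℕ} :
    inputSym x h = .rightEnd ↔ x.length + 1 ≤ h := by
  cases h with
  | zero => simp [inputSym]
  | succ h => simp only [inputSym]; split_ifs with hx <;> simp <;> omega

theorem inputSym_eq_bit {x : List Bool} {h : ℕ} {b : Bool} :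
    inputSym x h = .bit b ↔ ∃ m, h = m + 1 ∧ x.drop m = b :: x.drop (m + 1) := by
  cases h with
  | zero => simp [inputSym]
  | succ h =>
    simp only [inputSym]
    split_ifs with hx
    · rw [InSym.bit.injEq]
      constructor
      · rintro rfl
        exact ⟨h, rfl, List.drop_eq_getElem_cons hx⟩
      · rintro ⟨m, hm, hd⟩
        obtain rfl : h = m := by omega
        rw [List.drop_eq_getElem_cons hx] at hd
        exact (List.cons.inj hd).1
    · simp only [false_iff, not_exists, not_and]
      rintro m hm hd
      obtain rfl : h = m := by omega
      rw [List.drop_of_length_le (by omega)] at hd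
      cases hd

theorem decodeVal_of_rightEnd {x : List Bool} {h : ℕ} (hs : inputSym x h = .rightEnd) :
    decodeVal x (h + 1) = .list [] := by
  rw [inputSym_eq_rightEnd] at hs
  obtain ⟨m, rfl⟩ : ∃ m, h = m + 1 := ⟨h - 1, by omega⟩
  simp only [decodeVal]
  rw [List.drop_of_length_le (by omega)]

/-- With the head at `h`, the number `h + 1` codes the suffix that begins under the head and `h + 2`
codes its tail. Thus `null`, `head` and `tail` become inspections of the scanned symbol. -/
theorem decodeVal_of_bit {x : List Bool} {h : ℕ} {b : Bool} (hs : inputSym x h = .bit b) :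
    ∃ l, decodeVal x (h + 1) = .list (b :: l) ∧ decodeVal x (h + 2) = .list l := by
  obtain ⟨m, rfl, hd⟩ := inputSym_eq_bit.1 hs
  exact ⟨x.drop (m + 1), by simp only [decodeVal, hd], rfl⟩

theorem exists_pos_of_cons {x l : List Bool} {b : Bool} (hs : (CFVal.list (b :: l)).SuffixOf x) :
    ∃ h ≤ x.length, inputSym x h = .bit b ∧ codeVal x (.list (b :: l)) = h + 1 ∧
      codeVal x (.list l) = h + 2 := by
  obtain ⟨t, rfl⟩ := hs
  refine ⟨t.length + 1, by simp, inputSym_eq_bit.2 ⟨t.length, rfl, by simp⟩, ?_, ?_⟩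
  · simp [codeVal]
  · simp [codeVal]; omega

/-! ## Subexpressions -/

/-- Evaluating a body involves only its subexpressions; there are finitely many, so they can serve
as labels of a program. -/
def CFExpr.subs {k : ℕ} {arity : Fin k → ℕ} {m : ℕ} : CFExpr arity m → Set (CFExpr arity m)
  | .tt => {.tt}
  | .ff => {.ff}
  | .nil => {.nil}
  | .var i => {.var i}
  | .not e => insert (.not e) e.subs
  | .null e => insert (.null e) e.subs
  | .head e => insert (.head e) e.subs
  | .tail e => insert (.tail e) e.subs
  | .ite e₀ e₁ e₂ => insert (.ite e₀ e₁ e₂) (e₀.subs ∪ e₁.subs ∪ e₂.subs)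
  | .call f es => insert (.call f es) (⋃ i, (es i).subs)

namespace CFExpr

variable {k : ℕ} {arity : Fin k → ℕ} {m : ℕ}

theorem mem_subs_self (e : CFExpr arity m) : e ∈ e.subs := by
  cases e <;> simp [subs]

theorem finite_subs (e : CFExpr arity m) : e.subs.Finite := by
  induction e with
  | tt | ff | nil | var => exact Set.finite_singleton _
  | not _ ih | null _ ih | head _ ih | tail _ ih => exact ih.insert _
  | ite _ _ _ ih₀ ih₁ ih₂ => exact ((ih₀.union ih₁).union ih₂).insert _
  | call _ _ ih => exact (Set.finite_iUnion ih).insert _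

theorem subs_subset {e e' : CFExpr arity m} (h : e' ∈ e.subs) : e'.subs ⊆ e.subs := by
  induction e with
  | tt | ff | nil | var => cases h; exact subset_rfl
  | not _ ih | null _ ih | head _ ih | tail _ ih =>
    rcases h with rfl | h
    · exact subset_rfl
    · exact (ih h).trans (Set.subset_insert _ _)
  | ite _ _ _ ih₀ ih₁ ih₂ =>
    rcases h with rfl | (h | h) | h
    · exact subset_rfl
    · exact fun a ha => .inr (.inl (.inl (ih₀ h ha)))
    · exact fun a ha => .inr (.inl (.inr (ih₁ h ha)))
    · exact fun a ha => .inr (.inr (ih₂ h ha))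
  | call _ _ ih =>
    rcases h with rfl | h
    · exact subset_rfl
    · obtain ⟨i, hi⟩ := Set.mem_iUnion.1 h
      exact fun a ha => .inr (Set.mem_iUnion.2 ⟨i, ih i hi ha⟩)

variable {a : CFExpr arity m}

theorem sub_not {e : CFExpr arity m} (h : .not e ∈ a.subs) : e ∈ a.subs :=
  subs_subset h (.inr e.mem_subs_self)

theorem sub_null {e : CFExpr arity m} (h : .null e ∈ a.subs) : e ∈ a.subs :=
  subs_subset h (.inr e.mem_subs_self)

theorem sub_head {e : CFExpr arity m} (h : .head e ∈ a.subs) : e ∈ a.subs :=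
  subs_subset h (.inr e.mem_subs_self)

theorem sub_tail {e : CFExpr arity m} (h : .tail e ∈ a.subs) : e ∈ a.subs :=
  subs_subset h (.inr e.mem_subs_self)

theorem sub_ite₀ {e₀ e₁ e₂ : CFExpr arity m} (h : .ite e₀ e₁ e₂ ∈ a.subs) : e₀ ∈ a.subs :=
  subs_subset h (.inr (.inl (.inl e₀.mem_subs_self)))

theorem sub_ite₁ {e₀ e₁ e₂ : CFExpr arity m} (h : .ite e₀ e₁ e₂ ∈ a.subs) : e₁ ∈ a.subs :=
  subs_subset h (.inr (.inl (.inr e₁.mem_subs_self)))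

theorem sub_ite₂ {e₀ e₁ e₂ : CFExpr arity m} (h : .ite e₀ e₁ e₂ ∈ a.subs) : e₂ ∈ a.subs :=
  subs_subset h (.inr (.inr e₂.mem_subs_self))

theorem sub_call {f : Fin k} {es : Fin (arity f) → CFExpr arity m} (h : .call f es ∈ a.subs)
    (i : Fin (arity f)) : es i ∈ a.subs :=
  subs_subset h (.inr (Set.mem_iUnion.2 ⟨i, (es i).mem_subs_self⟩))

end CFExpr

/-! ## The register program that guesses and verifies computation trees -/

namespace CFProgram

variable (p : CFProgram)

/-- The occurrences of variables as parameters of functions. -/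
abbrev Param : Type := Σ f, Fin (p.arity f)

/-- The subexpressions of the bodies. -/
abbrev Node : Type := Σ f, {e : CFExpr p.arity (p.arity f) // e ∈ (p.body f).subs}

instance : Finite p.Node := by
  have : ∀ f, Finite {e : CFExpr p.arity (p.arity f) // e ∈ (p.body f).subs} :=
    fun f => (p.body f).finite_subs
  infer_instance

def bodyNode (f : Fin (p.numAux + 1)) : p.Node := ⟨f, p.body f, (p.body f).mem_subs_self⟩

def entryParam : p.Param := ⟨0, ⟨0, by rw [p.arity_entry]; exact Nat.one_pos⟩⟩

/-- `pos` counts the moves of the input head, `bound` and `depth` have the form `2 ^ d - 1`; `val` is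
the value that is to be verified, `env` holds the values of the parameters, and `arg` guessed values
of arguments. -/
inductive VReg : Type where
  | pos
  | bound
  | depth
  | tmp
  | val
  | env (v : p.Param)
  | arg (v : p.Param)

/-- `eval n` stands for the task of verifying that the expression at `n` has the value in `val`. -/
inductive VLabel : Type where
  | init
  | acc
  | eval (n : p.Node)
  | walk (n : p.Node)
  | evalBit (n : p.Node) (b : Bool)
  | evalArg (n : p.Node) (v : p.Param)
  | evalBody (f : Fin (p.numAux + 1))

instance : Finite p.VReg := by
  let F : Fin 5 ⊕ p.Param × Bool → p.VReg
    | .inl 0 => .pos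
    | .inl 1 => .bound
    | .inl 2 => .depth
    | .inl 3 => .tmp
    | .inl 4 => .val
    | .inr (v, true) => .env v
    | .inr (v, false) => .arg v
  refine Finite.of_surjective F fun s => ?_
  cases s with
  | pos => exact ⟨.inl 0, rfl⟩
  | bound => exact ⟨.inl 1, rfl⟩
  | depth => exact ⟨.inl 2, rfl⟩
  | tmp => exact ⟨.inl 3, rfl⟩
  | val => exact ⟨.inl 4, rfl⟩
  | env v => exact ⟨.inr (v, true), rfl⟩
  | arg v => exact ⟨.inr (v, false), rfl⟩

instance : Finite p.VLabel := by
  let F : Bool ⊕ p.Node × Fin 4 ⊕ p.Node × p.Param ⊕ Fin (p.numAux + 1) → p.VLabel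
    | .inl true => .init
    | .inl false => .acc
    | .inr (.inl (n, 0)) => .eval n
    | .inr (.inl (n, 1)) => .walk n
    | .inr (.inl (n, 2)) => .evalBit n true
    | .inr (.inl (n, 3)) => .evalBit n false
    | .inr (.inr (.inl (n, v))) => .evalArg n v
    | .inr (.inr (.inr f)) => .evalBody f
  refine Finite.of_surjective F fun s => ?_
  cases s with
  | init => exact ⟨.inl true, rfl⟩
  | acc => exact ⟨.inl false, rfl⟩
  | eval n => exact ⟨.inr (.inl (n, 0)), rfl⟩
  | walk n => exact ⟨.inr (.inl (n, 1)), rfl⟩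
  | evalBit n b =>
    cases b
    · exact ⟨.inr (.inl (n, 3)), rfl⟩
    · exact ⟨.inr (.inl (n, 2)), rfl⟩
  | evalArg n v => exact ⟨.inr (.inr (.inl (n, v))), rfl⟩
  | evalBody f => exact ⟨.inr (.inr (.inr f)), rfl⟩

noncomputable instance : DecidableEq p.VReg := Classical.decEq _

abbrev VInstr : Type := Instr p.VReg p.VLabel

abbrev VStore : Type := RegStore p.VReg p.VLabel

variable {p}

def setBit (r : p.VReg) (b : Bool) : List p.VInstr :=
  .zero r :: if b then [.inc r] else []

/-- The scanned symbol is a bit. -/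
def bitSyms : Set InSym := {σ | ∃ b, σ = .bit b}

/-- Leave the tasks `ls` on the stack, in any order. -/
def spawn (pre : List p.VInstr) (ls : List p.VLabel) : List (List p.VInstr × Option p.VLabel) :=
  ls.permutations.map fun l => (pre ++ l.map .push, none)

variable (p)

def guessArgs (g : Fin (p.numAux + 1)) : List p.VInstr :=
  List.ofFn fun j => .guess (.arg ⟨g, j⟩)

def loadArgs (g : Fin (p.numAux + 1)) : List p.VInstr :=
  List.ofFn fun j => .copy (.env ⟨g, j⟩) (.arg ⟨g, j⟩)

/-- The rules for an expression, when `pos` and the input head are at any position. -/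
def exprRules (f : Fin (p.numAux + 1)) : (e : CFExpr p.arity (p.arity f)) →
    e ∈ (p.body f).subs → List (List p.VInstr × Option p.VLabel)
  | .tt, _ => [(setBit .tmp true ++ [.eq .tmp .val], none)]
  | .ff, _ => [(setBit .tmp false ++ [.eq .tmp .val], none)]
  | .nil, _ => [([.look {.rightEnd} .stay, .eq .pos .val], none)]
  | .var i, _ => [([.eq .val (.env ⟨f, i⟩)], none)]
  | .not e, h => [true, false].map fun b =>
      (setBit .tmp (!b) ++ .eq .tmp .val :: setBit .val b, some (.eval ⟨f, e, CFExpr.sub_not h⟩))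
  | .null e, h =>
    [(setBit .tmp true ++ [.eq .tmp .val, .look {.rightEnd} .stay, .copy .val .pos],
        some (.eval ⟨f, e, CFExpr.sub_null h⟩)),
      (setBit .tmp false ++ [.eq .tmp .val, .look bitSyms .stay, .copy .val .pos],
        some (.eval ⟨f, e, CFExpr.sub_null h⟩))]
  | .head e, h => [true, false].map fun b =>
      (setBit .tmp b ++ [.eq .tmp .val, .look {.bit b} .stay, .copy .val .pos],
        some (.eval ⟨f, e, CFExpr.sub_head h⟩))
  | .tail e, h =>
    [([.look bitSyms .stay, .copy .tmp .pos, .inc .tmp, .eq .tmp .val, .copy .val .pos],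
        some (.eval ⟨f, e, CFExpr.sub_tail h⟩))]
  | .ite e₀ e₁ e₂, h =>
    spawn [] [.evalBit ⟨f, e₀, CFExpr.sub_ite₀ h⟩ true, .eval ⟨f, e₁, CFExpr.sub_ite₁ h⟩] ++
      spawn [] [.evalBit ⟨f, e₀, CFExpr.sub_ite₀ h⟩ false, .eval ⟨f, e₂, CFExpr.sub_ite₂ h⟩]
  | .call g es, h =>
    spawn (p.guessArgs g)
      (.evalBody g :: List.ofFn fun j => .evalArg ⟨f, es j, CFExpr.sub_call h j⟩ ⟨g, j⟩)

/-- At `init`, the width is increased by `k` whenever the length of the scanned part of the input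
reaches a power of two. -/
def rules (k : ℕ) : p.VLabel → List (List p.VInstr × Option p.VLabel)
  | .init =>
    -- The doubling makes `pos` and `bound` differ again, so the width grows at most once at each
    -- head position. A run may omit the growth; this only leaves it with less space.
    [(.eq .pos .bound :: (List.replicate k .grow ++ [.dbl .bound]), some .init),
      ([.look {.rightEnd}ᶜ .right, .inc .pos], some .init),
      (.look {.rightEnd} .stay :: (setBit .val true ++ [.zero (.env p.entryParam),
        .inc (.env p.entryParam), .inc (.env p.entryParam), .push .acc]),
        some (.eval (p.bodyNode 0)))]
  | .acc => []
  -- The head is rewound and then walks to a guessed cell, so that `pos` becomes the head position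
  -- plus one, the code of the suffix under the head.
  | .eval n =>
    [([.look Set.univ .left], some (.eval n)),
      (.look {.leftEnd} .stay :: setBit .pos true, some (.walk n))]
  | .walk n => ([.look {.rightEnd}ᶜ .right, .inc .pos], some (.walk n)) ::
      p.exprRules n.1 n.2.1 n.2.2
  | .evalBit n b => [(setBit .val b, some (.eval n))]
  | .evalArg n v => [([.copy .val (.arg v)], some (.eval n))]
  | .evalBody g => [(p.loadArgs g, some (.eval (p.bodyNode g)))]

noncomputable abbrev verifier (k : ℕ) : RegProgram where
  Reg := p.VReg
  Label := p.VLabel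
  rules := p.rules k
  start := .init
  accept := .acc
  depth := .depth

end CFProgram

/-! ### Straight-line code and invariants of register programs -/

namespace RegProgram

theorem store_ext_iff {Reg Label : Type} {s' : RegStore Reg Label} {h W : ℕ} {ρ : Reg → ℕ}
    {st : List (Label × (Reg → ℕ))} :
    s' = ⟨h, W, ρ, st⟩ ↔ s'.reg = ρ ∧ s'.inPos = h ∧ s'.width = W ∧ s'.stack = st := by
  cases s'
  simp only [RegStore.mk.injEq]
  tauto

section Instructions

variable {Reg Label : Type} [DecidableEq Reg] {D : Reg}

/-- The straight-line code can turn `s` into `s'`. -/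
def Runs (D : Reg) (x : List Bool) :
    List (Instr Reg Label) → RegStore Reg Label → RegStore Reg Label → Prop
  | [], s, s' => s' = s
  | i :: l, s, s' => ∃ s₁, Rel D x i s s₁ ∧ Runs D x l s₁ s'

variable {x : List Bool} {s s' : RegStore Reg Label}

theorem runs_nil : Runs D x [] s s' ↔ s' = s := Iff.rfl

theorem runs_cons {i : Instr Reg Label} {l : List (Instr Reg Label)} :
    Runs D x (i :: l) s s' ↔ ∃ s₁, Rel D x i s s₁ ∧ Runs D x l s₁ s' := Iff.rfl

theorem runs_append {l l' : List (Instr Reg Label)} :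
    Runs D x (l ++ l') s s' ↔ ∃ s₁, Runs D x l s s₁ ∧ Runs D x l' s₁ s' := by
  induction l generalizing s with
  | nil => simp [runs_nil]
  | cons i l ih =>
    simp only [List.cons_append, runs_cons, ih]
    constructor
    · rintro ⟨s₁, h, s₂, h', h''⟩; exact ⟨s₂, ⟨s₁, h, h'⟩, h''⟩
    · rintro ⟨s₂, ⟨s₁, h, h'⟩, h''⟩; exact ⟨s₁, h, s₂, h', h''⟩

theorem rel_zero {r : Reg} :
    Rel D x (.zero r) s s' ↔ s' = { s with reg := Function.update s.reg r 0 } := by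
  rw [store_ext_iff]; rfl

theorem rel_inc {r : Reg} : Rel D x (.inc r) s s' ↔ s.reg r + 1 < 2 ^ s.width ∧
    s' = { s with reg := Function.update s.reg r (s.reg r + 1) } := by
  rw [store_ext_iff]; exact and_assoc

theorem rel_dbl {r : Reg} : Rel D x (.dbl r) s s' ↔ 2 * s.reg r + 1 < 2 ^ s.width ∧
    s' = { s with reg := Function.update s.reg r (2 * s.reg r + 1) } := by
  rw [store_ext_iff]; exact and_assoc

theorem rel_eq {r t : Reg} : Rel D x (.eq r t) s s' ↔ s.reg r = s.reg t ∧ s' = s := by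
  rw [store_ext_iff]; exact and_assoc

theorem rel_copy {r t : Reg} :
    Rel D x (.copy r t) s s' ↔ s' = { s with reg := Function.update s.reg r (s.reg t) } := by
  rw [store_ext_iff]; rfl

theorem rel_guess {r : Reg} : Rel D x (.guess r) s s' ↔ ∃ a < 2 ^ s.width,
    s' = { s with reg := Function.update s.reg r a } := by
  constructor
  · rintro ⟨⟨a, ha, h⟩, h'⟩
    exact ⟨a, ha, store_ext_iff.2 ⟨h, h'⟩⟩
  · rintro ⟨a, ha, rfl⟩
    exact ⟨⟨a, ha, rfl⟩, rfl, rfl, rfl⟩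

theorem rel_look {A : Set InSym} {d : HeadMove} : Rel D x (.look A d) s s' ↔
    inputSym x s.inPos ∈ A ∧ s' = { s with inPos := min (d.apply s.inPos) (x.length + 1) } := by
  rw [store_ext_iff]; exact and_left_comm

theorem rel_push {t : Label} : Rel D x (.push t) s s' ↔ 2 * s.reg D + 1 < 2 ^ s.width ∧
    s' = { s with
      reg := Function.update s.reg D (2 * s.reg D + 1)
      stack := (t, s.reg) :: s.stack } := by
  rw [store_ext_iff]; exact and_assoc

theorem rel_grow : Rel D x .grow s s' ↔ s' = { s with width := s.width + 1 } := by
  rw [store_ext_iff]; rfl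

/-- `S` holds before every instruction and `Q` at the end, however the code is executed. -/
def Always (D : Reg) (x : List Bool) (S : Instr Reg Label → RegStore Reg Label → Prop)
    (Q : RegStore Reg Label → Prop) :
    List (Instr Reg Label) → RegStore Reg Label → Prop
  | [], s => Q s
  | i :: l, s => S i s ∧ ∀ s₁, Rel D x i s s₁ → Always D x S Q l s₁

theorem always_of_runs {Q : RegStore Reg Label → Prop} {l : List (Instr Reg Label)}
    (h : ∀ s', Runs D x l s s' → Q s') : Always D x (fun _ _ => True) Q l s := by
  induction l generalizing s with
  | nil => exact h s rfl
  | cons i l ih => exact ⟨trivial, fun s₁ h₁ => ih fun s' hs => h s' ⟨s₁, h₁, hs⟩⟩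

end Instructions

variable {P : RegProgram} {x : List Bool} {s s' : P.Store}

theorem Runs.steps {l : List (Instr P.Reg P.Label)} (h : Runs P.depth x l s s') (o : Option P.Label) :
    Relation.ReflTransGen (P.Step x) ⟨l, o, s⟩ ⟨[], o, s'⟩ := by
  induction l generalizing s with
  | nil => cases h; exact .refl
  | cons i l ih =>
    obtain ⟨s₁, hr, h⟩ := h
    exact .head (.instr hr) (ih h)

theorem Runs.steps_of_rule {t : P.Label} {l : List (Instr P.Reg P.Label)} {o : Option P.Label}
    (h : Runs P.depth x l s s') (hr : (l, o) ∈ P.rules t) :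
    Relation.ReflTransGen (P.Step x) ⟨[], some t, s⟩ ⟨[], o, s'⟩ :=
  .head (.jump hr) (h.steps o)

/-- An invariant is needed only at labels and returns; inside a code it is replaced by what the rest
of the code guarantees. -/
theorem Reachable.always {S : Instr P.Reg P.Label → P.Store → Prop}
    {Q : Option P.Label → P.Store → Prop} (hstart : Q (some P.start) P.init.store)
    (hrule : ∀ t s l o, P.Reachable x ⟨[], some t, s⟩ → Q (some t) s → (l, o) ∈ P.rules t →
      Always P.depth x S (Q o) l s)
    (hret : ∀ h W ρ t ρ' st, Q none ⟨h, W, ρ, (t, ρ') :: st⟩ → Q (some t) ⟨h, W, ρ', st⟩)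
    {c : P.Cfg} (hc : P.Reachable x c) : Always P.depth x S (Q c.next) c.code c.store := by
  induction hc with
  | refl => exact hstart
  | tail hr hs ih =>
    cases hs with
    | instr h => exact ih.2 _ h
    | jump h => exact hrule _ _ _ _ hr ih h
    | ret => exact hret _ _ _ _ _ _ ih

end RegProgram

namespace CFProgram

open RegProgram

variable {p : CFProgram} {k : ℕ} {x : List Bool}

/-! ### Soundness -/

/-- What the verifier verifies at a label, given the position of the input head and the registers. -/
def Claim (p : CFProgram) (x : List Bool) (t : p.VLabel) (h : ℕ) (ρ : p.VReg → ℕ) : Prop :=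
  match t with
  | .init => Nonempty (CFTree p (fun _ => .list x) (p.body 0) (.bit true))
  | .acc => True
  | .eval n => Nonempty (CFTree p (fun i => decodeVal x (ρ (.env ⟨n.1, i⟩))) n.2.1
      (decodeVal x (ρ .val)))
  | .walk n => ρ .pos = h + 1 →
      Nonempty (CFTree p (fun i => decodeVal x (ρ (.env ⟨n.1, i⟩))) n.2.1 (decodeVal x (ρ .val)))
  | .evalBit n b => Nonempty (CFTree p (fun i => decodeVal x (ρ (.env ⟨n.1, i⟩))) n.2.1 (.bit b))
  | .evalArg n v => Nonempty (CFTree p (fun i => decodeVal x (ρ (.env ⟨n.1, i⟩))) n.2.1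
      (decodeVal x (ρ (.arg v))))
  | .evalBody g => Nonempty (CFTree p (fun i => decodeVal x (ρ (.arg ⟨g, i⟩))) (p.body g)
      (decodeVal x (ρ .val)))

/-- All claims of the saved tasks hold, down to the end of the verification. -/
def Pending (p : CFProgram) (x : List Bool) : List (p.VLabel × (p.VReg → ℕ)) → Prop
  | [] => True
  | f :: st => f.1 = .acc ∨ ((∃ h, Claim p x f.1 h f.2) ∧ (f.1 = .init ∨ Pending p x st))

/-- The label `acc` discharges everything below it on the stack. At `init` the claim is already the
final goal, so the stack is not considered. -/
def PendingAt (p : CFProgram) (x : List Bool) (o : Option p.VLabel)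
    (s : p.VStore) : Prop :=
  match o with
  | none => Pending p x s.stack
  | some t => t = .acc ∨ (Claim p x t s.inPos s.reg ∧ (t = .init ∨ Pending p x s.stack))

theorem runs_setBit {r : p.VReg} {b : Bool} {s s' : p.VStore} :
    Runs .depth x (setBit r b) s s' ↔ (b = true → 1 < 2 ^ s.width) ∧
      s' = { s with reg := Function.update s.reg r b.toNat } := by
  cases b <;> simp [setBit, runs_cons, runs_nil, rel_zero, rel_inc]

theorem runs_push {ls : List p.VLabel} {s s' : p.VStore}
    (h : Runs .depth x (ls.map .push) s s') : (∀ r ≠ .depth, s'.reg r = s.reg r) ∧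
      ∃ st, s'.stack = st ++ s.stack ∧ (∀ f ∈ st, ∀ r ≠ .depth, f.2 r = s.reg r) ∧
        st.map Prod.fst = ls.reverse := by
  induction ls generalizing s with
  | nil => cases h; exact ⟨fun _ _ => rfl, [], rfl, by simp, rfl⟩
  | cons t ls ih =>
    obtain ⟨s₁, h₁, h⟩ := h
    rw [rel_push] at h₁
    obtain ⟨-, rfl⟩ := h₁
    obtain ⟨hr, st, h1, h2, h3⟩ := ih h
    have hu : ∀ r ≠ VReg.depth, (Function.update s.reg .depth
        (2 * s.reg .depth + 1)) r = s.reg r :=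
      fun r hr => Function.update_of_ne hr _ _
    refine ⟨fun r hr' => (hr r hr').trans (hu r hr'), st ++ [(t, s.reg)], by simp [h1], ?_,
      by simp [h3]⟩
    intro f hf r hr'
    rcases List.mem_append.1 hf with hf | hf
    · exact (h2 f hf r hr').trans (hu r hr')
    · rw [List.mem_singleton.1 hf]

theorem runs_ofFn_reg {n : ℕ} {i : Fin n → p.VInstr} {A : Set p.VReg} {s s' : p.VStore}
    (hi : ∀ j s s', Rel .depth x (i j) s s' →
      (∀ r ∉ A, s'.reg r = s.reg r) ∧ s'.stack = s.stack)
    (h : Runs .depth x (List.ofFn i) s s') : (∀ r ∉ A, s'.reg r = s.reg r) ∧ s'.stack = s.stack := by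
  induction n generalizing s with
  | zero => rw [List.ofFn_zero] at h; cases h; exact ⟨fun _ _ => rfl, rfl⟩
  | succ n ih =>
    rw [List.ofFn_succ] at h
    obtain ⟨s₁, h₁, h⟩ := h
    have h1 := hi _ _ _ h₁
    have h2 := ih (fun j => hi j.succ) h
    exact ⟨fun r hr => (h2.1 r hr).trans (h1.1 r hr), h2.2.trans h1.2⟩

theorem Claim.congr {t : p.VLabel} {h : ℕ} {ρ ρ' : p.VReg → ℕ} (hc : Claim p x t h ρ)
    (hρ : ∀ r ≠ .depth, ρ r = ρ' r) : Claim p x t h ρ' := by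
  cases t <;> simp_all [Claim]

theorem Pending.of_append {st st' : List (p.VLabel × (p.VReg → ℕ))}
    (h : Pending p x (st ++ st')) (hst : ∀ f ∈ st, f.1 ≠ .acc ∧ f.1 ≠ .init) :
    (∀ f ∈ st, ∃ h, Claim p x f.1 h f.2) ∧ Pending p x st' := by
  induction st with
  | nil => exact ⟨by simp, h⟩
  | cons f st ih =>
    have hf := hst f List.mem_cons_self
    obtain ⟨hc, hp⟩ := h.resolve_left hf.1
    obtain ⟨h1, h2⟩ := ih (hp.resolve_left hf.2) fun g hg => hst g (List.mem_cons_of_mem _ hg)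
    exact ⟨List.forall_mem_cons.2 ⟨hc, h1⟩, h2⟩

/-- Pushing changes only the depth register, which no claim mentions, so all frames state their
claims about the same registers, whatever the order of pushing. -/
theorem claims_of_runs_push {l ls : List p.VLabel} (hls : ∀ t ∈ ls, t ≠ .acc ∧ t ≠ .init)
    (hl : l.Perm ls) {s s' : p.VStore} (h : Runs .depth x (l.map .push) s s')
    (hs : Pending p x s'.stack) :
    (∀ t ∈ ls, ∃ h, Claim p x t h s.reg) ∧ Pending p x s.stack := by
  obtain ⟨-, st, h1, h2, h3⟩ := runs_push h
  rw [h1] at hs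
  have hmem : ∀ t, t ∈ ls ↔ ∃ f ∈ st, f.1 = t := by
    intro t
    rw [← hl.mem_iff, ← List.mem_reverse, ← h3, List.mem_map]
  obtain ⟨h4, h5⟩ := hs.of_append fun f hf => hls _ ((hmem _).2 ⟨f, hf, rfl⟩)
  refine ⟨fun t ht => ?_, h5⟩
  obtain ⟨f, hf, rfl⟩ := (hmem t).1 ht
  obtain ⟨h, hc⟩ := h4 f hf
  exact ⟨h, hc.congr (h2 f hf)⟩

/-- Read backwards, each rule of the verifier is a rule of the big-step semantics: trees for the
remaining tasks are the premises of a tree for `e`. -/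
theorem pendingAt_of_exprRules {f : Fin (p.numAux + 1)} {e : CFExpr p.arity (p.arity f)}
    (he : e ∈ (p.body f).subs) {l : List p.VInstr} {o : Option p.VLabel}
    (hr : (l, o) ∈ p.exprRules f e he) {s s' : p.VStore} (h : Runs .depth x l s s')
    (hs : PendingAt p x o s') :
    (s.reg .pos = s.inPos + 1 → Nonempty (CFTree p (fun i => decodeVal x (s.reg (.env ⟨f, i⟩))) e
      (decodeVal x (s.reg .val)))) ∧ Pending p x s.stack := by
  cases e with
  | tt =>
    simp only [exprRules, List.mem_singleton, Prod.mk.injEq] at hr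
    obtain ⟨rfl, rfl⟩ := hr
    simp only [runs_append, runs_setBit, runs_cons, runs_nil, rel_eq] at h
    simp at h
    obtain ⟨-, hv, rfl⟩ := h
    rw [← hv]
    exact ⟨fun _ => ⟨.tt⟩, hs⟩
  | ff =>
    simp only [exprRules, List.mem_singleton, Prod.mk.injEq] at hr
    obtain ⟨rfl, rfl⟩ := hr
    simp [runs_append, runs_setBit, runs_cons, runs_nil, rel_eq] at h
    obtain ⟨hv, rfl⟩ := h
    rw [← hv]
    exact ⟨fun _ => ⟨.ff⟩, hs⟩
  | nil =>
    simp only [exprRules, List.mem_singleton, Prod.mk.injEq] at hr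
    obtain ⟨rfl, rfl⟩ := hr
    simp only [runs_cons, runs_nil, rel_eq, rel_look] at h
    simp at h
    obtain ⟨hσ, hv, rfl⟩ := h
    refine ⟨fun hp => ?_, hs⟩
    rw [← hv, hp, decodeVal_of_rightEnd hσ]
    exact ⟨.nil⟩
  | var i =>
    simp only [exprRules, List.mem_singleton, Prod.mk.injEq] at hr
    obtain ⟨rfl, rfl⟩ := hr
    simp [runs_cons, runs_nil, rel_eq] at h
    obtain ⟨hv, rfl⟩ := h
    refine ⟨fun hp => ?_, hs⟩
    rw [hv]
    exact ⟨.var i⟩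
  | not e =>
    obtain ⟨b, -, hb⟩ := List.mem_map.1 hr
    cases hb
    simp [runs_append, runs_setBit, runs_cons, rel_eq] at h
    obtain ⟨-, hv, -, rfl⟩ := h
    simp [PendingAt, Claim, decodeVal_toNat] at hs
    obtain ⟨⟨T⟩, hp⟩ := hs
    refine ⟨fun _ => ?_, hp⟩
    rw [← hv, decodeVal_toNat]
    exact ⟨.not T⟩
  | null e =>
    simp only [exprRules, List.mem_cons, List.not_mem_nil, or_false, Prod.mk.injEq] at hr
    rcases hr with ⟨rfl, rfl⟩ | ⟨rfl, rfl⟩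
    · simp [runs_append, runs_setBit, runs_cons, runs_nil, rel_eq, rel_look, rel_copy] at h
      obtain ⟨-, hv, hσ, rfl⟩ := h
      simp [PendingAt, Claim] at hs
      obtain ⟨hT, hp⟩ := hs
      refine ⟨fun hpos => ?_, hp⟩
      rw [hpos, decodeVal_of_rightEnd hσ] at hT
      obtain ⟨T⟩ := hT
      rw [← hv]
      exact ⟨.nullNil T⟩
    · simp [runs_append, runs_setBit, runs_cons, runs_nil, rel_eq, rel_look, rel_copy] at h
      obtain ⟨hv, ⟨b, hσ⟩, rfl⟩ := h
      simp [PendingAt, Claim] at hs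
      obtain ⟨hT, hp⟩ := hs
      refine ⟨fun hpos => ?_, hp⟩
      obtain ⟨l, hl, -⟩ := decodeVal_of_bit hσ
      rw [hpos, hl] at hT
      obtain ⟨T⟩ := hT
      rw [← hv]
      exact ⟨.nullCons T⟩
  | head e =>
    obtain ⟨b, -, hb⟩ := List.mem_map.1 hr
    cases hb
    simp [runs_append, runs_setBit, runs_cons, runs_nil, rel_eq, rel_look, rel_copy] at h
    obtain ⟨-, hv, hσ, rfl⟩ := h
    simp [PendingAt, Claim] at hs
    obtain ⟨hT, hp⟩ := hs
    refine ⟨fun hpos => ?_, hp⟩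
    obtain ⟨l, hl, -⟩ := decodeVal_of_bit hσ
    rw [hpos, hl] at hT
    obtain ⟨T⟩ := hT
    rw [← hv, decodeVal_toNat]
    exact ⟨.head T⟩
  | tail e =>
    simp only [exprRules, List.mem_singleton, Prod.mk.injEq] at hr
    obtain ⟨rfl, rfl⟩ := hr
    simp [runs_cons, runs_nil, rel_eq, rel_look, rel_copy, rel_inc] at h
    obtain ⟨⟨b, hσ⟩, -, hv, rfl⟩ := h
    simp [PendingAt, Claim] at hs
    obtain ⟨hT, hp⟩ := hs
    refine ⟨fun hpos => ?_, hp⟩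
    obtain ⟨l, hl, hl'⟩ := decodeVal_of_bit hσ
    rw [hpos, hl] at hT
    obtain ⟨T⟩ := hT
    rw [← hv, hpos, hl']
    exact ⟨.tail T⟩
  | ite e₀ e₁ e₂ =>
    rcases List.mem_append.1 hr with hr | hr
    · obtain ⟨l', hl', hb⟩ := List.mem_map.1 hr
      cases hb
      obtain ⟨h1, h2⟩ := claims_of_runs_push (by simp) (List.mem_permutations.1 hl') h hs
      obtain ⟨-, ⟨T₀⟩⟩ := h1 _ List.mem_cons_self
      obtain ⟨-, ⟨T₁⟩⟩ := h1 _ (List.mem_cons_of_mem _ List.mem_cons_self)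
      exact ⟨fun _ => ⟨.iteTrue T₀ T₁⟩, h2⟩
    · obtain ⟨l', hl', hb⟩ := List.mem_map.1 hr
      cases hb
      obtain ⟨h1, h2⟩ := claims_of_runs_push (by simp) (List.mem_permutations.1 hl') h hs
      obtain ⟨-, ⟨T₀⟩⟩ := h1 _ List.mem_cons_self
      obtain ⟨-, ⟨T₁⟩⟩ := h1 _ (List.mem_cons_of_mem _ List.mem_cons_self)
      exact ⟨fun _ => ⟨.iteFalse T₀ T₁⟩, h2⟩
  | call g es =>
    obtain ⟨l', hl', hb⟩ := List.mem_map.1 hr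
    cases hb
    obtain ⟨s₁, hg, h⟩ := runs_append.1 h
    -- Guessing touches only the `arg` registers, so the premises refer to the original environment
    -- and value. The decoded guesses become the argument values of the tree.
    have hg' := runs_ofFn_reg (A := Set.range VReg.arg) (fun j s s' hj => by
      obtain ⟨a, -, rfl⟩ := rel_guess.1 hj
      refine ⟨fun r hr => Function.update_of_ne ?_ _ _, rfl⟩
      rintro rfl
      exact hr ⟨_, rfl⟩) hg
    obtain ⟨h1, h2⟩ := claims_of_runs_push (by simp) (List.mem_permutations.1 hl') h hs
    rw [hg'.2] at h2
    obtain ⟨-, ⟨T⟩⟩ := h1 _ List.mem_cons_self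
    have hTs := fun j => h1 _ (List.mem_cons_of_mem _ (List.mem_ofFn.2 ⟨j, rfl⟩))
    have henv : ∀ v, s₁.reg (.env v) = s.reg (.env v) := fun v => hg'.1 _ (by simp)
    have hval : s₁.reg .val = s.reg .val := hg'.1 _ (by simp)
    simp only [Claim, henv, exists_const] at hTs
    rw [hval] at T
    exact ⟨fun _ => ⟨.call g _ (fun j => (hTs j).some) T⟩, h2⟩

theorem runs_loadArgs {g : Fin (p.numAux + 1)} {s s' : p.VStore} :
    Runs .depth x (p.loadArgs g) s s' ↔ s' = { s with reg := fun r => match r with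
      | .env ⟨f, i⟩ => if f = g then s.reg (.arg ⟨f, i⟩) else s.reg (.env ⟨f, i⟩)
      | r => s.reg r } := by
  have key : ∀ (l : List (Fin (p.arity g))) (s : p.VStore),
      Runs .depth x (l.map fun j => .copy (.env ⟨g, j⟩) (.arg ⟨g, j⟩)) s s' ↔
      s' = { s with reg := fun r => match r with
        | .env v => if v ∈ l.map (Sigma.mk g) then s.reg (.arg v) else s.reg (.env v)
        | r => s.reg r } := by
    intro l
    induction l with
    | nil =>
      intro s
      simp only [List.map_nil, runs_nil, List.not_mem_nil, if_false]
      refine Eq.congr_right (congrArg (fun ρ => (⟨_, _, ρ, _⟩ : p.VStore)) ?_)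
      funext r
      cases r <;> rfl
    | cons j l ih =>
      intro s
      simp only [List.map_cons, runs_cons, rel_copy, exists_eq_left, ih]
      refine Eq.congr_right (congrArg (fun ρ => (⟨_, _, ρ, _⟩ : p.VStore)) ?_)
      funext r
      cases r with
      | env v =>
        by_cases hv : v = ⟨g, j⟩
        · subst hv; simp
        · simp [hv, Function.update_of_ne]
      | _ => simp
  have h1 := key (List.ofFn id) s
  rw [List.map_ofFn] at h1
  refine h1.trans (Eq.congr_right (congrArg (fun ρ => (⟨_, _, ρ, _⟩ : p.VStore)) ?_))
  funext r
  cases r with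
  | env v =>
    obtain ⟨f, i⟩ := v
    by_cases hf : f = g
    · subst hf; simp
    · simp [hf, Ne.symm hf]
  | _ => rfl

theorem pendingAt_of_rules {t : p.VLabel} {l : List p.VInstr} {o : Option p.VLabel}
    (hr : (l, o) ∈ p.rules k t) {s s' : p.VStore} (h : Runs .depth x l s s')
    (hs : PendingAt p x o s') : PendingAt p x (some t) s := by
  right
  cases t with
  | init =>
    simp only [rules, List.mem_cons, List.not_mem_nil, or_false, Prod.mk.injEq] at hr
    rcases hr with ⟨rfl, rfl⟩ | ⟨rfl, rfl⟩ | ⟨rfl, rfl⟩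
    · exact ⟨(hs.resolve_left (by simp)).1, .inl rfl⟩
    · exact ⟨(hs.resolve_left (by simp)).1, .inl rfl⟩
    · refine ⟨?_, .inl rfl⟩
      obtain ⟨hc, -⟩ := hs.resolve_left (by simp)
      simp [runs_append, runs_setBit, runs_cons, runs_nil, rel_look, rel_zero, rel_inc, rel_push] at h
      obtain ⟨-, -, -, -, -, rfl⟩ := h
      simp [Claim, bodyNode] at hc
      obtain ⟨T⟩ := hc
      have : ∀ i : Fin (p.arity 0), (⟨0, i⟩ : p.Param) = p.entryParam := by
        intro i
        have := p.arity_entry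
        refine Sigma.ext rfl (heq_of_eq (Fin.ext ?_))
        simp [entryParam]
        omega
      simp [this] at T
      exact ⟨T⟩
  | acc => simp [rules] at hr
  | eval n =>
    simp only [rules, List.mem_cons, List.not_mem_nil, or_false, Prod.mk.injEq] at hr
    rcases hr with ⟨rfl, rfl⟩ | ⟨rfl, rfl⟩
    · simp [runs_cons, runs_nil, rel_look] at h
      subst h
      exact hs.resolve_left (by simp)
    · simp [runs_setBit, runs_cons, rel_look] at h
      obtain ⟨hσ, -, rfl⟩ := h
      rw [inputSym_eq_leftEnd] at hσ
      simpa [PendingAt, Claim, hσ, HeadMove.apply] using hs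
  | walk n =>
    simp only [rules, List.mem_cons, Prod.mk.injEq] at hr
    rcases hr with ⟨rfl, rfl⟩ | hr
    · simp [runs_cons, runs_nil, rel_look, rel_inc, inputSym_eq_rightEnd] at h
      obtain ⟨hσ, -, rfl⟩ := h
      have : min (s.inPos + 1) (x.length + 1) = s.inPos + 1 := min_eq_left (by omega)
      simpa [PendingAt, Claim, HeadMove.apply, this] using hs
    · have := pendingAt_of_exprRules n.2.2 hr h hs
      exact ⟨this.1, .inr this.2⟩
  | evalBit n b =>
    simp only [rules, List.mem_singleton, Prod.mk.injEq] at hr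
    obtain ⟨rfl, rfl⟩ := hr
    obtain ⟨-, rfl⟩ := runs_setBit.1 h
    simpa [PendingAt, Claim, decodeVal_toNat] using hs
  | evalArg n v =>
    simp only [rules, List.mem_singleton, Prod.mk.injEq] at hr
    obtain ⟨rfl, rfl⟩ := hr
    simp [runs_cons, runs_nil, rel_copy] at h
    subst h
    simpa [PendingAt, Claim] using hs
  | evalBody g =>
    simp only [rules, List.mem_singleton, Prod.mk.injEq] at hr
    obtain ⟨rfl, rfl⟩ := hr
    rw [runs_loadArgs] at h
    subst h
    simpa [PendingAt, Claim, bodyNode] using hs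

/-- The invariant is an implication: if the current obligations hold, the desired tree exists. It
passes forward along a run because obligations pass backward, and at `acc` its premise is trivially
true. -/
theorem verifier_sound {s : p.VStore} (h : (p.verifier k).Reachable x ⟨[], some .acc, s⟩) :
    Nonempty (CFTree p (fun _ => .list x) (p.body 0) (.bit true)) := by
  have := RegProgram.Reachable.always (S := fun _ _ => True)
    (Q := fun o s => PendingAt p x o s →
      Nonempty (CFTree p (fun _ => .list x) (p.body 0) (.bit true))) ?_ ?_ ?_ h
  · exact this (.inl rfl)
  · exact fun h => (h.resolve_left (by simp)).1
  · intro t s l o hs ht hr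
    exact always_of_runs fun s' hl hp => ht (pendingAt_of_rules hr hl hp)
  · intro h W ρ t ρ' st hp hp'
    exact hp (hp'.imp_right fun h' => ⟨⟨_, h'.1⟩, h'.2⟩)

/-! ### Space -/

/-- The depth register bounds the height of the stack, now and after every return. -/
def FramesOK : List (p.VLabel × (p.VReg → ℕ)) → Prop
  | [] => True
  | f :: st => f.1 ≠ .init ∧ 2 ^ st.length ≤ f.2 .depth + 1 ∧ FramesOK st

def MainOK (B : ℕ) (s : p.VStore) : Prop :=
  s.width ≤ B ∧ 2 ^ s.stack.length ≤ s.reg .depth + 1 ∧ FramesOK s.stack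

def InitOK (k : ℕ) (x : List Bool) (s : p.VStore) : Prop :=
  s.stack = [] ∧ s.reg .depth = 0 ∧ s.reg .pos = s.inPos ∧
    ∃ j ≤ Nat.log 2 (x.length + 2) + 1, s.width = 1 + k * j ∧ s.reg .bound + 1 = 2 ^ j

def maxWidth (k n : ℕ) : ℕ := 1 + k * (Nat.log 2 (n + 2) + 1)

def LabelOK (k : ℕ) (x : List Bool) (o : Option p.VLabel) (s : p.VStore) : Prop :=
  (o = some .init ∧ InitOK k x s) ∨ (o ≠ some .init ∧ MainOK (maxWidth k x.length) s)

def InstrOK (B : ℕ) (i : p.VInstr) (s : p.VStore) : Prop :=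
  s.width ≤ B ∧ 2 ^ s.stack.length ≤ s.reg .depth + 1 ∧ (i = .grow → s.stack = [])

/-- The instructions that keep the relation between the depth register and the stack. -/
def Tame : p.VInstr → Prop
  | .zero r | .inc r | .dbl r | .copy r _ | .guess r => r ≠ .depth
  | .eq _ _ | .look _ _ => True
  | .push t => t ≠ .init
  | .grow => False

/-- A push doubles both `depth + 1` and `2 ^ height`. The frame keeps the depth from before the
push, which fits the height that a return leads back to. -/
theorem MainOK.rel {B : ℕ} {i : p.VInstr} {s s' : p.VStore} (hs : MainOK B s) (hi : Tame i)
    (h : Rel .depth x i s s') : MainOK B s' := by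
  have hu : ∀ r a, r ≠ VReg.depth → Function.update s.reg r a .depth = s.reg .depth :=
    fun r a hr => Function.update_of_ne hr.symm _ _
  cases i with
  | zero r => rw [rel_zero] at h; subst h; simpa [MainOK, hu r _ hi] using hs
  | inc r => rw [rel_inc] at h; obtain ⟨-, rfl⟩ := h; simpa [MainOK, hu r _ hi] using hs
  | dbl r => rw [rel_dbl] at h; obtain ⟨-, rfl⟩ := h; simpa [MainOK, hu r _ hi] using hs
  | copy r t => rw [rel_copy] at h; subst h; simpa [MainOK, hu r _ hi] using hs
  | guess r => rw [rel_guess] at h; obtain ⟨a, -, rfl⟩ := h; simpa [MainOK, hu r _ hi] using hs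
  | eq r t => rw [rel_eq] at h; obtain ⟨-, rfl⟩ := h; exact hs
  | look A d => rw [rel_look] at h; obtain ⟨-, rfl⟩ := h; exact hs
  | push t =>
    rw [rel_push] at h
    obtain ⟨-, rfl⟩ := h
    refine ⟨hs.1, ?_, hi, hs.2.1, hs.2.2⟩
    have := hs.2.1
    simp only [List.length_cons, pow_succ, Function.update_self]
    omega
  | grow => exact hi.elim

theorem always_of_tame {B : ℕ} {l : List p.VInstr} {s : p.VStore} (hl : ∀ i ∈ l, Tame i)
    (hs : MainOK B s) : Always .depth x (InstrOK B) (MainOK B) l s := by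
  induction l generalizing s with
  | nil => exact hs
  | cons i l ih =>
    have hi := hl i List.mem_cons_self
    refine ⟨⟨hs.1, hs.2.1, ?_⟩, fun s₁ h => ih (fun j hj => hl j (List.mem_cons_of_mem _ hj))
      (hs.rel hi h)⟩
    rintro rfl
    exact hi.elim

theorem tame_of_mem_setBit {r : p.VReg} {b : Bool} (hr : r ≠ .depth) :
    ∀ i ∈ setBit r b, Tame i := by
  cases b <;> simp [setBit, Tame, hr]

theorem tame_of_spawn {pre l : List p.VInstr} {ls : List p.VLabel} {o : Option p.VLabel}
    (hpre : ∀ i ∈ pre, Tame i) (hls : ∀ t ∈ ls, t ≠ .init) (hr : (l, o) ∈ spawn pre ls) :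
    (∀ i ∈ l, Tame i) ∧ o ≠ some .init := by
  obtain ⟨l', hl', hb⟩ := List.mem_map.1 hr
  cases hb
  refine ⟨fun i hi => ?_, by simp⟩
  rcases List.mem_append.1 hi with hi | hi
  · exact hpre i hi
  · obtain ⟨t, ht, rfl⟩ := List.mem_map.1 hi
    exact hls t ((List.mem_permutations.1 hl').mem_iff.1 ht)

theorem tame_of_exprRules {f : Fin (p.numAux + 1)} {e : CFExpr p.arity (p.arity f)}
    (he : e ∈ (p.body f).subs) {l : List p.VInstr} {o : Option p.VLabel}
    (hr : (l, o) ∈ p.exprRules f e he) : (∀ i ∈ l, Tame i) ∧ o ≠ some .init := by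
  have ht : ∀ b, ∀ i ∈ setBit (p := p) .tmp b, Tame i := fun b => tame_of_mem_setBit (by simp)
  have hv : ∀ b, ∀ i ∈ setBit (p := p) .val b, Tame i := fun b => tame_of_mem_setBit (by simp)
  cases e with
  | ite e₀ e₁ e₂ =>
    rcases List.mem_append.1 hr with hr | hr
    · exact tame_of_spawn (by simp) (by simp) hr
    · exact tame_of_spawn (by simp) (by simp) hr
  | call g es =>
    exact tame_of_spawn (by simp [guessArgs, Tame]) (by simp) hr
  | not e | head e =>
    obtain ⟨b, -, hb⟩ := List.mem_map.1 hr
    cases hb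
    simp only [List.forall_mem_append, List.forall_mem_cons]
    refine ⟨⟨ht _, ?_⟩, by simp⟩
    first
      | exact ⟨trivial, hv _⟩
      | simp [Tame]
  | null e =>
    simp only [exprRules, List.mem_cons, List.not_mem_nil, or_false, Prod.mk.injEq] at hr
    rcases hr with ⟨rfl, rfl⟩ | ⟨rfl, rfl⟩ <;>
    · simp only [List.forall_mem_append, List.forall_mem_cons]
      refine ⟨⟨ht _, ?_⟩, by simp⟩
      simp [Tame]
  | tt | ff =>
    simp only [exprRules, List.mem_singleton, Prod.mk.injEq] at hr
    obtain ⟨rfl, rfl⟩ := hr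
    simp only [List.forall_mem_append, List.forall_mem_cons]
    refine ⟨⟨ht _, ?_⟩, by simp⟩
    simp [Tame]
  | nil | var | tail =>
    simp only [exprRules, List.mem_singleton, Prod.mk.injEq] at hr
    obtain ⟨rfl, rfl⟩ := hr
    simp [Tame]

theorem tame_of_rules {t : p.VLabel} (ht : t ≠ .init) {l : List p.VInstr} {o : Option p.VLabel}
    (hr : (l, o) ∈ p.rules k t) : (∀ i ∈ l, Tame i) ∧ o ≠ some .init := by
  cases t with
  | init => exact absurd rfl ht
  | acc => simp [rules] at hr
  | eval n =>
    simp only [rules, List.mem_cons, List.not_mem_nil, or_false, Prod.mk.injEq] at hr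
    rcases hr with ⟨rfl, rfl⟩ | ⟨rfl, rfl⟩
    · simp [Tame]
    · exact ⟨List.forall_mem_cons.2 ⟨trivial, tame_of_mem_setBit (by simp)⟩, by simp⟩
  | walk n =>
    simp only [rules, List.mem_cons, Prod.mk.injEq] at hr
    rcases hr with ⟨rfl, rfl⟩ | hr
    · simp [Tame]
    · exact tame_of_exprRules n.2.2 hr
  | evalBit n b =>
    simp only [rules, List.mem_singleton, Prod.mk.injEq] at hr
    obtain ⟨rfl, rfl⟩ := hr
    exact ⟨tame_of_mem_setBit (by simp), by simp⟩
  | evalArg n v =>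
    simp only [rules, List.mem_singleton, Prod.mk.injEq] at hr
    obtain ⟨rfl, rfl⟩ := hr
    simp [Tame]
  | evalBody g =>
    simp only [rules, List.mem_singleton, Prod.mk.injEq] at hr
    obtain ⟨rfl, rfl⟩ := hr
    simp [loadArgs, Tame]

theorem always_replicate_grow {B m : ℕ} {l : List p.VInstr} {s : p.VStore} {Q : p.VStore → Prop}
    (hst : s.stack = []) (hW : s.width + m ≤ B)
    (h : Always .depth x (InstrOK B) Q l { s with width := s.width + m }) :
    Always .depth x (InstrOK B) Q (List.replicate m .grow ++ l) s := by
  induction m generalizing s with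
  | zero => exact h
  | succ m ih =>
    refine ⟨⟨by omega, by simp [hst], fun _ => hst⟩, fun s₁ h₁ => ?_⟩
    rw [rel_grow] at h₁
    subst h₁
    refine ih hst (by simp only; omega) ?_
    simpa only [add_assoc, add_comm 1] using h

theorem always_of_init {l : List p.VInstr} {o : Option p.VLabel} (hr : (l, o) ∈ p.rules k .init)
    {s : p.VStore} (hh : s.inPos ≤ x.length + 1) (hs : InitOK k x s) :
    Always .depth x (InstrOK (maxWidth k x.length)) (LabelOK k x o) l s := by
  obtain ⟨hst, hd, hpos, j, hj, hW, hb⟩ := hs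
  have hWB : s.width ≤ maxWidth k x.length := by
    rw [hW, maxWidth]
    gcongr
  have hsafe : InstrOK (maxWidth k x.length) (.zero .tmp) s := ⟨hWB, by simp [hst], by simp⟩
  simp only [rules, List.mem_cons, List.not_mem_nil, or_false, Prod.mk.injEq] at hr
  rcases hr with ⟨rfl, rfl⟩ | ⟨rfl, rfl⟩ | ⟨rfl, rfl⟩
  · refine ⟨⟨hWB, by simp [hst], by simp⟩, fun s₁ h₁ => ?_⟩
    obtain ⟨he, rfl⟩ := rel_eq.1 h₁
    -- Here `pos = 2 ^ j - 1` is a head position, hence at most `x.length + 1`.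
    have hj' : j ≤ Nat.log 2 (x.length + 2) := by
      apply Nat.le_log_of_pow_le (by omega)
      omega
    have hWk : s₁.width + k = 1 + k * (j + 1) := by rw [hW]; ring
    have hWk' : s₁.width + k ≤ maxWidth k x.length := by
      rw [hWk, maxWidth]
      gcongr
    refine always_replicate_grow hst hWk' ?_
    refine ⟨⟨hWk', by simp [hst], by simp⟩, fun s₂ h₂ => ?_⟩
    obtain ⟨-, rfl⟩ := rel_dbl.1 h₂
    refine .inl ⟨rfl, hst, by simpa using hd, by simpa using hpos, j + 1, by omega, hWk, ?_⟩
    simp only [Function.update_self, pow_succ]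
    omega
  · refine ⟨⟨hWB, by simp [hst], by simp⟩, fun s₁ h₁ => ?_⟩
    obtain ⟨hσ, rfl⟩ := rel_look.1 h₁
    refine ⟨⟨hWB, by simp [hst], by simp⟩, fun s₂ h₂ => ?_⟩
    obtain ⟨-, rfl⟩ := rel_inc.1 h₂
    have h1 : ¬ x.length + 1 ≤ s.inPos := fun h => hσ (inputSym_eq_rightEnd.2 h)
    refine .inl ⟨rfl, hst, by simpa using hd, ?_, j, hj, hW, by simpa using hb⟩
    simp [HeadMove.apply, hpos]
    omega
  · have hm : MainOK (maxWidth k x.length) s := ⟨hWB, by simp [hst], by rw [hst]; trivial⟩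
    have hQ : LabelOK k x (some (.eval (p.bodyNode 0))) = MainOK (maxWidth k x.length) := by
      funext s
      simp [LabelOK]
    rw [hQ]
    refine always_of_tame ?_ hm
    have := tame_of_mem_setBit (p := p) (r := .val) (b := true) (by simp)
    simp only [List.forall_mem_append, List.forall_mem_cons]
    simp [Tame]
    exact this

theorem verifier_always {c : (p.verifier k).Cfg} (hc : (p.verifier k).Reachable x c) :
    Always .depth x (InstrOK (maxWidth k x.length)) (LabelOK k x c.next) c.code c.store := by
  refine RegProgram.Reachable.always (Q := LabelOK k x) ?_ ?_ ?_ hc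
  · exact .inl ⟨rfl, rfl, rfl, rfl, 0, by omega, rfl, rfl⟩
  · intro t s l o hs ht hr
    by_cases hti : t = .init
    · subst hti
      exact always_of_init hr hs.inPos_le (ht.resolve_right (by simp)).2
    · obtain ⟨h1, h2⟩ := tame_of_rules hti hr
      have hQ : LabelOK k x o = MainOK (maxWidth k x.length) := by
        funext s
        simp [LabelOK, h2]
      rw [hQ]
      exact always_of_tame h1 (ht.resolve_left (by simp [hti])).2
  · intro h W ρ t ρ' st hs
    obtain ⟨-, h1, -, h2, h3, h4⟩ := hs.resolve_left (by simp)
    exact .inr ⟨by simpa using h2, h1, h3, h4⟩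

/-- `2 ^ height ≤ depth + 1 ≤ 2 ^ width`: that registers cannot overflow bounds the stack on every
branch, good or bad. -/
theorem verifier_space {c : (p.verifier k).Cfg} (hc : (p.verifier k).Reachable x c) :
    c.store.width ≤ maxWidth k x.length ∧ c.store.stack.length ≤ c.store.width ∧
      ∀ l, c.code = .grow :: l → c.store.stack = [] := by
  have hb := hc.bounded.1 .depth
  have key : c.store.width ≤ maxWidth k x.length ∧
      2 ^ c.store.stack.length ≤ c.store.reg .depth + 1 ∧
      ∀ l, c.code = .grow :: l → c.store.stack = [] := by
    have h := verifier_always hc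
    obtain ⟨l, o, s⟩ := c
    cases l with
    | nil =>
      rcases h with ⟨-, h1, h2, -, j, hj, hW, -⟩ | ⟨-, h1, h2, -⟩
      · replace h1 : s.stack = [] := h1
        replace hW : s.width = 1 + k * j := hW
        refine ⟨?_, by simp [h1], by simp⟩
        simp only [hW, maxWidth]
        gcongr
      · exact ⟨h1, h2, by simp⟩
    | cons i l => exact ⟨h.1.1, h.1.2.1, fun l' hl' => h.1.2.2 (List.cons.inj hl').1⟩
  refine ⟨key.1, ?_, key.2.2⟩
  exact (Nat.pow_le_pow_iff_right (a := 2) (by omega)).1 (key.2.1.trans hb)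

open Relation

/-! ### Completeness -/

/-- The store with a depth register that fits the stack. -/
noncomputable def ready (W : ℕ) (τ : p.VReg → ℕ) (h : ℕ)
    (st : List (p.VLabel × (p.VReg → ℕ))) : p.VStore :=
  ⟨h, W, Function.update τ .depth (2 ^ st.length - 1), st⟩

/-- Final head position and registers are left open: the next frame restores its own registers, and
every evaluation repositions the head. -/
def Solves (k : ℕ) (x : List Bool) (W : ℕ) (τ : p.VReg → ℕ) (t : p.VLabel) (h : ℕ)
    (st : List (p.VLabel × (p.VReg → ℕ))) : Prop :=
  ∃ h' ≤ x.length + 1, ∃ ρ', ReflTransGen ((p.verifier k).Step x) ⟨[], some t, ready W τ h st⟩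
    ⟨[], none, h', W, ρ', st⟩

/-- The task `t` can be completed with a stack that grows by at most `κ * (Nat.log 2 z + 1)`. -/
def Doable (k : ℕ) (x : List Bool) (κ W : ℕ) (τ : p.VReg → ℕ) (t : p.VLabel) (z : ℕ) : Prop :=
  ∀ h st, h ≤ x.length + 1 → st.length + κ * (Nat.log 2 z + 1) ≤ W → Solves k x W τ t h st

section Ready

variable {W h a : ℕ} {τ : p.VReg → ℕ} {st : List (p.VLabel × (p.VReg → ℕ))} {r t : p.VReg}
  {s' : p.VStore}

theorem ready_reg (hr : r ≠ .depth) : (ready W τ h st).reg r = τ r :=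
  Function.update_of_ne hr _ _

theorem ready_update (hr : r ≠ .depth) :
    { ready W τ h st with reg := Function.update (ready W τ h st).reg r a } =
      ready W (Function.update τ r a) h st := by
  simp only [ready]
  rw [Function.update_comm hr]

theorem runs_setBit_ready {b : Bool} (hr : r ≠ .depth) :
    Runs .depth x (setBit r b) (ready W τ h st) s' ↔ (b = true → 1 < 2 ^ W) ∧
      s' = ready W (Function.update τ r b.toNat) h st := by
  rw [runs_setBit, ready_update hr]
  rfl

theorem rel_copy_ready (hr : r ≠ .depth) (ht : t ≠ .depth) :
    Rel .depth x (.copy r t) (ready W τ h st) s' ↔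
      s' = ready W (Function.update τ r (τ t)) h st := by
  rw [rel_copy, ready_update hr, ready_reg ht]

theorem rel_inc_ready (hr : r ≠ .depth) :
    Rel .depth x (.inc r) (ready W τ h st) s' ↔ τ r + 1 < 2 ^ W ∧
      s' = ready W (Function.update τ r (τ r + 1)) h st := by
  rw [rel_inc, ready_update hr, ready_reg hr]
  rfl

theorem rel_eq_ready (hr : r ≠ .depth) (ht : t ≠ .depth) :
    Rel .depth x (.eq r t) (ready W τ h st) s' ↔ τ r = τ t ∧ s' = ready W τ h st := by
  rw [rel_eq, ready_reg hr, ready_reg ht]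

theorem rel_look_ready {A : Set InSym} {d : HeadMove} :
    Rel .depth x (.look A d) (ready W τ h st) s' ↔
      inputSym x h ∈ A ∧ s' = ready W τ (min (d.apply h) (x.length + 1)) st :=
  rel_look

/-- The stack after the tasks `ls` have been saved. -/
noncomputable def pushAll (τ : p.VReg → ℕ) : List p.VLabel → List (p.VLabel × (p.VReg → ℕ)) →
    List (p.VLabel × (p.VReg → ℕ))
  | [], st => st
  | t :: ls, st => pushAll τ ls ((t, Function.update τ .depth (2 ^ st.length - 1)) :: st)

theorem runs_pushAll {ls : List p.VLabel} (hW : st.length + ls.length ≤ W) :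
    Runs .depth x (ls.map .push) (ready W τ h st) (ready W τ h (pushAll τ ls st)) := by
  induction ls generalizing st with
  | nil => rfl
  | cons t ls ih =>
    simp only [List.length_cons] at hW
    have h1 : 2 * (2 ^ st.length - 1) + 1 = 2 ^ (st.length + 1) - 1 := by
      have := Nat.one_le_two_pow (n := st.length)
      rw [pow_succ]
      omega
    refine ⟨_, rel_push.2 ⟨?_, rfl⟩, ?_⟩
    · simp only [ready, Function.update_self, h1]
      have := Nat.pow_le_pow_right (n := 2) (by omega) (show st.length + 1 ≤ W by omega)
      have := Nat.one_le_two_pow (n := st.length + 1)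
      omega
    · rw [pushAll]
      convert ih (st := (t, Function.update τ .depth (2 ^ st.length - 1)) :: st)
        (by simp only [List.length_cons]; omega) using 1
      simp only [ready, Function.update_self, Function.update_idem, h1, List.length_cons]

/-- The task pushed last is run first. When a task runs, its own frame and all those above it are
gone, which explains the strict bound on the stack. -/
theorem steps_pushAll {ls : List p.VLabel} {ρ : p.VReg → ℕ} (hh : h ≤ x.length + 1)
    (hls : ∀ t ∈ ls, ∀ h st', h ≤ x.length + 1 → st'.length < st.length + ls.length →
      Solves k x W τ t h st') :
    ∃ h' ≤ x.length + 1, ∃ ρ', ReflTransGen ((p.verifier k).Step x)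
      ⟨[], none, h, W, ρ, pushAll τ ls st⟩ ⟨[], none, h', W, ρ', st⟩ := by
  induction ls generalizing st with
  | nil => exact ⟨h, hh, ρ, .refl⟩
  | cons t ls ih =>
    simp only [List.length_cons] at hls
    obtain ⟨h₁, hh₁, ρ₁, hs₁⟩ := ih (st := (t, Function.update τ .depth (2 ^ st.length - 1)) :: st)
      fun t' ht' h' st' hh' hst' => hls t' (List.mem_cons_of_mem _ ht') h' st' hh'
        (by simp only [List.length_cons] at hst'; omega)
    obtain ⟨h₂, hh₂, ρ₂, hs₂⟩ := hls t List.mem_cons_self h₁ st hh₁ (by omega)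
    exact ⟨h₂, hh₂, ρ₂, (hs₁.tail .ret).trans hs₂⟩

end Ready

theorem exists_perm_cons_le {α : Type} (f : α → ℕ) {l : List α} (hl : l ≠ []) :
    ∃ a l', l.Perm (a :: l') ∧ ∀ b ∈ l', f b ≤ f a := by
  induction l with
  | nil => exact absurd rfl hl
  | cons c l ih =>
    by_cases hl' : l = []
    · subst hl'
      exact ⟨c, [], .refl _, by simp⟩
    · obtain ⟨a, l', hp, hle⟩ := ih hl'
      rcases le_total (f c) (f a) with h | h
      · exact ⟨a, c :: l', (hp.cons c).trans (.swap _ _ _), List.forall_mem_cons.2 ⟨h, hle⟩⟩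
      · refine ⟨c, l, .refl _, fun b hb => ?_⟩
        rcases List.mem_cons.1 (hp.mem_iff.1 hb) with rfl | hb
        · exact h
        · exact (hle b hb).trans h

/-- The largest task is left at the bottom of the added part of the stack, and the others have less
than half the size. -/
theorem exists_steps_pushAll {κ W h z : ℕ} {τ : p.VReg → ℕ} {st : List (p.VLabel × (p.VReg → ℕ))}
    {L : List (p.VLabel × ℕ)} (hL : L ≠ []) (hlen : L.length ≤ κ)
    (hz : (L.map Prod.snd).sum < z) (hh : h ≤ x.length + 1)
    (hW : st.length + κ * (Nat.log 2 z + 1) ≤ W) (hpos : ∀ t ∈ L, 0 < t.2)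
    (hd : ∀ t ∈ L, Doable k x κ W τ t.1 t.2) :
    ∃ ls : List p.VLabel, ls.Perm (L.map Prod.fst) ∧ ∃ h' ≤ x.length + 1, ∃ ρ',
      ReflTransGen ((p.verifier k).Step x) ⟨ls.map .push, none, ready W τ h st⟩
        ⟨[], none, h', W, ρ', st⟩ := by
  obtain ⟨a, L', hp, hle⟩ := exists_perm_cons_le Prod.snd hL
  have hlen' := hp.length_eq
  simp only [List.length_cons] at hlen'
  have hκ : κ ≤ κ * (Nat.log 2 z + 1) := Nat.le_mul_of_pos_right _ (by omega)
  have hsum : a.2 + (L'.map Prod.snd).sum < z := by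
    have := (hp.map Prod.snd).sum_eq
    simp only [List.map_cons, List.sum_cons] at this
    omega
  refine ⟨(a :: L').map Prod.fst, (hp.map _).symm, ?_⟩
  have h1 : Runs .depth x (((a :: L').map Prod.fst).map .push) (ready W τ h st)
      (ready W τ h (pushAll τ ((a :: L').map Prod.fst) st)) :=
    runs_pushAll (by simp only [List.length_map, List.length_cons]; omega)
  obtain ⟨h₁, hh₁, ρ₁, hs₁⟩ := steps_pushAll (k := k) (x := x) (W := W) (τ := τ)
    (ls := L'.map Prod.fst)
    (st := (a.1, Function.update τ .depth (2 ^ st.length - 1)) :: st) (h := h)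
    (ρ := (ready W τ h (pushAll τ ((a :: L').map Prod.fst) st)).reg) hh (by
      intro t ht h' st' hh' hst'
      obtain ⟨b, hb, rfl⟩ := List.mem_map.1 ht
      have hbL : b ∈ L := hp.mem_iff.2 (List.mem_cons_of_mem _ hb)
      refine hd b hbL h' st' hh' ?_
      have hbs : b.2 ≤ (L'.map Prod.snd).sum := List.le_sum_of_mem (List.mem_map_of_mem hb)
      have hba := hle b hb
      -- From `b.2 ≤ a.2` and `a.2 + b.2 < z` follows `2 * b.2 < z`. The unit of logarithm gained
      -- pays for the at most `κ` sibling frames below.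
      have hlog : Nat.log 2 b.2 + 1 ≤ Nat.log 2 z := by
        rw [← Nat.log_mul_base (by omega) (hpos b hbL).ne']
        exact Nat.log_mono_right (by omega)
      have := Nat.mul_le_mul_left κ hlog
      have h2 : κ * (Nat.log 2 z + 1) = κ * Nat.log 2 z + κ := by ring
      simp only [List.length_cons, List.length_map] at hst'
      omega)
  -- The largest task runs last, on the original stack `st`, so its logarithm need not be smaller.
  obtain ⟨h₂, hh₂, ρ₂, hs₂⟩ := hd a (hp.mem_iff.2 List.mem_cons_self) h₁ st hh₁ (by
    have : Nat.log 2 a.2 ≤ Nat.log 2 z := Nat.log_mono_right (by omega)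
    have := Nat.mul_le_mul_left κ (Nat.add_le_add_right this 1)
    omega)
  exact ⟨h₂, hh₂, ρ₂, ((Runs.steps (P := p.verifier k) h1 none).trans (hs₁.tail .ret)).trans hs₂⟩

section Eval

variable {κ W z : ℕ} {τ τ' : p.VReg → ℕ}

theorem Doable.of_rule {t t' : p.VLabel} {l : List p.VInstr} (hr : (l, some t') ∈ p.rules k t)
    (hl : ∀ h st, Runs .depth x l (ready W τ h st) (ready W τ' h st))
    (hd : Doable k x κ W τ' t' z) : Doable k x κ W τ t z := by
  intro h st hh hW
  obtain ⟨h', hh', ρ', hs⟩ := hd h st hh hW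
  exact ⟨h', hh', ρ', (Runs.steps_of_rule (P := p.verifier k) (hl h st) hr).trans hs⟩

/-- The head can be moved to any position. -/
theorem steps_walk (hx : x.length + 2 < 2 ^ W) (n : p.Node) {h h₀ : ℕ} (hh : h ≤ x.length + 1)
    (hh₀ : h₀ ≤ x.length + 1) (st : List (p.VLabel × (p.VReg → ℕ))) :
    ReflTransGen ((p.verifier k).Step x) ⟨[], some (.eval n), ready W τ h st⟩
      ⟨[], some (.walk n), ready W (Function.update τ .pos (h₀ + 1)) h₀ st⟩ := by
  have hback : ReflTransGen ((p.verifier k).Step x) ⟨[], some (.eval n), ready W τ h st⟩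
      ⟨[], some (.eval n), ready W τ 0 st⟩ := by
    induction h with
    | zero => exact .refl
    | succ h ih =>
      refine (Runs.steps_of_rule (P := p.verifier k) (l := [.look Set.univ .left])
        (o := some (.eval n)) ⟨_, rel_look_ready.2 ⟨trivial, rfl⟩, rfl⟩ ?_).trans ?_
      · simp [rules]
      · rw [show min (HeadMove.left.apply (h + 1)) (x.length + 1) = h by
          simp only [HeadMove.apply]; omega]
        exact ih (by omega)
  refine hback.trans ?_
  induction h₀ with
  | zero =>
    refine Runs.steps_of_rule (P := p.verifier k)
      (l := .look {.leftEnd} .stay :: setBit .pos true) ?_ ?_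
    · exact ⟨_, rel_look_ready.2 ⟨inputSym_eq_leftEnd.2 rfl, rfl⟩,
        (runs_setBit_ready (by simp)).2 ⟨fun _ => by omega, rfl⟩⟩
    · simp [rules]
  | succ h₀ ih =>
    refine (ih (by omega)).trans (Runs.steps_of_rule (P := p.verifier k)
      (l := [.look {.rightEnd}ᶜ .right, .inc .pos]) ?_ ?_)
    · refine ⟨_, rel_look_ready.2 ⟨?_, rfl⟩, _, (rel_inc_ready (by simp)).2 ⟨?_, rfl⟩, ?_⟩
      · intro he
        have := inputSym_eq_rightEnd.1 he
        omega
      · simp only [Function.update_self]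
        omega
      · rw [runs_nil]
        simp only [Function.update_self, Function.update_idem, HeadMove.apply]
        rw [min_eq_left (by omega)]
    · simp [rules]

variable {f : Fin (p.numAux + 1)} {e : CFExpr p.arity (p.arity f)} {he : e ∈ (p.body f).subs}

theorem Doable.of_exprRules (hx : x.length + 2 < 2 ^ W) {h₀ : ℕ} (hh₀ : h₀ ≤ x.length + 1)
    (h : ∀ st : List (p.VLabel × (p.VReg → ℕ)), st.length + κ * (Nat.log 2 z + 1) ≤ W →
      ∃ l o, (l, o) ∈ p.exprRules f e he ∧ ∃ h' ≤ x.length + 1, ∃ ρ',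
        ReflTransGen ((p.verifier k).Step x)
          ⟨l, o, ready W (Function.update τ .pos (h₀ + 1)) h₀ st⟩ ⟨[], none, h', W, ρ', st⟩) :
    Doable k x κ W τ (.eval ⟨f, e, he⟩) z := by
  intro h₁ st hh₁ hst
  obtain ⟨l, o, hr, h', hh', ρ', hs⟩ := h st hst
  refine ⟨h', hh', ρ', (steps_walk hx _ hh₁ hh₀ st).trans (.head (.jump ?_) hs)⟩
  exact List.mem_cons_of_mem _ hr

theorem Doable.of_check (hx : x.length + 2 < 2 ^ W) {h₀ : ℕ} (hh₀ : h₀ ≤ x.length + 1)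
    {l : List p.VInstr} (hr : (l, none) ∈ p.exprRules f e he)
    (hl : ∀ st, Runs .depth x l (ready W (Function.update τ .pos (h₀ + 1)) h₀ st)
      (ready W τ' h₀ st)) :
    Doable k x κ W τ (.eval ⟨f, e, he⟩) z :=
  .of_exprRules hx hh₀ fun st _ => ⟨l, none, hr, h₀, hh₀, _,
    Runs.steps (P := p.verifier k) (hl st) none⟩

theorem Doable.of_continue (hx : x.length + 2 < 2 ^ W) {h₀ z' : ℕ} (hh₀ : h₀ ≤ x.length + 1)
    {l : List p.VInstr} {t : p.VLabel} (hr : (l, some t) ∈ p.exprRules f e he)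
    (hl : ∀ st, Runs .depth x l (ready W (Function.update τ .pos (h₀ + 1)) h₀ st)
      (ready W τ' h₀ st)) (hz : z' ≤ z) (hd : Doable k x κ W τ' t z') :
    Doable k x κ W τ (.eval ⟨f, e, he⟩) z := by
  refine .of_exprRules hx hh₀ fun st hst => ⟨l, _, hr, ?_⟩
  obtain ⟨h', hh', ρ', hs⟩ := hd h₀ st hh₀ (by
    have := Nat.mul_le_mul_left κ (Nat.add_le_add_right (Nat.log_mono_right (b := 2) hz) 1)
    omega)
  exact ⟨h', hh', ρ', (Runs.steps (P := p.verifier k) (hl st) _).trans hs⟩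

theorem Doable.of_spawn (hx : x.length + 2 < 2 ^ W) {pre : List p.VInstr}
    {L : List (p.VLabel × ℕ)} (hL : L ≠ []) (hlen : L.length ≤ κ)
    (hr : ∀ r ∈ spawn pre (L.map Prod.fst), r ∈ p.exprRules f e he)
    (hpre : ∀ st, Runs .depth x pre (ready W (Function.update τ .pos 1) 0 st) (ready W τ' 0 st))
    (hz : (L.map Prod.snd).sum < z) (hpos : ∀ t ∈ L, 0 < t.2)
    (hd : ∀ t ∈ L, Doable k x κ W τ' t.1 t.2) :
    Doable k x κ W τ (.eval ⟨f, e, he⟩) z := by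
  refine .of_exprRules hx (h₀ := 0) (by omega) fun st hst => ?_
  obtain ⟨ls, hp, h', hh', ρ', hs⟩ := exists_steps_pushAll hL hlen hz (Nat.zero_le _) hst hpos hd
  refine ⟨pre ++ ls.map .push, none, hr _ ?_, h', hh', ρ', ?_⟩
  · exact List.mem_map.2 ⟨ls, List.mem_permutations.2 hp, rfl⟩
  · have key : ∀ (l l' : List p.VInstr) (s s' : p.VStore), Runs .depth x l s s' →
        ReflTransGen ((p.verifier k).Step x) ⟨l ++ l', none, s⟩ ⟨l', none, s'⟩ := by
      intro l l' s s' h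
      induction l generalizing s with
      | nil => cases h; exact .refl
      | cons i l ih =>
        obtain ⟨s₁, hr, h⟩ := h
        exact .head (.instr hr) (ih _ h)
    exact (key _ _ _ _ (hpre st)).trans hs

end Eval

theorem exists_runs_guessArgs {g : Fin (p.numAux + 1)} {W h : ℕ} {τ : p.VReg → ℕ}
    {a : Fin (p.arity g) → ℕ} (ha : ∀ j, a j < 2 ^ W) :
    ∃ τ', (∀ st, Runs .depth x (p.guessArgs g) (ready W τ h st) (ready W τ' h st)) ∧
      (∀ j, τ' (.arg ⟨g, j⟩) = a j) ∧ ∀ r, (∀ v, r ≠ .arg v) → τ' r = τ r := by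
  have key : ∀ (l : List (Fin (p.arity g))) (τ : p.VReg → ℕ), ∃ τ' : p.VReg → ℕ,
      (∀ st, Runs .depth x (l.map fun j => .guess (.arg ⟨g, j⟩)) (ready W τ h st)
        (ready W τ' h st)) ∧
      (∀ j ∈ l, τ' (.arg ⟨g, j⟩) = a j) ∧ ∀ r, (∀ j ∈ l, r ≠ .arg ⟨g, j⟩) → τ' r = τ r := by
    intro l
    induction l with
    | nil => exact fun τ => ⟨τ, fun _ => rfl, by simp, fun _ _ => rfl⟩
    | cons j l ih =>
      intro τ
      obtain ⟨τ', h1, h2, h3⟩ := ih (Function.update τ (.arg ⟨g, j⟩) (a j))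
      refine ⟨τ', fun st => ⟨_, rel_guess.2 ⟨a j, ha j, rfl⟩, ?_⟩, ?_, fun r hr => ?_⟩
      · rw [ready_update (by simp)]
        exact h1 st
      · intro i hi
        by_cases hil : i ∈ l
        · exact h2 i hil
        · obtain rfl := (List.mem_cons.1 hi).resolve_right hil
          rw [h3 _ fun j' hj' he => hil ?_, Function.update_self]
          simp only [VReg.arg.injEq, Sigma.mk.injEq, heq_eq_eq, true_and] at he
          exact he ▸ hj'
      · rw [h3 r fun i hi => hr i (List.mem_cons_of_mem _ hi),
          Function.update_of_ne (hr j List.mem_cons_self)]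
  obtain ⟨τ', h1, h2, h3⟩ := key (List.ofFn id) τ
  rw [List.map_ofFn] at h1
  exact ⟨τ', h1, fun j => h2 j (by simp), fun r hr => h3 r fun j _ => hr _⟩

theorem runs_loadArgs_ready {g : Fin (p.numAux + 1)} {W h : ℕ} {τ : p.VReg → ℕ}
    {st : List (p.VLabel × (p.VReg → ℕ))} :
    Runs .depth x (p.loadArgs g) (ready W τ h st) (ready W (fun r => match r with
      | .env ⟨f, i⟩ => if f = g then τ (.arg ⟨f, i⟩) else τ (.env ⟨f, i⟩)
      | r => τ r) h st) := by
  rw [runs_loadArgs]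
  simp only [ready, RegStore.mk.injEq, true_and, and_true]
  funext r
  cases r <;> simp [Function.update]

/-- The last rule of the tree dictates the choices of the verifier: where to stop the head, which
code to run, which arguments to guess. Unary rules leave the stack alone; conditionals and calls use
`Doable.of_spawn`, with at most `κ` premises. The induction is on a bound for the size, since the
function whose body is evaluated changes in a call. -/
theorem doable_of_tree {κ W : ℕ} (hκ : ∀ f, p.arity f + 2 ≤ κ) (hx : x.length + 2 < 2 ^ W) {N : ℕ} :
    ∀ {f : Fin (p.numAux + 1)} {e : CFExpr p.arity (p.arity f)} (he : e ∈ (p.body f).subs)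
      {ρ : Fin (p.arity f) → CFVal} {v : CFVal} (T : CFTree p ρ e v), T.size ≤ N →
      (∀ i, (ρ i).SuffixOf x) → ∀ τ : p.VReg → ℕ, (∀ i, τ (.env ⟨f, i⟩) = codeVal x (ρ i)) →
      τ .val = codeVal x v → Doable k x κ W τ (.eval ⟨f, e, he⟩) T.size := by
  have h1W : 1 < 2 ^ W := by omega
  induction N with
  | zero => exact fun _ _ _ T hT => absurd hT T.size_pos.not_ge
  | succ N ih =>
    intro f e he ρ v T hT hρ τ hτ hv
    cases T with
    | var i =>
      refine .of_check hx (h₀ := 0) (by omega) (List.mem_singleton_self _)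
        (τ' := Function.update τ .pos 1) fun st => ?_
      simp [runs_cons, runs_nil, rel_eq_ready, hτ, hv]
    | tt =>
      refine .of_check hx (h₀ := 0) (by omega) (List.mem_singleton_self _)
        (τ' := Function.update (Function.update τ .pos 1) .tmp 1) fun st => ?_
      simp [runs_append, runs_cons, runs_nil, runs_setBit_ready, rel_eq_ready, hv, codeVal, h1W]
    | ff =>
      refine .of_check hx (h₀ := 0) (by omega) (List.mem_singleton_self _)
        (τ' := Function.update (Function.update τ .pos 1) .tmp 0) fun st => ?_
      simp [runs_append, runs_cons, runs_nil, runs_setBit_ready, rel_eq_ready, hv, codeVal]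
    | nil =>
      -- On the right end marker `pos` is `x.length + 2`, the code of `[]`.
      refine .of_check hx (h₀ := x.length + 1) le_rfl (List.mem_singleton_self _)
        (τ' := Function.update τ .pos (x.length + 2)) fun st => ?_
      simp [runs_cons, runs_nil, rel_eq_ready, rel_look_ready, hv, codeVal, HeadMove.apply,
        inputSym_eq_rightEnd]
    | @not _ _ e b T =>
      simp only [CFTree.size] at hT ⊢
      refine .of_continue hx (h₀ := 0) (by omega)
        (List.mem_map_of_mem (a := b) (by cases b <;> simp))
        (fun st => ?_) (Nat.le_succ _)
        (ih (CFExpr.sub_not he) T (by omega) hρ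
          (Function.update (Function.update (Function.update τ .pos 1) .tmp (!b).toNat) .val b.toNat)
          (by simpa using hτ) (by simp [codeVal]))
      simp [runs_append, runs_cons, runs_setBit_ready, rel_eq_ready, hv, codeVal, h1W]
    | @nullNil _ _ e T =>
      simp only [CFTree.size] at hT ⊢
      refine .of_continue hx (h₀ := x.length + 1) le_rfl List.mem_cons_self
        (fun st => ?_) (Nat.le_succ _)
        (ih (CFExpr.sub_null he) T (by omega) hρ
          (Function.update (Function.update (Function.update τ .pos (x.length + 2)) .tmp 1) .val
            (x.length + 2))
          (by simpa using hτ) (by simp [codeVal]))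
      simp [runs_append, runs_cons, runs_nil, runs_setBit_ready, rel_eq_ready, rel_look_ready,
        rel_copy_ready, hv, codeVal, h1W, HeadMove.apply, inputSym_eq_rightEnd]
    | @nullCons _ _ e b l T =>
      obtain ⟨h, hh, hb, hc, -⟩ := exists_pos_of_cons (T.suffixOf hρ)
      simp only [CFTree.size] at hT ⊢
      refine .of_continue hx (h₀ := h) (by omega) (List.mem_cons_of_mem _ List.mem_cons_self)
        (fun st => ?_) (Nat.le_succ _)
        (ih (CFExpr.sub_null he) T (by omega) hρ
          (Function.update (Function.update (Function.update τ .pos (h + 1)) .tmp 0) .val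
            (h + 1))
          (by simpa using hτ) (by simp [hc]))
      have : min h (x.length + 1) = h := by omega
      simp [runs_append, runs_cons, runs_nil, runs_setBit_ready, rel_eq_ready, rel_look_ready,
        rel_copy_ready, hv, codeVal, HeadMove.apply, hb, bitSyms, this]
    | @head _ _ e b l T =>
      obtain ⟨h, hh, hb, hc, -⟩ := exists_pos_of_cons (T.suffixOf hρ)
      simp only [CFTree.size] at hT ⊢
      refine .of_continue hx (h₀ := h) (by omega)
        (List.mem_map_of_mem (a := b) (by cases b <;> simp))
        (fun st => ?_) (Nat.le_succ _)
        (ih (CFExpr.sub_head he) T (by omega) hρ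
          (Function.update (Function.update (Function.update τ .pos (h + 1)) .tmp b.toNat) .val
            (h + 1))
          (by simpa using hτ) (by simp [hc]))
      have : min h (x.length + 1) = h := by omega
      simp [runs_append, runs_cons, runs_nil, runs_setBit_ready, rel_eq_ready, rel_look_ready,
        rel_copy_ready, hv, codeVal, HeadMove.apply, hb, this, h1W]
    | @tail _ _ e b l T =>
      obtain ⟨h, hh, hb, hc, hc'⟩ := exists_pos_of_cons (T.suffixOf hρ)
      simp only [CFTree.size] at hT ⊢
      refine .of_continue hx (h₀ := h) (by omega) (List.mem_singleton_self _)
        (fun st => ?_) (Nat.le_succ _)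
        (ih (CFExpr.sub_tail he) T (by omega) hρ
          (Function.update (Function.update (Function.update τ .pos (h + 1)) .tmp (h + 2)) .val
            (h + 1))
          (by simpa using hτ) (by simp [hc]))
      have : min h (x.length + 1) = h := by omega
      have : h + 1 + 1 < 2 ^ W := by omega
      simp [runs_cons, runs_nil, rel_eq_ready, rel_look_ready, rel_inc_ready,
        rel_copy_ready, HeadMove.apply, bitSyms, *]
    | @iteTrue _ _ e₀ e₁ e₂ _ T₀ T₁ =>
      simp only [CFTree.size] at hT ⊢
      refine .of_spawn hx (pre := []) (τ' := Function.update τ .pos 1)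
        (L := [(.evalBit ⟨f, e₀, CFExpr.sub_ite₀ he⟩ true, T₀.size),
          (.eval ⟨f, e₁, CFExpr.sub_ite₁ he⟩, T₁.size)]) (by simp) ?_
        (fun r hr => List.mem_append_left _ hr) (fun st => rfl) (by simp) ?_ ?_
      -- A conditional has two premises, which the summand 2 in `hκ` covers for any function.
      · exact (by simp : 2 ≤ p.arity 0 + 2).trans (hκ 0)
      · simp [T₀.size_pos, T₁.size_pos]
      · simp only [List.forall_mem_cons]
        refine ⟨?_, ih _ T₁ (by omega) hρ _ (by simpa using hτ) (by simpa using hv), by simp⟩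
        exact .of_rule (List.mem_singleton_self _)
          (fun h st => (runs_setBit_ready (by simp)).2 ⟨fun _ => h1W, rfl⟩)
          (ih _ T₀ (by omega) hρ _ (by simpa using hτ) (by simp [codeVal]))
    | @iteFalse _ _ e₀ e₁ e₂ _ T₀ T₂ =>
      simp only [CFTree.size] at hT ⊢
      refine .of_spawn hx (pre := []) (τ' := Function.update τ .pos 1)
        (L := [(.evalBit ⟨f, e₀, CFExpr.sub_ite₀ he⟩ false, T₀.size),
          (.eval ⟨f, e₂, CFExpr.sub_ite₂ he⟩, T₂.size)]) (by simp) ?_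
        (fun r hr => List.mem_append_right _ hr) (fun st => rfl) (by simp) ?_ ?_
      · exact (by simp : 2 ≤ p.arity 0 + 2).trans (hκ 0)
      · simp [T₀.size_pos, T₂.size_pos]
      · simp only [List.forall_mem_cons]
        refine ⟨?_, ih _ T₂ (by omega) hρ _ (by simpa using hτ) (by simpa using hv), by simp⟩
        exact .of_rule (List.mem_singleton_self _)
          (fun h st => (runs_setBit_ready (by simp)).2 ⟨fun _ => h1W, rfl⟩)
          (ih _ T₀ (by omega) hρ _ (by simpa using hτ) (by simp [codeVal]))
    | @call _ _ g es w _ Ts T =>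
      simp only [CFTree.size] at hT ⊢
      have hw : ∀ j, (w j).SuffixOf x := fun j => (Ts j).suffixOf hρ
      obtain ⟨τ', h1, h2, h3⟩ := exists_runs_guessArgs (x := x) (h := 0) (W := W)
        (τ := Function.update τ .pos 1) (a := fun j => codeVal x (w j))
        fun j => (codeVal_le x (w j)).trans_lt hx
      have hTs : ∀ j, (Ts j).size ≤ ∑ i, (Ts i).size := fun j =>
        Finset.single_le_sum (f := fun i => (Ts i).size) (fun _ _ => Nat.zero_le _)
          (Finset.mem_univ j)
      have hτ' : ∀ i, τ' (.env ⟨f, i⟩) = codeVal x (ρ i) := fun i => by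
        rw [h3 _ (by simp)]; simpa using hτ i
      refine .of_spawn hx (pre := p.guessArgs g) (τ' := τ')
        (L := (.evalBody g, T.size) :: List.ofFn fun j =>
          (.evalArg ⟨f, es j, CFExpr.sub_call he j⟩ ⟨g, j⟩, (Ts j).size)) (by simp) ?_
        (fun r hr => ?_) h1 ?_ ?_ ?_
      · have := hκ g
        simp
        omega
      · rw [List.map_cons, List.map_ofFn] at hr
        exact hr
      · rw [List.map_cons, List.map_ofFn, List.sum_cons, List.sum_ofFn]
        simp only [Function.comp_apply]
        omega
      · simp only [List.forall_mem_cons, List.forall_mem_ofFn_iff]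
        exact ⟨T.size_pos, fun j => (Ts j).size_pos⟩
      · simp only [List.forall_mem_cons, List.forall_mem_ofFn_iff]
        refine ⟨?_, fun j => ?_⟩
        · refine .of_rule (List.mem_singleton_self _) (fun h st => runs_loadArgs_ready)
            (ih _ T (by omega) hw _ (by simpa using h2) ?_)
          refine (h3 .val (by simp)).trans ?_
          simpa using hv
        · have := hTs j
          exact .of_rule (List.mem_singleton_self _)
            (fun h st => ⟨_, (rel_copy_ready (by simp) (by simp)).2 rfl, rfl⟩)
            (ih _ (Ts j) (by omega) hρ _ (by simpa using hτ') (by simp [h2]))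

theorem runs_replicate_grow {m W h : ℕ} {τ : p.VReg → ℕ} {st : List (p.VLabel × (p.VReg → ℕ))} :
    Runs .depth x (List.replicate m .grow) (ready W τ h st) (ready (W + m) τ h st) := by
  induction m generalizing W with
  | zero => rfl
  | succ m ih =>
    refine ⟨_, rel_grow.2 rfl, ?_⟩
    rw [← Nat.add_assoc, Nat.add_right_comm]
    exact ih

/-- The input head can reach any position, with a sufficient width. -/
theorem exists_reachable_init (hk : 0 < k) {i : ℕ} (hi : i ≤ x.length + 1) :
    ∃ j τ, i < 2 ^ j ∧ τ .pos = i ∧ τ .bound + 1 = 2 ^ j ∧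
      (p.verifier k).Reachable x ⟨[], some .init, ready (1 + k * j) τ i []⟩ := by
  induction i with
  | zero =>
    refine ⟨0, fun _ => 0, by simp, rfl, rfl, ?_⟩
    have : ready (1 + k * 0) (fun _ => 0) 0 [] = (p.verifier k).init.store := by
      simp [RegProgram.init, ready]
    rw [this]
    exact .refl
  | succ i ih =>
    obtain ⟨j, τ, hij, hpos, hb, hr⟩ := ih (by omega)
    have hpow : ∀ j, 2 ^ j < 2 ^ (1 + k * j) := fun j =>
      Nat.pow_lt_pow_right (by omega) (by have := Nat.le_mul_of_pos_left j hk; omega)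
    have key : ∃ j τ, i + 1 < 2 ^ j ∧ τ .pos = i ∧ τ .bound + 1 = 2 ^ j ∧
        (p.verifier k).Reachable x ⟨[], some .init, ready (1 + k * j) τ i []⟩ := by
      by_cases hij' : i + 1 < 2 ^ j
      · exact ⟨j, τ, hij', hpos, hb, hr⟩
      -- Now `i + 1 = 2 ^ j`, so `pos` equals `bound` and the growth rule applies before the head
      -- moves on.
      · have hpj := hpow (j + 1)
        rw [pow_succ] at hpj
        have hrun : Runs .depth x (.eq .pos .bound :: (List.replicate k .grow ++ [.dbl .bound]))
            (ready (1 + k * j) τ i [])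
            (ready (1 + k * (j + 1)) (Function.update τ .bound (2 * τ .bound + 1)) i []) := by
          refine ⟨_, (rel_eq_ready (by simp) (by simp)).2 ⟨by omega, rfl⟩,
            runs_append.2 ⟨_, runs_replicate_grow, ?_⟩⟩
          rw [show 1 + k * j + k = 1 + k * (j + 1) by ring]
          refine ⟨_, rel_dbl.2 ⟨?_, rfl⟩, ?_⟩
          · rw [ready_reg (by simp)]
            simp only [ready]
            omega
          · rw [ready_update (by simp), ready_reg (by simp)]
            rfl
        refine ⟨j + 1, Function.update τ .bound (2 * τ .bound + 1), ?_, by simpa using hpos, ?_,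
          hr.trans (Runs.steps_of_rule (P := p.verifier k) hrun List.mem_cons_self)⟩
        · rw [pow_succ]; omega
        · rw [Function.update_self, pow_succ]; omega
    obtain ⟨j, τ, hij, hpos, hb, hr⟩ := key
    refine ⟨j, Function.update τ .pos (i + 1), hij, by simp, by simpa using hb,
      hr.trans (Runs.steps_of_rule (P := p.verifier k)
        (l := [.look {.rightEnd}ᶜ .right, .inc .pos]) ?_ (by simp [rules]))⟩
    have hpj := hpow j
    refine ⟨_, rel_look_ready.2 ⟨?_, rfl⟩, _, (rel_inc_ready (by simp)).2 ⟨by omega, rfl⟩, ?_⟩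
    · intro he
      have := inputSym_eq_rightEnd.1 he
      omega
    · rw [runs_nil, hpos, HeadMove.apply, min_eq_left (by omega)]

theorem verifier_complete {κ : ℕ} (hκ : ∀ f, p.arity f + 2 ≤ κ) (hk : 0 < k)
    (T : CFTree p (fun _ => .list x) (p.body 0) (.bit true))
    (hT : ∀ j, x.length + 2 ≤ 2 ^ j → κ * (Nat.log 2 T.size + 1) ≤ k * j) :
    ∃ s, (p.verifier k).Reachable x ⟨[], some .acc, s⟩ := by
  obtain ⟨j, τ, hj, hpos, -, hr⟩ := exists_reachable_init (p := p) hk (le_refl (x.length + 1))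
  have hT := hT j hj
  have hpow : 2 ^ j < 2 ^ (1 + k * j) :=
    Nat.pow_lt_pow_right (by omega) (by have := Nat.le_mul_of_pos_left j hk; omega)
  -- The code of True is 1, and the code of the whole input is 2.
  let τ' : p.VReg → ℕ := Function.update (Function.update τ .val 1) (.env p.entryParam) 2
  have hentry : ∀ i : Fin (p.arity 0), (⟨0, i⟩ : p.Param) = p.entryParam := fun i => by
    have h1 := i.2
    have h2 := p.arity_entry
    have : i = ⟨0, by omega⟩ := Fin.ext (by simp only; omega)
    rw [this]
    rfl
  have hd := doable_of_tree (k := k) (W := 1 + k * j) hκ (by omega) (CFExpr.mem_subs_self _) T le_rfl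
    (fun _ => List.suffix_rfl) τ' (fun i => by simp [τ', hentry, codeVal]) (by simp [τ', codeVal])
  -- Of the width `1 + k * j`, the 1 pays for the frame of `acc` and `k * j` for the verification of
  -- the tree.
  obtain ⟨h', hh', ρ', hs⟩ := hd (x.length + 1) (pushAll τ' [.acc] []) le_rfl (by
    simp only [pushAll, List.length_singleton]
    omega)
  have hrun : Runs .depth x (.look {.rightEnd} .stay :: (setBit .val true ++
      [.zero (.env p.entryParam), .inc (.env p.entryParam), .inc (.env p.entryParam), .push .acc]))
      (ready (1 + k * j) τ (x.length + 1) [])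
      (ready (1 + k * j) τ' (x.length + 1) (pushAll τ' [.acc] [])) := by
    refine ⟨_, rel_look_ready.2 ⟨inputSym_eq_rightEnd.2 le_rfl, rfl⟩, runs_append.2
      ⟨_, (runs_setBit_ready (by simp)).2 ⟨fun _ => by omega, rfl⟩, _, rel_zero.2 rfl, ?_⟩⟩
    rw [ready_update (by simp)]
    refine ⟨_, (rel_inc_ready (by simp)).2 ⟨?_, rfl⟩, _, (rel_inc_ready (by simp)).2 ⟨?_, rfl⟩, ?_⟩
    · simp only [Function.update_self]
      omega
    · simp only [Function.update_self]
      omega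
    · have := runs_pushAll (x := x) (h := x.length + 1) (τ := τ') (st := []) (W := 1 + k * j)
        (ls := [.acc]) (by simp)
      simpa [HeadMove.apply, τ'] using this
  refine ⟨_, ((hr.trans (Runs.steps_of_rule (P := p.verifier k) hrun ?_)).trans hs).tail .ret⟩
  simp [rules, bodyNode]

end CFProgram

/-! ### Numerical bounds and the main theorem -/

/-- The base is at least 2 even for `n = 0`, so coefficients and sums are absorbed by the exponent.
-/
theorem Polynomial.exists_eval_le_pow (π : Polynomial ℕ) : ∃ c, ∀ n, π.eval n ≤ (n + 2) ^ c := by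
  induction π using Polynomial.induction_on' with
  | add π π' h h' =>
    obtain ⟨c, hc⟩ := h
    obtain ⟨c', hc'⟩ := h'
    refine ⟨c + c' + 1, fun n => ?_⟩
    have h1 : (n + 2) ^ c ≤ (n + 2) ^ (c + c') := Nat.pow_le_pow_right (by omega) (by omega)
    have h2 : (n + 2) ^ c' ≤ (n + 2) ^ (c + c') := Nat.pow_le_pow_right (by omega) (by omega)
    have := hc n
    have := hc' n
    rw [Polynomial.eval_add, pow_succ]
    nlinarith
  | monomial m a =>
    refine ⟨a + m, fun n => ?_⟩
    rw [Polynomial.eval_monomial, pow_add]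
    have h1 : a ≤ (n + 2) ^ a :=
      Nat.lt_two_pow_self.le.trans (Nat.pow_le_pow_left (by omega) a)
    exact Nat.mul_le_mul h1 (Nat.pow_le_pow_left (by omega) m)

theorem Nat.log_two_add_two_le (n : ℕ) : Nat.log 2 (n + 2) ≤ Nat.log 2 n + 2 := by
  rcases n.eq_zero_or_pos with rfl | hn
  · exact (Nat.log_lt_self 2 (by omega)).le
  · rw [show Nat.log 2 n + 2 = Nat.log 2 n + 1 + 1 from rfl,
      ← Nat.log_mul_base (by omega) hn.ne', ← Nat.log_mul_base (by omega) (by omega)]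
    exact Nat.log_mono_right (by omega)

/-- With `m = Nat.log 2 n`, the width plus one is at most `(3 * k + 2) * (m + 1)`; squaring and `(m
+ 1) ^ 2 ≤ 2 * m ^ 2 + 2` give the constant, with the 4 absorbing the lower-order terms. -/
theorem CFProgram.space_of_le_maxWidth {k n W l : ℕ} (hW : W ≤ CFProgram.maxWidth k n)
    (hl : l ≤ W) :
    W + 2 < (2 * (3 * k + 2) ^ 2 + 4) * Nat.log 2 n ^ 2 + (2 * (3 * k + 2) ^ 2 + 4) ∧
      (l + 1) * W + 1 < (2 * (3 * k + 2) ^ 2 + 4) * Nat.log 2 n ^ 2 + (2 * (3 * k + 2) ^ 2 + 4) := by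
  have h1 := Nat.log_two_add_two_le n
  set m := Nat.log 2 n
  have h2 : W + 1 ≤ (3 * k + 2) * (m + 1) := by
    have : k * (Nat.log 2 (n + 2) + 1) ≤ k * (m + 3) := Nat.mul_le_mul_left k (by omega)
    rw [CFProgram.maxWidth] at hW
    nlinarith
  have h3 : (W + 1) * (W + 1) ≤ ((3 * k + 2) * (m + 1)) * ((3 * k + 2) * (m + 1)) :=
    Nat.mul_le_mul h2 h2
  have h4 : ((3 * k + 2) * (m + 1)) * ((3 * k + 2) * (m + 1)) ≤
      (3 * k + 2) ^ 2 * (2 * m ^ 2 + 2) := by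
    rw [show ((3 * k + 2) * (m + 1)) * ((3 * k + 2) * (m + 1)) =
      (3 * k + 2) ^ 2 * (m + 1) ^ 2 by ring]
    refine Nat.mul_le_mul_left _ ?_
    have := two_mul_le_add_sq m 1
    nlinarith
  have h5 : (l + 1) * W ≤ (W + 1) * (W + 1) := Nat.mul_le_mul (by omega) (by omega)
  have h6 : W + 1 ≤ (W + 1) * (W + 1) := Nat.le_mul_self _
  constructor <;> nlinarith

theorem mainTheorem1 : decidedBy CFpoly ⊆ NSPACE (fun n => Nat.log 2 n ^ 2) := by
  rintro X ⟨p, ⟨π, hπ⟩, hX⟩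
  obtain ⟨c, hc⟩ := π.exists_eval_le_pow
  let κ := ∑ f, p.arity f + 2
  have hκ : ∀ f, p.arity f + 2 ≤ κ := fun f => Nat.add_le_add_right
    (Finset.single_le_sum (f := p.arity) (fun _ _ => Nat.zero_le _) (Finset.mem_univ f)) 2
  -- The time is at most `2 ^ (j * c)` whenever `x.length + 2 ≤ 2 ^ j`, so `κ * (j * c + 1)` frames
  -- suffice; since `1 ≤ j`, this is at most `k * j`.
  let k := κ * (c + 1)
  have hk : 0 < k := Nat.mul_pos (by omega) (by omega)
  obtain ⟨M, hM⟩ := RegProgram.exists_NTM (p.verifier k)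
  refine ⟨M, fun x => ?_, 2 * (3 * k + 2) ^ 2 + 4, fun x => ?_⟩
  · rw [(hM x fun c l hc => (CFProgram.verifier_space hc).2.2 l).1]
    constructor
    · intro hx
      obtain ⟨v, t, ⟨T, rfl⟩, ht⟩ := hπ x
      obtain ⟨-, T', -⟩ := (hX x).1 hx
      -- The tree with the time bound and the tree that decides membership are given separately;
      -- determinism identifies their values.
      obtain rfl := T.unique T'
      refine CFProgram.verifier_complete hκ hk T fun j hj => ?_
      have hT : T.size ≤ 2 ^ (j * c) := by
        rw [pow_mul]
        have := (hc x.length).trans (Nat.pow_le_pow_left hj c)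
        omega
      have hlog : Nat.log 2 T.size ≤ j * c :=
        (Nat.log_mono_right hT).trans (Nat.log_pow (by omega) _).le
      have hj1 : 1 ≤ j := Nat.one_le_iff_ne_zero.2 (by rintro rfl; omega)
      rw [show k * j = κ * (j * c + j) by ring]
      exact Nat.mul_le_mul_left κ (by omega)
    · rintro ⟨s, hs⟩
      obtain ⟨T⟩ := CFProgram.verifier_sound hs
      by_contra hx
      obtain ⟨-, T', -⟩ := (hX x).2 hx
      cases T.unique T'
  · refine (hM x fun c l hc => (CFProgram.verifier_space hc).2.2 l).2 _ fun c hc => ?_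
    obtain ⟨h1, h2, -⟩ := CFProgram.verifier_space hc
    exact CFProgram.space_of_le_maxWidth h1 h2
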